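/- Let $G=SU(2,1)=\{x\in SL(3,\mathbb C)\mid x^*\gamma x=\gamma\}$ with $\gamma=\operatorname{diag}(1,1,-1)$, and let $K=\{x\in G\mid x^*x=1\}$ be its maximal compact subgroup of fixed points of the Cartan involution $x\mapsto (x^*)^{-1}$. Let $\mathfrak g=\mathfrak{sl}(3,\mathbb C)$ be the complexified Lie algebra of $G$, and let $\mathfrak g=\mathfrak k\oplus\mathfrak p$ be the corresponding Cartan decomposition. Let $e_{ij}$ be the matrix units and put $$H_1=\tfrac13(2e_{11}-e_{22}-e_{33}),\quad H_2=\tfrac13(-e_{11}+2e_{22}-e_{33}),\quad H=H_1-H_2,$$ $$E=e_{12},\quad F=e_{21},\quad E_1=e_{13},\quad E_2=e_{23},\quad F_1=e_{31},\quad F_2=e_{32},$$ so that $\mathfrak p=\operatorname{span}\{E_1,E_2,F_1,F_2\}$. Let $U(\mathfrak g)$ be the universal enveloping algebra of $\mathfrak g$, and let $C(\mathfrak p)$ be the Clifford algebra of $\mathfrak p$ with respect to the trace form $B(X,Y)=\operatorname{tr}(XY)$, with the convention $XY+YX=-2B(X,Y)$. The group $K$ acts on $U(\mathfrak g)$ by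 $\operatorname{Ad}$ and on $U(\mathfrak g)\otimes C(\mathfrak p)$ (tensor product over $\mathbb C$) by $\operatorname{Ad}\otimes\operatorname{Ad}$; a superscript $K$ denotes the algebra of $K$-invariants. The algebra $(U(\mathfrak g)\otimes C(\mathfrak p))^K$ is a left module over $U(\mathfrak g)^K$ through multiplication by $u\otimes 1$. Put \begin{align*} \tilde a&=(H_1+H_2)\otimes 1,\\ \tilde b&=(H^2+2(EF+FE))\otimes 1,\\ \tilde c&=(E_1F_1+E_2F_2)\otimes 1,\\ \tilde d&=(2EE_2F_1+HE_1F_1-HE_2F_2+2FE_1F_2)\otimes 1,\\ \tilde e&=F_1\otimes E_1+F_2\otimes E_2,\\ \tilde f&=E_1\otimes F_1+E_2\otimes F_2,\\ \tilde g&=1\otimes(E_1F_1+E_2F_2),\\ \tilde h&=(2EE_2+HE_1)\otimes F_1+(-HE_2+2FE_1)\otimes F_2,\\ \tilde i&=2E\otimes E_2F_1+H\otimes E_1F_1-H\otimes E_2F_2+2F\otimes E_1F_2,\\ \tilde j&=(HF_1+2FF_2)\otimes E_1+(2EF_1-HF_2)\otimes E_2. \end{align*} **Corollary.** The algebra $(U(\mathfrak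 g)\otimes C(\mathfrak p))^K$ is a free module of rank $16$ over $U(\mathfrak g)^K$, and the $16$ elements of $$\tilde T=\{1,\tilde e,\tilde f,\tilde g,\tilde h,\tilde i,\tilde j,\tilde e\tilde f,\tilde e\tilde g,\tilde f\tilde g,\tilde g^2,\tilde e\tilde i,\tilde e\tilde j,\tilde f\tilde h,\tilde f\tilde i,\tilde f\tilde j\}$$ form a basis of this free module. Moreover, the products $\tilde a^{n_1}\tilde b^{n_2}\tilde c^{n_3}\tilde d^{n_4}\,t$ with $n_1,n_2,n_3,n_4\in\mathbb Z_{\ge 0}$ and $t\in\tilde T$ are pairwise distinct and form a basis of $(U(\mathfrak g)\otimes C(\mathfrak p))^K$ as a complex vector space. -/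

import Mathlib

open scoped TensorProduct Matrix

noncomputable section

namespace SU21

attribute [local instance 100] LieRing.ofAssociativeRing

/-- The Lie algebra `𝔤 = 𝔰𝔩(3, ℂ)`, the complexification of `𝔰𝔲(2,1)`. -/
abbrev g : Type := LieAlgebra.SpecialLinear.sl (Fin 3) ℂ

/-- The matrix `γ = diag(1, 1, -1)`. -/
def gam : Matrix (Fin 3) (Fin 3) ℂ := Matrix.diagonal ![1, 1, -1]

lemma gam_mul_gam : gam * gam = 1 := by
  ext i j; fin_cases i <;> fin_cases j <;> simp [gam]

/-- The real Lie group `G = SU(2,1)`, as a subgroup of `SL(3, ℂ)`. -/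
def G : Subgroup (Matrix.SpecialLinearGroup (Fin 3) ℂ) where
  carrier := {x | (x : Matrix (Fin 3) (Fin 3) ℂ)ᴴ * gam * (x : Matrix (Fin 3) (Fin 3) ℂ) = gam}
  one_mem' := by simp
  mul_mem' := by
    intro x y hx hy
    simp only [Set.mem_ofPred_eq, Matrix.SpecialLinearGroup.coe_mul,
      Matrix.conjTranspose_mul] at *
    calc _ = (y : Matrix (Fin 3) (Fin 3) ℂ)ᴴ *
          ((x : Matrix (Fin 3) (Fin 3) ℂ)ᴴ * gam * (x : Matrix (Fin 3) (Fin 3) ℂ)) *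
          (y : Matrix (Fin 3) (Fin 3) ℂ) := by simp only [mul_assoc]
      _ = gam := by rw [hx, hy]
  inv_mem' := by
    intro x hx
    simp only [Set.mem_ofPred_eq] at *
    have h1 : (x : Matrix (Fin 3) (Fin 3) ℂ) *
        ((x⁻¹ : Matrix.SpecialLinearGroup (Fin 3) ℂ) : Matrix (Fin 3) (Fin 3) ℂ) = 1 := by
      rw [← Matrix.SpecialLinearGroup.coe_mul, mul_inv_cancel, Matrix.SpecialLinearGroup.coe_one]
    have h2 : ((x⁻¹ : Matrix.SpecialLinearGroup (Fin 3) ℂ) : Matrix (Fin 3) (Fin 3) ℂ)ᴴ *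
        (x : Matrix (Fin 3) (Fin 3) ℂ)ᴴ = 1 := by
      rw [← Matrix.conjTranspose_mul, h1, Matrix.conjTranspose_one]
    generalize ((x⁻¹ : Matrix.SpecialLinearGroup (Fin 3) ℂ) : Matrix (Fin 3) (Fin 3) ℂ) = y at *
    calc yᴴ * gam * y = yᴴ * ((x : Matrix (Fin 3) (Fin 3) ℂ)ᴴ * gam *
          (x : Matrix (Fin 3) (Fin 3) ℂ)) * y := by rw [hx]
      _ = (yᴴ * (x : Matrix (Fin 3) (Fin 3) ℂ)ᴴ) * gam *
          ((x : Matrix (Fin 3) (Fin 3) ℂ) * y) := by simp only [mul_assoc]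
      _ = gam := by rw [h1, h2, one_mul, mul_one]

/-- The maximal compact subgroup `K = G^Θ` of fixed points of the Cartan involution
`Θ(x) = (x*)⁻¹`, i.e. the elements of `SU(2,1)` that satisfy `x* x = 1`. -/
def K : Subgroup (Matrix.SpecialLinearGroup (Fin 3) ℂ) where
  carrier := {x | x ∈ G ∧
    (x : Matrix (Fin 3) (Fin 3) ℂ)ᴴ * (x : Matrix (Fin 3) (Fin 3) ℂ) = 1}
  one_mem' := ⟨G.one_mem, by simp⟩
  mul_mem' := by
    rintro x y ⟨hx, hx'⟩ ⟨hy, hy'⟩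
    refine ⟨G.mul_mem hx hy, ?_⟩
    rw [Matrix.SpecialLinearGroup.coe_mul, Matrix.conjTranspose_mul, mul_assoc,
      ← mul_assoc _ (x : Matrix (Fin 3) (Fin 3) ℂ), hx', one_mul, hy']
  inv_mem' := by
    rintro x ⟨hx, hx'⟩
    refine ⟨G.inv_mem hx, ?_⟩
    have h1 : (x : Matrix (Fin 3) (Fin 3) ℂ) *
        ((x⁻¹ : Matrix.SpecialLinearGroup (Fin 3) ℂ) : Matrix (Fin 3) (Fin 3) ℂ) = 1 := by
      rw [← Matrix.SpecialLinearGroup.coe_mul, mul_inv_cancel, Matrix.SpecialLinearGroup.coe_one]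
    have h2 : ((x⁻¹ : Matrix.SpecialLinearGroup (Fin 3) ℂ) : Matrix (Fin 3) (Fin 3) ℂ) =
        (x : Matrix (Fin 3) (Fin 3) ℂ)ᴴ := by
      rw [← one_mul ((x⁻¹ : Matrix.SpecialLinearGroup (Fin 3) ℂ) : Matrix (Fin 3) (Fin 3) ℂ),
        ← hx', mul_assoc, h1, mul_one]
    rw [h2, Matrix.conjTranspose_conjTranspose, ← h2, h1]

/-- An element of `K` commutes with `γ`. -/
lemma gam_comm {x : Matrix.SpecialLinearGroup (Fin 3) ℂ} (hx : x ∈ K) :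
    gam * (x : Matrix (Fin 3) (Fin 3) ℂ) = (x : Matrix (Fin 3) (Fin 3) ℂ) * gam := by
  obtain ⟨h, h'⟩ := hx
  have h1 : (x : Matrix (Fin 3) (Fin 3) ℂ)ᴴ * gam * (x : Matrix (Fin 3) (Fin 3) ℂ) = gam := h
  have h2 : (x : Matrix (Fin 3) (Fin 3) ℂ) * (x : Matrix (Fin 3) (Fin 3) ℂ)ᴴ = 1 :=
    mul_eq_one_comm.mp h'
  calc gam * (x : Matrix (Fin 3) (Fin 3) ℂ)
      = ((x : Matrix (Fin 3) (Fin 3) ℂ) * (x : Matrix (Fin 3) (Fin 3) ℂ)ᴴ) * gam *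
          (x : Matrix (Fin 3) (Fin 3) ℂ) := by rw [h2, one_mul]
    _ = (x : Matrix (Fin 3) (Fin 3) ℂ) * ((x : Matrix (Fin 3) (Fin 3) ℂ)ᴴ * gam *
          (x : Matrix (Fin 3) (Fin 3) ℂ)) := by simp only [mul_assoc]
    _ = _ := by rw [h1]

lemma coe_inv_mul_coe (x : Matrix.SpecialLinearGroup (Fin 3) ℂ) :
    ((x⁻¹ : Matrix.SpecialLinearGroup (Fin 3) ℂ) : Matrix (Fin 3) (Fin 3) ℂ) *
      (x : Matrix (Fin 3) (Fin 3) ℂ) = 1 := by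
  rw [← Matrix.SpecialLinearGroup.coe_mul, inv_mul_cancel, Matrix.SpecialLinearGroup.coe_one]

/-- The adjoint action `Ad(x) X = x X x⁻¹` on `𝔤`. -/
def adg (x : Matrix.SpecialLinearGroup (Fin 3) ℂ) : g →ₗ⁅ℂ⁆ g where
  toFun X := ⟨(x : Matrix (Fin 3) (Fin 3) ℂ) * (X : Matrix (Fin 3) (Fin 3) ℂ) *
      ((x⁻¹ : Matrix.SpecialLinearGroup (Fin 3) ℂ) : Matrix (Fin 3) (Fin 3) ℂ), by
    have hX : Matrix.trace (X : Matrix (Fin 3) (Fin 3) ℂ) = 0 := X.2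
    change Matrix.trace ((x : Matrix (Fin 3) (Fin 3) ℂ) * (X : Matrix (Fin 3) (Fin 3) ℂ) *
      ((x⁻¹ : Matrix.SpecialLinearGroup (Fin 3) ℂ) : Matrix (Fin 3) (Fin 3) ℂ)) = 0
    rw [Matrix.trace_mul_comm, ← mul_assoc, coe_inv_mul_coe, one_mul, hX]⟩
  map_add' X Y := by
    apply Subtype.ext
    simp [mul_add, add_mul]
  map_smul' c X := by
    apply Subtype.ext
    simp
  map_lie' {X Y} := by
    apply Subtype.ext
    have key : ∀ A B : Matrix (Fin 3) (Fin 3) ℂ,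
        (x : Matrix (Fin 3) (Fin 3) ℂ) * (A * B) *
          ((x⁻¹ : Matrix.SpecialLinearGroup (Fin 3) ℂ) : Matrix (Fin 3) (Fin 3) ℂ) =
        ((x : Matrix (Fin 3) (Fin 3) ℂ) * A *
          ((x⁻¹ : Matrix.SpecialLinearGroup (Fin 3) ℂ) : Matrix (Fin 3) (Fin 3) ℂ)) *
        ((x : Matrix (Fin 3) (Fin 3) ℂ) * B *
          ((x⁻¹ : Matrix.SpecialLinearGroup (Fin 3) ℂ) : Matrix (Fin 3) (Fin 3) ℂ)) := by
      intro A B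
      rw [mul_assoc _ B, mul_assoc (_ * A), ← mul_assoc _ (x : Matrix (Fin 3) (Fin 3) ℂ),
        coe_inv_mul_coe, one_mul]
      simp only [mul_assoc]
    simp only [LieAlgebra.SpecialLinear.sl_bracket, mul_sub, sub_mul, key]

/-- The space `𝔭`: the `-1`-eigenspace in `𝔤` of the complexified Cartan involution
`X ↦ γ X γ` (on `𝔰𝔲(2,1)` this involution is `X ↦ -X*`). -/
def p : Submodule ℂ g where
  carrier := {X | gam * (X : Matrix (Fin 3) (Fin 3) ℂ) * gam = -(X : Matrix (Fin 3) (Fin 3) ℂ)}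
  add_mem' := by
    intro X Y hX hY
    change gam * (X.1 + Y.1) * gam = -(X.1 + Y.1)
    rw [mul_add, add_mul, neg_add, hX, hY]
  zero_mem' := by
    change gam * 0 * gam = -0
    simp
  smul_mem' := by
    intro c X hX
    change gam * (c • X.1) * gam = -(c • X.1)
    rw [Matrix.mul_smul, Matrix.smul_mul, hX, smul_neg]

/-- The trace form `B(X, Y) = tr(XY)` on `𝔭`. -/
def B : LinearMap.BilinForm ℂ p :=
  LinearMap.mk₂ ℂ (fun X Y : p =>
      Matrix.trace ((X : g) * (Y : g) : Matrix (Fin 3) (Fin 3) ℂ))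
    (by intro X Y Z; simp [add_mul])
    (by intro c X Y; simp)
    (by intro X Y Z; simp [mul_add])
    (by intro c X Y; simp)

/-- The quadratic form `X ↦ -B(X, X)` on `𝔭`. -/
def Q : QuadraticForm ℂ p := -(LinearMap.BilinMap.toQuadraticMap B)

lemma Q_apply (X : p) :
    Q X = -Matrix.trace ((X : g) * (X : g) : Matrix (Fin 3) (Fin 3) ℂ) := rfl

/-- The universal enveloping algebra `U(𝔤)`. -/
abbrev U : Type := UniversalEnvelopingAlgebra ℂ g

/-- The Clifford algebra `C(𝔭)` of `𝔭` with respect to the trace form, with the sign convention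
`X Y + Y X = -2 B(X, Y)`. -/
abbrev C : Type := CliffordAlgebra Q

/-- The algebra `U(𝔤) ⊗ C(𝔭)`. -/
abbrev UC : Type := U ⊗[ℂ] C

lemma adg_mem_p (x : K) (X : p) : adg x X ∈ p := by
  have hX : gam * ((X : g) : Matrix (Fin 3) (Fin 3) ℂ) * gam =
    -((X : g) : Matrix (Fin 3) (Fin 3) ℂ) := X.2
  have h1 := gam_comm x.2
  have h2 := gam_comm (K.inv_mem x.2)
  change gam * (((x : Matrix.SpecialLinearGroup (Fin 3) ℂ) : Matrix (Fin 3) (Fin 3) ℂ) *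
    ((X : g) : Matrix (Fin 3) (Fin 3) ℂ) *
    (((x : Matrix.SpecialLinearGroup (Fin 3) ℂ)⁻¹ : Matrix.SpecialLinearGroup (Fin 3) ℂ) :
      Matrix (Fin 3) (Fin 3) ℂ)) * gam = -(_ * _ * _)
  rw [mul_assoc, mul_assoc _ _ gam, ← h2, ← mul_assoc gam, ← mul_assoc gam, h1,
    ← neg_mul, ← mul_neg, ← hX]
  simp only [mul_assoc]

lemma trace_conj_sq (x : Matrix.SpecialLinearGroup (Fin 3) ℂ) (A : Matrix (Fin 3) (Fin 3) ℂ) :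
    Matrix.trace (((x : Matrix (Fin 3) (Fin 3) ℂ) * A *
        ((x⁻¹ : Matrix.SpecialLinearGroup (Fin 3) ℂ) : Matrix (Fin 3) (Fin 3) ℂ)) *
      ((x : Matrix (Fin 3) (Fin 3) ℂ) * A *
        ((x⁻¹ : Matrix.SpecialLinearGroup (Fin 3) ℂ) : Matrix (Fin 3) (Fin 3) ℂ))) =
      Matrix.trace (A * A) := by
  have h := coe_inv_mul_coe x
  generalize ((x⁻¹ : Matrix.SpecialLinearGroup (Fin 3) ℂ) : Matrix (Fin 3) (Fin 3) ℂ) = y at *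
  generalize (x : Matrix (Fin 3) (Fin 3) ℂ) = z at *
  calc Matrix.trace ((z * A * y) * (z * A * y))
      = Matrix.trace (z * A * (y * z) * (A * y)) := by simp only [mul_assoc]
    _ = Matrix.trace (A * y * (z * A)) := by rw [h, mul_one, Matrix.trace_mul_comm]
    _ = Matrix.trace (A * (y * z) * A) := by simp only [mul_assoc]
    _ = Matrix.trace (A * A) := by rw [h, mul_one]

/-- The adjoint action of `x ∈ K` on `𝔭`, an isometry of `𝔭`. -/
def adp (x : K) : Q →qᵢ Q where
  toLinearMap := ((adg x : g →ₗ[ℂ] g).comp p.subtype).codRestrict p (adg_mem_p x)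
  map_app' := by
    intro X
    exact congrArg Neg.neg (trace_conj_sq x X.1.1)

/-- The action of `x ∈ K` on `U(𝔤)` by algebra automorphisms that extends `Ad` on `𝔤`. -/
def adU (x : K) : U →ₐ[ℂ] U :=
  UniversalEnvelopingAlgebra.lift ℂ ((UniversalEnvelopingAlgebra.ι ℂ).comp (adg x))

/-- The action of `x ∈ K` on `C(𝔭)` by algebra automorphisms that extends `Ad` on `𝔭`. -/
def adC (x : K) : C →ₐ[ℂ] C := CliffordAlgebra.map (adp x)

/-- The action `Ad ⊗ Ad` of `x ∈ K` on `U(𝔤) ⊗ C(𝔭)`. -/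
def adUC (x : K) : UC →ₐ[ℂ] UC := Algebra.TensorProduct.map (adU x) (adC x)

/-- The algebra of invariants `U(𝔤)^K`. -/
def UK : Subalgebra ℂ U where
  carrier := {u | ∀ x : K, adU x u = u}
  mul_mem' := by intro u v hu hv x; rw [map_mul, hu x, hv x]
  add_mem' := by intro u v hu hv x; rw [map_add, hu x, hv x]
  algebraMap_mem' := by intro c x; exact AlgHom.commutes _ c

/-- The algebra of invariants `(U(𝔤) ⊗ C(𝔭))^K`. -/
def UCK : Subalgebra ℂ UC where
  carrier := {u | ∀ x : K, adUC x u = u}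
  mul_mem' := by intro u v hu hv x; rw [map_mul, hu x, hv x]
  add_mem' := by intro u v hu hv x; rw [map_add, hu x, hv x]
  algebraMap_mem' := by intro c x; exact AlgHom.commutes _ c

/-- The inclusion `U(𝔤)^K → (U(𝔤) ⊗ C(𝔭))^K`, `u ↦ u ⊗ 1`. -/
def incl : UK →ₐ[ℂ] UCK :=
  ((Algebra.TensorProduct.includeLeft : U →ₐ[ℂ] UC).comp UK.val).codRestrict UCK (by
    intro u x
    change adUC x ((u : U) ⊗ₜ[ℂ] (1 : C)) = (u : U) ⊗ₜ[ℂ] (1 : C)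
    rw [adUC, Algebra.TensorProduct.map_tmul, map_one, u.2 x])

/-- `(U(𝔤) ⊗ C(𝔭))^K` as a (left) module over its subalgebra `U(𝔤)^K`. -/
instance instModuleUCK : Module UK UCK := Module.compHom UCK (incl : UK →+* UCK)

lemma coe_smul (u : UK) (y : UCK) :
    ((u • y : UCK) : UC) = ((u : U) ⊗ₜ[ℂ] (1 : C)) * (y : UC) := rfl

/-! The basis of `𝔤` and the subspace `𝔭`. -/

lemma mem_g {X : Matrix (Fin 3) (Fin 3) ℂ} (h : X 0 0 + X 1 1 + X 2 2 = 0) :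
    X ∈ LieAlgebra.SpecialLinear.sl (Fin 3) ℂ := by
  change Matrix.trace X = 0
  rw [Matrix.trace_fin_three, h]

def H₁ : g := ⟨!![2/3, 0, 0; 0, -1/3, 0; 0, 0, -1/3], mem_g (by simp; try norm_num)⟩
def H₂ : g := ⟨!![-1/3, 0, 0; 0, 2/3, 0; 0, 0, -1/3], mem_g (by simp; try norm_num)⟩
def E : g := ⟨!![0, 1, 0; 0, 0, 0; 0, 0, 0], mem_g (by simp; try norm_num)⟩
def F : g := ⟨!![0, 0, 0; 1, 0, 0; 0, 0, 0], mem_g (by simp; try norm_num)⟩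
def E₁ : g := ⟨!![0, 0, 1; 0, 0, 0; 0, 0, 0], mem_g (by simp; try norm_num)⟩
def E₂ : g := ⟨!![0, 0, 0; 0, 0, 1; 0, 0, 0], mem_g (by simp; try norm_num)⟩
def F₁ : g := ⟨!![0, 0, 0; 0, 0, 0; 1, 0, 0], mem_g (by simp; try norm_num)⟩
def F₂ : g := ⟨!![0, 0, 0; 0, 0, 0; 0, 1, 0], mem_g (by simp; try norm_num)⟩
def H : g := H₁ - H₂

lemma mem_p_iff (X : g) : X ∈ p ↔
    X.1 0 0 = 0 ∧ X.1 0 1 = 0 ∧ X.1 1 0 = 0 ∧ X.1 1 1 = 0 ∧ X.1 2 2 = 0 := by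
  change gam * X.1 * gam = -X.1 ↔ _
  constructor
  · intro h
    refine ⟨?_, ?_, ?_, ?_, ?_⟩
    · simpa [gam, self_eq_neg] using congrFun (congrFun h 0) 0
    · simpa [gam, self_eq_neg] using congrFun (congrFun h 0) 1
    · simpa [gam, self_eq_neg] using congrFun (congrFun h 1) 0
    · simpa [gam, self_eq_neg] using congrFun (congrFun h 1) 1
    · simpa [gam, self_eq_neg] using congrFun (congrFun h 2) 2
  · rintro ⟨h1, h2, h3, h4, h5⟩
    ext i j
    fin_cases i <;> fin_cases j <;>
      simp [gam, h1, h2, h3, h4, h5]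

lemma E₁_mem : E₁ ∈ p := by rw [mem_p_iff]; simp [E₁]
lemma E₂_mem : E₂ ∈ p := by rw [mem_p_iff]; simp [E₂]
lemma F₁_mem : F₁ ∈ p := by rw [mem_p_iff]; simp [F₁]
lemma F₂_mem : F₂ ∈ p := by rw [mem_p_iff]; simp [F₂]

/-- `𝔭 = span {E₁, E₂, F₁, F₂}`. -/
lemma p_eq_span : p = Submodule.span ℂ {E₁, E₂, F₁, F₂} := by
  apply le_antisymm
  · intro X hX
    rw [mem_p_iff] at hX
    obtain ⟨h1, h2, h3, h4, h5⟩ := hX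
    have : X = X.1 0 2 • E₁ + (X.1 1 2 • E₂ + (X.1 2 0 • F₁ + X.1 2 1 • F₂)) := by
      apply Subtype.ext
      ext i j
      fin_cases i <;> fin_cases j <;> simp [E₁, E₂, F₁, F₂, h1, h2, h3, h4, h5]
    rw [this]
    refine add_mem (Submodule.smul_mem _ _ (Submodule.subset_span (by simp))) (add_mem
      (Submodule.smul_mem _ _ (Submodule.subset_span (by simp))) (add_mem
      (Submodule.smul_mem _ _ (Submodule.subset_span (by simp)))
      (Submodule.smul_mem _ _ (Submodule.subset_span (by simp)))))
  · rw [Submodule.span_le]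
    rintro X (rfl | rfl | rfl | rfl)
    · exact E₁_mem
    · exact E₂_mem
    · exact F₁_mem
    · exact F₂_mem

/-- The canonical map `𝔤 → U(𝔤)`. -/
abbrev u (X : g) : U := UniversalEnvelopingAlgebra.ι ℂ X

/-! The images of `E₁, E₂, F₁, F₂ ∈ 𝔭` in `C(𝔭)`. -/

def cE₁ : C := CliffordAlgebra.ι Q ⟨E₁, E₁_mem⟩
def cE₂ : C := CliffordAlgebra.ι Q ⟨E₂, E₂_mem⟩
def cF₁ : C := CliffordAlgebra.ι Q ⟨F₁, F₁_mem⟩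
def cF₂ : C := CliffordAlgebra.ι Q ⟨F₂, F₂_mem⟩

/-! The elements `ã, …, j̃` of `U(𝔤) ⊗ C(𝔭)`. -/

def ta : UC := (u H₁ + u H₂) ⊗ₜ[ℂ] 1
def tb : UC := (u H ^ 2 + 2 * (u E * u F + u F * u E)) ⊗ₜ[ℂ] 1
def tc : UC := (u E₁ * u F₁ + u E₂ * u F₂) ⊗ₜ[ℂ] 1
def td : UC :=
  (2 * u E * u E₂ * u F₁ + u H * u E₁ * u F₁ - u H * u E₂ * u F₂ + 2 * u F * u E₁ * u F₂) ⊗ₜ[ℂ] 1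
def te : UC := u F₁ ⊗ₜ[ℂ] cE₁ + u F₂ ⊗ₜ[ℂ] cE₂
def tf : UC := u E₁ ⊗ₜ[ℂ] cF₁ + u E₂ ⊗ₜ[ℂ] cF₂
def tg : UC := 1 ⊗ₜ[ℂ] (cE₁ * cF₁ + cE₂ * cF₂)
def th : UC :=
  (2 * u E * u E₂ + u H * u E₁) ⊗ₜ[ℂ] cF₁ + (-(u H * u E₂) + 2 * u F * u E₁) ⊗ₜ[ℂ] cF₂
def ti : UC :=
  (2 * u E) ⊗ₜ[ℂ] (cE₂ * cF₁) + u H ⊗ₜ[ℂ] (cE₁ * cF₁) - u H ⊗ₜ[ℂ] (cE₂ * cF₂)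
    + (2 * u F) ⊗ₜ[ℂ] (cE₁ * cF₂)
def tj : UC :=
  (u H * u F₁ + 2 * u F * u F₂) ⊗ₜ[ℂ] cE₁ + (2 * u E * u F₁ - u H * u F₂) ⊗ₜ[ℂ] cE₂

/-- The sixteen elements of `T̃`. -/
def T : Fin 16 → UC :=
  ![1, te, tf, tg, th, ti, tj, te * tf, te * tg, tf * tg, tg ^ 2, te * ti, te * tj,
    tf * th, tf * ti, tf * tj]

/-- The monomials `ã^n₁ b̃^n₂ c̃^n₃ d̃^n₄` of `S̃`. -/
def S (n : Fin 4 → ℕ) : UC := ta ^ n 0 * tb ^ n 1 * tc ^ n 2 * td ^ n 3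

end SU21

end

/-!
The proof passes to symbols, that is, to the associated graded algebra `S(𝔤) = ℂ[x₀, …, x₇]` of
`U(𝔤)`, and to matrices over it.

*Symbols.* Let `X ∈ 𝔤` act on the polynomial functions of a `3 × 3` matrix as a left-invariant
vector field. Applied to the `n`-th power of a generic linear form that vanishes at the identity
matrix, an element of `U(𝔤)` of degree at most `n` takes at the identity the value `n!` times its
symbol. This gives linear maps `symb n : U(𝔤) → S(𝔤)`, multiplicative on the filtration
(`symb_mul`), whose kernel on elements of degree at most `n` is the space of elements of lower
degree (`mem_filLT_of_symb_eq_zero`, the Poincaré–Birkhoff–Witt theorem).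

*Spinors.* `C(𝔭)` is the full algebra of endomorphisms of the spin module `Λ(𝔭⁺)` of dimension `4`,
so `U(𝔤) ⊗ C(𝔭)` is the algebra of `4 × 4` matrices over `U(𝔤)` (`toMat`). An element of `K` acts on
`𝔤` as conjugation by `diag(a, 1)` with `a ∈ U(2)`, and it acts on the spin module by
`diag(1, a, det a)` up to a scalar (`ConjBy.toMat_adUC`). The symbol of an element of
`(U(𝔤) ⊗ C(𝔭))^K` is therefore a `4 × 4` matrix of polynomials that is equivariant under `U(2)`, and
under almost all of `GL(2, ℂ)` by density of the real points in the Cayley parametrization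
(`UEquivariant.extend`).

*Covariants.* A point of `𝔤*` is a scalar `x₀`, a traceless `2 × 2` matrix `Y`, a column `y` and a
row `z`. The points for which `y` and `Yy` are the standard basis form a slice, and the element
`a = (y | Yy)` of `GL(2, ℂ)` moves a generic point to it; so an equivariant matrix is determined by
its restriction to the slice (`UEquivariant.mul_frameY`), whose coordinates are the four invariants
`x₀, tr Y²/2, zy, zYy`, the symbols of `ã, b̃, c̃, d̃`. The same holds for `z` and `zY`
(`UEquivariant.frameZ_mul`). Comparison of the two slices and divisibility in polynomial rings show
that the equivariant matrices are the combinations, with coefficients polynomial in the four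
invariants, of the symbols of the elements of `T̃` (`UEquivariant.exists_comb`). The coefficients
are unique (`symT_independent`).

*Conclusion.* By induction on the degree, the products `S n * T i` span the invariants
(`UCK_le_span`), and a linear relation among them would give one among their symbols of highest
degree (`S_mul_T_linearIndependent`). In the same way the monomials in the generators span `U(𝔤)^K`
(`UK_le_span`), hence `T̃` is a basis over `U(𝔤)^K`. This algebra is commutative by Gelfand's trick:
the anti-automorphism of `U(𝔤)` given by the transposition of matrices fixes the symbols of the
invariants, and being an involution it fixes the invariants themselves (`trU_eq`). So the rank is
well defined, and it is `16`.
-/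

open scoped TensorProduct Matrix

noncomputable section

namespace SU21

attribute [local instance 100] LieRing.ofAssociativeRing

/-! ### Symbols of elements of the enveloping algebra -/

/-- The symmetric algebra `S(𝔤)`, as the polynomials in the elements of the basis `bas` of `𝔤`. -/
abbrev Pol : Type := MvPolynomial (Fin 8) ℂ

/-- The basis of `𝔤` to which the variables of `Pol` correspond. Its first element is `H₁ + H₂`,
which is central in `𝔨`. -/
def bas : Fin 8 → g := ![H₁ + H₂, H, E, F, E₁, E₂, F₁, F₂]

open MvPolynomial in
/-- A generic point of `𝔤*`: the entry `(i, j)` is the coefficient of the matrix entry `X i j` in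
the linear form that it defines on `𝔤`. -/
def lam : Matrix (Fin 3) (Fin 3) Pol :=
  !![(1 / 2 : ℂ) • X 0 + (1 / 2 : ℂ) • X 1, X 2, X 4;
     X 3, (1 / 2 : ℂ) • X 0 - (1 / 2 : ℂ) • X 1, X 5;
     X 6, X 7, - X 0]

/-- The inclusion of `𝔤` into `S(𝔤)`, `X ↦ ∑ X i j • lam i j`. -/
def sym : g →ₗ[ℂ] Pol where
  toFun X := ∑ i, ∑ j, (X : Matrix (Fin 3) (Fin 3) ℂ) i j • lam i j
  map_add' X Y := by simp [add_smul, Finset.sum_add_distrib]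
  map_smul' c X := by simp [mul_smul, Finset.smul_sum]

lemma sym_bas (i : Fin 8) : sym (bas i) = MvPolynomial.X i := by
  fin_cases i <;>
    simp [sym, bas, lam, Fin.sum_univ_three, H₁, H₂, H, E, F, E₁, E₂, F₁, F₂] <;>
    module

lemma eq_sum_bas (X : g) : ∃ c : Fin 8 → ℂ, X = ∑ i, c i • bas i := by
  have hX : Matrix.trace X.1 = 0 := X.2
  rw [Matrix.trace_fin_three] at hX
  refine ⟨![-3/2 * X.1 2 2, (X.1 0 0 - X.1 1 1)/2, X.1 0 1, X.1 1 0, X.1 0 2, X.1 1 2, X.1 2 0,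
    X.1 2 1], ?_⟩
  apply Subtype.ext
  ext i j
  fin_cases i <;> fin_cases j <;>
    simp [Fin.sum_univ_eight, bas, H₁, H₂, H, E, F, E₁, E₂, F₁, F₂] <;>
    first
    | ring1
    | linear_combination (-1/2) * hX
    | linear_combination (1/2) * hX

/-- Polynomial functions of a `3 × 3` matrix, with coefficients in `S(𝔤)`. -/
abbrev 𝒜 : Type := MvPolynomial (Fin 3 × Fin 3) Pol

open MvPolynomial in
/-- The left-invariant vector field on the space of matrices defined by `M`, the derivative along
`x ↦ x exp(t M)`. -/
def vf (M : Matrix (Fin 3) (Fin 3) ℂ) : Derivation Pol 𝒜 𝒜 :=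
  mkDerivation Pol fun ij => ∑ k, (M k ij.2) • (X (ij.1, k) : 𝒜)

lemma vf_X (M : Matrix (Fin 3) (Fin 3) ℂ) (ij : Fin 3 × Fin 3) :
    vf M (MvPolynomial.X ij) = ∑ k, (M k ij.2) • (MvPolynomial.X (ij.1, k) : 𝒜) :=
  MvPolynomial.mkDerivation_X _ _ _

/-- The representation of `𝔤` by left-invariant vector fields. -/
def vfHom : g →ₗ⁅ℂ⁆ Module.End Pol 𝒜 where
  toFun X := (vf X.1 : 𝒜 →ₗ[Pol] 𝒜)
  map_add' X Y := by
    have : vf (X + Y).1 = vf X.1 + vf Y.1 := by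
      apply MvPolynomial.derivation_ext
      intro i
      simp [vf_X, add_smul, Finset.sum_add_distrib]
    rw [this]; rfl
  map_smul' c X := by
    have : vf (c • X).1 = c • vf X.1 := by
      apply MvPolynomial.derivation_ext
      intro i
      simp [vf_X, mul_smul, Finset.smul_sum]
    rw [this]; rfl
  map_lie' {X Y} := by
    have : vf ⁅X, Y⁆.1 = ⁅vf X.1, vf Y.1⁆ := by
      apply MvPolynomial.derivation_ext
      intro i
      rw [Derivation.commutator_apply, LieAlgebra.SpecialLinear.sl_bracket]
      simp [vf_X, Fin.sum_univ_three, Matrix.mul_apply]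
      module
    change (vf ⁅X, Y⁆.1 : 𝒜 →ₗ[Pol] 𝒜) = _
    rw [this]; rfl

/-- Evaluation of a polynomial in the matrix entries at the identity matrix. -/
def evOne : 𝒜 →ₐ[Pol] Pol := MvPolynomial.aeval fun ij => if ij.1 = ij.2 then 1 else 0

/-- The ideal of functions that vanish at the identity matrix. -/
def mI : Ideal 𝒜 := RingHom.ker evOne

/-- A linear function of the matrix entries that vanishes at the identity and whose derivative
there along `X ∈ 𝔤` is `sym X`. -/
def ell : 𝒜 := ∑ i, ∑ j, MvPolynomial.C (lam i j) * MvPolynomial.X (i, j)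

lemma ell_mem : ell ∈ mI := by
  change evOne ell = 0
  simp [ell, evOne, lam, Fin.sum_univ_three]
  module

lemma evOne_vf_ell (X : g) : evOne (vf X.1 ell) = sym X := by
  simp [ell, Derivation.leibniz, vf_X, evOne, sym,
    MvPolynomial.derivation_C]
  simp [Algebra.smul_def, mul_comm]

lemma sub_C_evOne_mem (f : 𝒜) : f - MvPolynomial.C (evOne f) ∈ mI := by
  change evOne _ = 0
  simp [evOne]

lemma vf_pow_mem (M : Matrix (Fin 3) (Fin 3) ℂ) (n : ℕ) {f : 𝒜} (hf : f ∈ mI ^ (n + 1)) :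
    vf M f ∈ mI ^ n := by
  induction n generalizing f with
  | zero => simp
  | succ n ih =>
    rw [pow_succ] at hf
    induction hf using Submodule.mul_induction_on' with
    | mem_mul_mem a ha b hb =>
      rw [Derivation.leibniz]
      refine add_mem (Ideal.mul_mem_right _ _ ha) ?_
      rw [smul_eq_mul, mul_comm, pow_succ]
      exact Ideal.mul_mem_mul (ih ha) hb
    | add x hx y hy h1 h2 =>
      rw [map_add]; exact add_mem h1 h2

/-- The action of `U(𝔤)` on polynomial functions of a matrix, by differential operators. -/
def actU : U →ₐ[ℂ] Module.End Pol 𝒜 := UniversalEnvelopingAlgebra.lift ℂ vfHom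

lemma actU_u (X : g) (f : 𝒜) : actU (u X) f = vf X.1 f := by
  have : actU (u X) = vfHom X := UniversalEnvelopingAlgebra.lift_ι_apply ℂ vfHom X
  rw [this]; rfl

/-- The space of elements of `U(𝔤)` of degree at most `1`. -/
def lin : Submodule ℂ U :=
  1 ⊔ LinearMap.range ((UniversalEnvelopingAlgebra.ι ℂ : g →ₗ⁅ℂ⁆ U) : g →ₗ[ℂ] U)

/-- The standard filtration of `U(𝔤)`. -/
def fil (n : ℕ) : Submodule ℂ U := lin ^ n

lemma one_mem_lin : (1 : U) ∈ lin := Submodule.mem_sup_left (Submodule.one_le.1 le_rfl)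

lemma fil_mul {m n : ℕ} {v w : U} (hv : v ∈ fil m) (hw : w ∈ fil n) : v * w ∈ fil (m + n) := by
  rw [fil, pow_add]; exact Submodule.mul_mem_mul hv hw

lemma fil_mono : Monotone fil := by
  refine monotone_nat_of_le_succ fun n x hx => ?_
  simpa using fil_mul hx (show (1 : U) ∈ fil 1 by simpa [fil] using one_mem_lin)

lemma u_mem_fil (X : g) : u X ∈ fil 1 := by
  rw [fil, pow_one]
  exact Submodule.mem_sup_right ⟨X, rfl⟩

lemma one_mem_fil (n : ℕ) : (1 : U) ∈ fil n :=
  fil_mono (Nat.zero_le n) (by rw [fil, pow_zero]; exact Submodule.one_le.1 le_rfl)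

lemma fil_induction {p : ℕ → U → Prop} (h0 : ∀ c : ℂ, p 0 (algebraMap ℂ U c))
    (hadd : ∀ n v w, v ∈ fil n → w ∈ fil n → p n v → p n w → p n (v + w))
    (hmul : ∀ n (c : ℂ) (X : g) v, v ∈ fil n → p n v → p (n + 1) ((algebraMap ℂ U c + u X) * v))
    {n : ℕ} {v : U} (hv : v ∈ fil n) : p n v := by
  refine Submodule.pow_induction_on_left' lin (C := fun n v _ => p n v) h0
    (fun x y i hx hy h1 h2 => hadd _ _ _ hx hy h1 h2) ?_ hv
  intro m hm i x hx h
  obtain ⟨a, ha, b, ⟨X, rfl⟩, rfl⟩ := Submodule.mem_sup.1 hm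
  obtain ⟨c, rfl⟩ := Submodule.mem_one.1 ha
  exact hmul i c X x hx h

/-- The symbol in degree `n`: the value at the identity of `v` applied to `ell ^ n / n!`. It is a
meaningful symbol only for `v` of degree at most `n`. -/
def symb (n : ℕ) : U →ₗ[ℂ] Pol where
  toFun v := ((n.factorial : ℂ)⁻¹) • evOne (actU v (ell ^ n))
  map_add' v w := by rw [map_add, LinearMap.add_apply, map_add, smul_add]
  map_smul' c v := by
    have : evOne (actU (c • v) (ell ^ n)) = c • evOne (actU v (ell ^ n)) := by
      rw [map_smul, LinearMap.smul_apply, ← algebraMap_smul Pol c, map_smul, algebraMap_smul]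
    rw [this, smul_comm]; rfl

lemma symb_one : symb 0 1 = 1 := by
  change ((Nat.factorial 0 : ℂ)⁻¹) • evOne (actU 1 (ell ^ 0)) = 1
  rw [map_one, Module.End.one_apply, pow_zero, map_one]
  simp

lemma evOne_eq_zero_of_mem {f : 𝒜} (hf : f ∈ mI ^ 1) : evOne f = 0 := by
  rw [pow_one] at hf; exact hf

/-- `P` describes the leading term at the identity of `v` applied to all powers `ell ^ n`, `k ≤ n`.
The case `n = k` shows that `P` is `symb k v`; the other cases carry the induction on the degree. -/
def IsSymb (k : ℕ) (v : U) (P : Pol) : Prop :=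
  ∀ n, k ≤ n → actU v (ell ^ n) - ((n.descFactorial k : ℕ) : 𝒜) * MvPolynomial.C P * ell ^ (n - k)
    ∈ mI ^ (n - k + 1)

lemma IsSymb.symb_eq {k : ℕ} {v : U} {P : Pol} (h : IsSymb k v P) : symb k v = P := by
  have h1 := h k le_rfl
  rw [Nat.sub_self, pow_zero, mul_one, zero_add, Nat.descFactorial_self] at h1
  have h2 := evOne_eq_zero_of_mem h1
  rw [map_sub, sub_eq_zero] at h2
  change ((k.factorial : ℂ)⁻¹) • evOne (actU v (ell ^ k)) = P
  have h3 : evOne (MvPolynomial.C P) = P := by simp [evOne]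
  rw [h2, map_mul, map_natCast, h3, ← nsmul_eq_mul, ← Nat.cast_smul_eq_nsmul ℂ, smul_smul,
    inv_mul_cancel₀ (by exact_mod_cast k.factorial_ne_zero), one_smul]

lemma IsSymb.mul_left {k : ℕ} {v : U} {P : Pol} (h : IsSymb k v P) (c : ℂ) (X : g) :
    IsSymb (k + 1) ((algebraMap ℂ U c + u X) * v) (sym X * P) := by
  intro n hn
  obtain ⟨j, rfl⟩ := Nat.exists_eq_add_of_le hn
  have h1 := h (k + 1 + j) (by omega)
  have e1 : k + 1 + j - k = j + 1 := by omega
  have e2 : k + 1 + j - (k + 1) = j := by omega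
  rw [e1] at h1
  rw [e2, Nat.descFactorial_succ, e1]
  set D : 𝒜 := (((k + 1 + j).descFactorial k : ℕ) : 𝒜) with hD
  set f : 𝒜 := actU v (ell ^ (k + 1 + j)) with hf
  have h2 : actU ((algebraMap ℂ U c + u X) * v) (ell ^ (k + 1 + j)) = c • f + vf X.1 f := by
    rw [map_mul, map_add, AlgHom.commutes, Module.End.mul_apply, LinearMap.add_apply, actU_u,
      ← hf]
    rfl
  have hl := ell_mem
  have h3 : f ∈ mI ^ (j + 1) := by
    have : f = (f - D * MvPolynomial.C P * ell ^ (j + 1)) +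
        D * MvPolynomial.C P * ell ^ (j + 1) := by
      ring
    rw [this]
    exact add_mem (Ideal.pow_le_pow_right (Nat.le_succ _) h1)
      (Ideal.mul_mem_left _ _ (Ideal.pow_mem_pow hl _))
  have h4 := vf_pow_mem X.1 (j + 1) h1
  have h5 : vf X.1 (f - D * MvPolynomial.C P * ell ^ (j + 1)) =
      vf X.1 f - D * MvPolynomial.C P * ((j + 1 : ℕ) : 𝒜) * ell ^ j * vf X.1 ell := by
    rw [map_sub, Derivation.leibniz, Derivation.leibniz_pow, Derivation.leibniz, hD,
      Derivation.map_natCast, MvPolynomial.derivation_C]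
    simp
    ring
  have h6 : c • f ∈ mI ^ (j + 1) := by
    rw [Algebra.smul_def]; exact Ideal.mul_mem_left _ _ h3
  have h7 := sub_C_evOne_mem (vf X.1 ell)
  rw [evOne_vf_ell] at h7
  have h8 : D * MvPolynomial.C P * ((j + 1 : ℕ) : 𝒜) * (ell ^ j *
      (vf X.1 ell - MvPolynomial.C (sym X))) ∈ mI ^ (j + 1) := by
    apply Ideal.mul_mem_left
    rw [pow_succ]
    exact Ideal.mul_mem_mul (Ideal.pow_mem_pow hl _) h7
  rw [h5] at h4
  rw [h2]
  have h9 := add_mem (add_mem h6 h4) h8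
  convert h9 using 1
  push_cast
  rw [MvPolynomial.C_mul]
  ring

lemma isSymb_symb {k : ℕ} {v : U} (hv : v ∈ fil k) : IsSymb k v (symb k v) := by
  have : ∃ P, IsSymb k v P := by
    refine fil_induction (p := fun k v => ∃ P, IsSymb k v P) ?_ ?_ ?_ hv
    · intro c
      refine ⟨MvPolynomial.C c, fun n _ => ?_⟩
      rw [AlgHom.commutes]
      have : (algebraMap ℂ (Module.End Pol 𝒜) c) (ell ^ n) = c • ell ^ n := rfl
      rw [this, Algebra.smul_def]
      simp [MvPolynomial.algebraMap_eq, IsScalarTower.algebraMap_apply ℂ Pol 𝒜]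
    · rintro n v w - - ⟨P, hP⟩ ⟨P', hP'⟩
      refine ⟨P + P', fun m hm => ?_⟩
      have := add_mem (hP m hm) (hP' m hm)
      convert this using 1
      rw [map_add, LinearMap.add_apply, MvPolynomial.C_add]
      ring
    · rintro n c X v - ⟨P, hP⟩
      exact ⟨_, hP.mul_left c X⟩
  obtain ⟨P, hP⟩ := this
  rwa [hP.symb_eq]

/-- The first factor contributes its linear part only: its constant part, and the terms of higher
order that the vector field produces, vanish at the identity to too high an order. -/
lemma symb_mul_left {k : ℕ} {v : U} (hv : v ∈ fil k) (c : ℂ) (X : g) :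
    symb (k + 1) ((algebraMap ℂ U c + u X) * v) = sym X * symb k v :=
  ((isSymb_symb hv).mul_left c X).symb_eq

lemma symb_succ {k : ℕ} {v : U} (hv : v ∈ fil k) : symb (k + 1) v = 0 := by
  simpa using symb_mul_left hv 1 0

lemma symb_of_lt {k n : ℕ} {v : U} (hv : v ∈ fil k) (h : k < n) : symb n v = 0 := by
  obtain ⟨m, rfl⟩ := Nat.exists_eq_succ_of_ne_zero (Nat.ne_zero_of_lt h)
  exact symb_succ (fil_mono (Nat.lt_succ_iff.1 h) hv)

lemma symb_u (X : g) : symb 1 (u X) = sym X := by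
  simpa [symb_one] using symb_mul_left (one_mem_fil 0) 0 X

lemma symb_mul {m n : ℕ} {v w : U} (hv : v ∈ fil m) (hw : w ∈ fil n) :
    symb (m + n) (v * w) = symb m v * symb n w := by
  refine fil_induction (p := fun m v => symb (m + n) (v * w) = symb m v * symb n w) ?_ ?_ ?_ hv
  · intro c
    rw [zero_add, Algebra.algebraMap_eq_smul_one, smul_mul_assoc, one_mul, map_smul, map_smul,
      symb_one, smul_mul_assoc, one_mul]
  · intro m v v' _ _ h h'
    rw [add_mul, map_add, h, h', map_add, add_mul]
  · intro m c X v hv h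
    rw [mul_assoc, show m + 1 + n = m + n + 1 by omega, symb_mul_left (fil_mul hv hw), h,
      symb_mul_left hv, mul_assoc]

lemma symb_homogeneous {n : ℕ} {v : U} (hv : v ∈ fil n) : (symb n v).IsHomogeneous n := by
  have hs : ∀ X, (sym X).IsHomogeneous 1 := by
    intro X
    obtain ⟨c, rfl⟩ := eq_sum_bas X
    rw [map_sum]
    refine MvPolynomial.IsHomogeneous.sum _ _ _ fun i _ => ?_
    rw [map_smul, sym_bas, MvPolynomial.smul_eq_C_mul]
    simpa using (MvPolynomial.isHomogeneous_C (Fin 8) (c i)).mul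
      (MvPolynomial.isHomogeneous_X ℂ i)
  refine fil_induction (p := fun n v => (symb n v).IsHomogeneous n) ?_ ?_ ?_ hv
  · intro c
    rw [Algebra.algebraMap_eq_smul_one, map_smul, symb_one, ← MvPolynomial.C_mul', mul_one]
    exact MvPolynomial.isHomogeneous_C _ _
  · intro n v w _ _ h h'
    rw [map_add]; exact h.add h'
  · intro n c X v hv h
    rw [symb_mul_left hv, add_comm]
    exact (hs X).mul h

/-- The elements of `U(𝔤)` of degree less than `n`; only `0` for `n = 0`. -/
def filLT : ℕ → Submodule ℂ U
  | 0 => ⊥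
  | n + 1 => fil n

lemma u_mul_mem_filLT (X : g) {n : ℕ} {v : U} (hv : v ∈ filLT n) : u X * v ∈ filLT (n + 1) := by
  cases n with
  | zero =>
    rw [(Submodule.mem_bot ℂ).1 hv, mul_zero]; exact zero_mem _
  | succ n =>
    change _ ∈ fil (n + 1)
    rw [add_comm]; exact fil_mul (u_mem_fil X) hv

lemma symb_filLT {n : ℕ} {v : U} (hv : v ∈ filLT n) : symb n v = 0 := by
  cases n with
  | zero => rw [(Submodule.mem_bot ℂ).1 hv, map_zero]
  | succ n => exact symb_succ hv

/-- The product in `U(𝔤)` of a list of elements of the basis. -/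
def word (l : List (Fin 8)) : U := (l.map fun i => u (bas i)).prod

lemma word_cons (i : Fin 8) (l : List (Fin 8)) : word (i :: l) = u (bas i) * word l := by
  simp [word]

lemma word_mem_fil (l : List (Fin 8)) : word l ∈ fil l.length := by
  induction l with
  | nil => exact one_mem_fil 0
  | cons i l ih =>
    rw [word_cons, List.length_cons, add_comm]
    exact fil_mul (u_mem_fil _) ih

lemma symb_word (l : List (Fin 8)) :
    symb l.length (word l) = (l.map (MvPolynomial.X : Fin 8 → Pol)).prod := by
  induction l with
  | nil => simpa [word] using symb_one
  | cons i l ih =>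
    rw [word_cons, List.length_cons, add_comm, symb_mul (u_mem_fil _) (word_mem_fil l), ih,
      symb_u, sym_bas, List.map_cons, List.prod_cons]

lemma u_lie (X Y : g) : u X * u Y - u Y * u X = u ⁅X, Y⁆ := by
  exact ((LieHom.map_lie (UniversalEnvelopingAlgebra.ι ℂ) X Y).trans
    (LieRing.of_associative_ring_bracket _ _)).symm

lemma u_sum_smul {ι : Type*} (s : Finset ι) (c : ι → ℂ) (x : ι → g) :
    u (∑ i ∈ s, c i • x i) = ∑ i ∈ s, c i • u (x i) := by
  change ((UniversalEnvelopingAlgebra.ι ℂ : g →ₗ⁅ℂ⁆ U) : g →ₗ[ℂ] U) _ = _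
  rw [map_sum]
  exact Finset.sum_congr rfl fun i _ => map_smul _ _ _

/-- The order of the factors of a word matters in lower degree only. -/
lemma word_perm {l l' : List (Fin 8)} (h : l.Perm l') : word l - word l' ∈ filLT l.length := by
  induction h with
  | nil => simp
  | cons x _ ih =>
    rw [word_cons, word_cons, ← mul_sub]
    exact u_mul_mem_filLT _ ih
  | swap x y l =>
    rw [word_cons, word_cons, word_cons, word_cons, ← mul_assoc, ← mul_assoc, ← sub_mul, u_lie]
    change _ ∈ fil (l.length + 1)
    rw [add_comm]
    exact fil_mul (u_mem_fil _) (word_mem_fil l)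
  | trans h1 h2 ih1 ih2 =>
    rw [← h1.length_eq] at ih2
    simpa using add_mem ih1 ih2

/-- Modulo lower degree, `fil n` is spanned by one word of length `n` for each multiset. -/
lemma fil_le_span_words {n : ℕ} {v : U} (hv : v ∈ fil n) :
    v ∈ Submodule.span ℂ (Set.range fun m : {m : Multiset (Fin 8) // m.card = n} =>
      word m.1.toList) ⊔ filLT n := by
  refine fil_induction (p := fun n v => v ∈ Submodule.span ℂ
    (Set.range fun m : {m : Multiset (Fin 8) // m.card = n} => word m.1.toList) ⊔ filLT n)
    ?_ ?_ ?_ hv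
  · intro c
    rw [Algebra.algebraMap_eq_smul_one]
    refine Submodule.smul_mem _ _ (Submodule.mem_sup_left (Submodule.subset_span ⟨⟨0, rfl⟩, ?_⟩))
    simp [word]
  · intro n v w _ _ h h'
    exact add_mem h h'
  · intro n c X v hv h
    rw [add_mul]
    refine add_mem (Submodule.mem_sup_right ?_) ?_
    · rw [Algebra.algebraMap_eq_smul_one, smul_mul_assoc, one_mul]
      exact Submodule.smul_mem _ _ hv
    · obtain ⟨s, hs, t, ht, rfl⟩ := Submodule.mem_sup.1 h
      rw [mul_add]
      refine add_mem ?_ (Submodule.mem_sup_right (u_mul_mem_filLT X ht))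
      clear hv h
      induction hs using Submodule.span_induction with
      | zero => simp
      | add x y _ _ hx hy =>
        rw [mul_add]
        exact add_mem hx hy
      | smul a x _ hx =>
        rw [mul_smul_comm]
        exact Submodule.smul_mem _ _ hx
      | mem x hx =>
        obtain ⟨⟨m, hm⟩, rfl⟩ := hx
        obtain ⟨c, rfl⟩ := eq_sum_bas X
        rw [u_sum_smul, Finset.sum_mul]
        refine Submodule.sum_mem _ fun i _ => ?_
        rw [smul_mul_assoc]
        refine Submodule.smul_mem _ _ ?_
        have hp : (i :: m.toList).Perm (i ::ₘ m).toList := by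
          rw [← Multiset.coe_eq_coe, ← Multiset.cons_coe, Multiset.coe_toList, Multiset.coe_toList]
        have := word_perm hp
        rw [List.length_cons, Multiset.length_toList, hm, word_cons] at this
        rw [← sub_add_cancel (u (bas i) * _) (word (i ::ₘ m).toList)]
        exact add_mem (Submodule.mem_sup_right this)
          (Submodule.mem_sup_left (Submodule.subset_span ⟨⟨i ::ₘ m, by simp [hm]⟩, rfl⟩))

lemma prod_map_X (l : List (Fin 8)) : (l.map (MvPolynomial.X : Fin 8 → Pol)).prod =
    MvPolynomial.monomial (Multiset.toFinsupp (l : Multiset (Fin 8))) 1 := by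
  induction l with
  | nil => simp
  | cons i l ih =>
    rw [List.map_cons, List.prod_cons, ih, ← Multiset.cons_coe, ← Multiset.singleton_add, map_add,
      Multiset.toFinsupp_singleton, MvPolynomial.X, MvPolynomial.monomial_mul, one_mul]

/-- The Poincaré–Birkhoff–Witt theorem: an element of degree at most `n` whose symbol of degree
`n` vanishes has degree less than `n`. -/
lemma mem_filLT_of_symb_eq_zero {n : ℕ} {v : U} (hv : v ∈ fil n) (h : symb n v = 0) :
    v ∈ filLT n := by
  obtain ⟨s, hs, t, ht, rfl⟩ := Submodule.mem_sup.1 (fil_le_span_words hv)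
  rw [map_add, symb_filLT ht, add_zero] at h
  suffices s = 0 by rw [this, zero_add]; exact ht
  obtain ⟨c, rfl⟩ := (Finsupp.mem_span_range_iff_exists_finsupp).1 hs
  rw [map_finsuppSum] at h
  have hm : ∀ m : {m : Multiset (Fin 8) // m.card = n}, symb n (word m.1.toList) =
      MvPolynomial.basisMonomials (Fin 8) ℂ (Multiset.toFinsupp m.1) := by
    rintro ⟨m, rfl⟩
    have := symb_word m.toList
    rw [Multiset.length_toList] at this
    rw [this, MvPolynomial.coe_basisMonomials, prod_map_X, Multiset.coe_toList]
  simp only [map_smul, hm] at h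
  have hli := (MvPolynomial.basisMonomials (Fin 8) ℂ).linearIndependent.comp
    (fun m : {m : Multiset (Fin 8) // m.card = n} => Multiset.toFinsupp m.1)
    (Multiset.toFinsupp.injective.comp Subtype.val_injective)
  have := (linearIndependent_iff.1 hli) c h
  rw [this]; simp

/-- The filtration is exhaustive: the elements of finite degree form a subalgebra that
contains `𝔤`. -/
lemma exists_mem_fil (v : U) : ∃ n, v ∈ fil n := by
  let A : Subalgebra ℂ U :=
    { carrier := {v | ∃ n, v ∈ fil n}
      mul_mem' := fun ⟨m, hm⟩ ⟨n, hn⟩ => ⟨m + n, fil_mul hm hn⟩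
      add_mem' := fun ⟨m, hm⟩ ⟨n, hn⟩ => ⟨max m n, add_mem (fil_mono (le_max_left m n) hm)
        (fil_mono (le_max_right m n) hn)⟩
      algebraMap_mem' := fun c => ⟨0, by
        rw [Algebra.algebraMap_eq_smul_one]; exact Submodule.smul_mem _ _ (one_mem_fil 0)⟩ }
  let j : g →ₗ⁅ℂ⁆ A :=
    { toFun := fun X => ⟨u X, 1, u_mem_fil X⟩
      map_add' := fun X Y => Subtype.ext (map_add (UniversalEnvelopingAlgebra.ι ℂ) X Y)
      map_smul' := fun c X => Subtype.ext (map_smul (UniversalEnvelopingAlgebra.ι ℂ) c X)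
      map_lie' := fun {X Y} => Subtype.ext (LieHom.map_lie (UniversalEnvelopingAlgebra.ι ℂ) X Y) }
  have h : A.val.comp (UniversalEnvelopingAlgebra.lift ℂ j) = AlgHom.id ℂ U := by
    apply UniversalEnvelopingAlgebra.hom_ext
    ext1 X
    exact congrArg A.val (UniversalEnvelopingAlgebra.lift_ι_apply ℂ j X)
  have := (UniversalEnvelopingAlgebra.lift ℂ j v).2
  have h2 : ((UniversalEnvelopingAlgebra.lift ℂ j v : A) : U) = v := DFunLike.congr_fun h v
  rwa [h2] at this

/-! ### The spin representation -/

/-- The action of `X ∈ 𝔭` on the spin module `Λ(𝔭⁺)`, in the basis `1, E₁, E₂, E₁ ∧ E₂`. -/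
def spinMat (X : Matrix (Fin 3) (Fin 3) ℂ) : Matrix (Fin 4) (Fin 4) ℂ :=
  !![0, -2 * X 2 0, -2 * X 2 1, 0;
     X 0 2, 0, 0, 2 * X 2 1;
     X 1 2, 0, 0, -2 * X 2 0;
     0, - X 1 2, X 0 2, 0]

/-- The Clifford map of the spin representation. -/
def spinLin : p →ₗ[ℂ] Matrix (Fin 4) (Fin 4) ℂ where
  toFun X := spinMat X.1.1
  map_add' X Y := by
    ext i j; fin_cases i <;> fin_cases j <;> simp [spinMat] <;> ring
  map_smul' c X := by
    ext i j; fin_cases i <;> fin_cases j <;> simp [spinMat] <;> ring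

lemma spinLin_sq (X : p) : spinLin X * spinLin X = algebraMap ℂ _ (Q X) := by
  obtain ⟨h1, h2, h3, h4, h5⟩ := (mem_p_iff X.1).1 X.2
  rw [Q_apply, Matrix.trace_fin_three]
  change spinMat X.1.1 * spinMat X.1.1 = _
  ext i j
  fin_cases i <;> fin_cases j <;>
    simp [spinMat, Matrix.mul_apply, Fin.sum_univ_four, Fin.sum_univ_three, h1, h2, h3, h4, h5,
      Matrix.algebraMap_eq_diagonal] <;> ring

/-- The spin representation of `C(𝔭)`. -/
def spin : C →ₐ[ℂ] Matrix (Fin 4) (Fin 4) ℂ :=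
  CliffordAlgebra.lift Q ⟨spinLin, spinLin_sq⟩

lemma spin_ι (X : p) : spin (CliffordAlgebra.ι Q X) = spinMat X.1.1 :=
  CliffordAlgebra.lift_ι_apply spinLin spinLin_sq X

lemma spin_cE₁ : spin cE₁ = !![0, 0, 0, 0; 1, 0, 0, 0; 0, 0, 0, 0; 0, 0, 1, 0] := by
  rw [cE₁, spin_ι]
  ext i j; fin_cases i <;> fin_cases j <;> simp [spinMat, E₁]

lemma spin_cE₂ : spin cE₂ = !![0, 0, 0, 0; 0, 0, 0, 0; 1, 0, 0, 0; 0, -1, 0, 0] := by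
  rw [cE₂, spin_ι]
  ext i j; fin_cases i <;> fin_cases j <;> simp [spinMat, E₂]

lemma spin_cF₁ : spin cF₁ = !![0, -2, 0, 0; 0, 0, 0, 0; 0, 0, 0, -2; 0, 0, 0, 0] := by
  rw [cF₁, spin_ι]
  ext i j; fin_cases i <;> fin_cases j <;> simp [spinMat, F₁]

lemma spin_cF₂ : spin cF₂ = !![0, 0, -2, 0; 0, 0, 0, 2; 0, 0, 0, 0; 0, 0, 0, 0] := by
  rw [cF₂, spin_ι]
  ext i j; fin_cases i <;> fin_cases j <;> simp [spinMat, F₂]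

/-- The projection to the vacuum vector lies in the image of the spin representation. -/
lemma single_zero_zero : Matrix.single 0 0 (1 : ℂ) =
    (-1 / 4 : ℂ) • ((spin cF₁ * spin cF₂) * (spin cE₁ * spin cE₂)) := by
  rw [spin_cE₁, spin_cE₂, spin_cF₁, spin_cF₂]
  ext i j
  fin_cases i <;> fin_cases j <;> norm_num [Matrix.mul_apply, Fin.sum_univ_four, Matrix.single]

lemma single_left (i : Fin 4) : Matrix.single i 0 (1 : ℂ) =
    ![1, spin cE₁, spin cE₂, spin cE₁ * spin cE₂] i * Matrix.single 0 0 1 := by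
  have key : ∀ M : Matrix (Fin 4) (Fin 4) ℂ, (∀ k, M k 0 = (Pi.single i 1 : Fin 4 → ℂ) k) →
      Matrix.single i 0 (1 : ℂ) = M * Matrix.single 0 0 1 := by
    intro M hM
    ext k j
    by_cases hj : j = 0
    · subst hj
      simp [Matrix.mul_single_apply_same, hM, Matrix.single_apply, Pi.single_apply, eq_comm]
    · rw [Matrix.mul_single_apply_of_ne _ _ _ _ _ hj]
      simp [Ne.symm hj]
  apply key
  rw [spin_cE₁, spin_cE₂]
  fin_cases i <;> intro k <;> fin_cases k <;> simp

lemma single_right (j : Fin 4) : Matrix.single 0 j (1 : ℂ) = Matrix.single 0 0 1 *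
    ![1, (-1 / 2 : ℂ) • spin cF₁, (-1 / 2 : ℂ) • spin cF₂,
      (-1 / 4 : ℂ) • (spin cF₁ * spin cF₂)] j := by
  have key : ∀ M : Matrix (Fin 4) (Fin 4) ℂ, M 0 = Pi.single j 1 →
      Matrix.single 0 j (1 : ℂ) = Matrix.single 0 0 1 * M := by
    intro M hM
    ext i k
    by_cases hi : i = 0
    · subst hi
      simp [Matrix.single_mul_apply_same, hM, Matrix.single_apply, Pi.single_apply, eq_comm]
    · rw [Matrix.single_mul_apply_of_ne _ _ _ _ _ hi]
      simp [Ne.symm hi]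
  apply key
  rw [spin_cF₁, spin_cF₂]
  fin_cases j <;> ext k <;> fin_cases k <;> (simp; try norm_num)

lemma spin_surjective : Function.Surjective spin := by
  rw [← AlgHom.range_eq_top, eq_top_iff]
  have h1 : spin cE₁ ∈ spin.range := ⟨_, rfl⟩
  have h2 : spin cE₂ ∈ spin.range := ⟨_, rfl⟩
  have h3 : spin cF₁ ∈ spin.range := ⟨_, rfl⟩
  have h4 : spin cF₂ ∈ spin.range := ⟨_, rfl⟩
  have h00 : Matrix.single 0 0 (1 : ℂ) ∈ spin.range := by
    rw [single_zero_zero]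
    exact Subalgebra.smul_mem _ (mul_mem (mul_mem h3 h4) (mul_mem h1 h2)) _
  have hcol : ∀ i : Fin 4, Matrix.single i 0 (1 : ℂ) ∈ spin.range := by
    intro i
    rw [single_left]
    refine mul_mem ?_ h00
    fin_cases i
    exacts [one_mem _, h1, h2, mul_mem h1 h2]
  have hrow : ∀ j : Fin 4, Matrix.single 0 j (1 : ℂ) ∈ spin.range := by
    intro j
    rw [single_right]
    refine mul_mem h00 ?_
    fin_cases j
    exacts [one_mem _, Subalgebra.smul_mem _ h3 _, Subalgebra.smul_mem _ h4 _,
      Subalgebra.smul_mem _ (mul_mem h3 h4) _]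
  intro M _
  rw [Matrix.matrix_eq_sum_single M]
  refine sum_mem fun i _ => sum_mem fun j _ => ?_
  have : Matrix.single i j (M i j) = M i j • (Matrix.single i 0 1 * Matrix.single 0 j 1) := by
    simp
  rw [this]
  exact Subalgebra.smul_mem _ (mul_mem (hcol i) (hrow j)) _

/-- The basis `E₁, E₂, F₁, F₂` of `𝔭`, given by its coordinates. -/
def pEquiv : p ≃ₗ[ℂ] (Fin 4 → ℂ) where
  toFun X := ![X.1.1 0 2, X.1.1 1 2, X.1.1 2 0, X.1.1 2 1]
  map_add' X Y := by ext i; fin_cases i <;> simp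
  map_smul' c X := by ext i; fin_cases i <;> simp
  invFun c := c 0 • ⟨E₁, E₁_mem⟩ + c 1 • ⟨E₂, E₂_mem⟩ + c 2 • ⟨F₁, F₁_mem⟩ + c 3 • ⟨F₂, F₂_mem⟩
  left_inv X := by
    obtain ⟨h1, h2, h3, h4, h5⟩ := (mem_p_iff X.1).1 X.2
    apply Subtype.ext
    apply Subtype.ext
    ext i j
    fin_cases i <;> fin_cases j <;> simp [E₁, E₂, F₁, F₂, h1, h2, h3, h4, h5]
  right_inv c := by
    ext i; fin_cases i <;> simp [E₁, E₂, F₁, F₂]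

lemma finrank_C : Module.finrank ℂ C = 16 := by
  have : Invertible (2 : ℂ) := invertibleOfNonzero two_ne_zero
  rw [(CliffordAlgebra.equivExterior Q).finrank_eq,
    Module.finrank_eq_card_basis (Module.Basis.ofEquivFun pEquiv).ExteriorAlgebra]
  simp

lemma spin_bijective : Function.Bijective spin := by
  have : Module.Finite ℂ C := Module.finite_of_finrank_pos (by rw [finrank_C]; norm_num)
  refine ⟨?_, spin_surjective⟩
  refine (LinearMap.injective_iff_surjective_of_finrank_eq_finrank (f := spin.toLinearMap) ?_).2
    spin_surjective
  rw [finrank_C, Module.finrank_matrix]; simp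

/-- The spin representation identifies `C(𝔭)` with the algebra of `4 × 4` matrices. -/
def spinEquiv : C ≃ₐ[ℂ] Matrix (Fin 4) (Fin 4) ℂ := AlgEquiv.ofBijective spin spin_bijective

/-- `U(𝔤) ⊗ C(𝔭)` as an algebra of matrices over `U(𝔤)`, through the spin representation. -/
def toMat : UC ≃ₐ[ℂ] Matrix (Fin 4) (Fin 4) U :=
  (Algebra.TensorProduct.congr AlgEquiv.refl spinEquiv).trans (matrixEquivTensor (Fin 4) ℂ U).symm

lemma toMat_tmul (v : U) (c : C) : toMat (v ⊗ₜ c) = (spin c).map fun z => z • v := by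
  rw [toMat, AlgEquiv.trans_apply, Algebra.TensorProduct.congr_apply,
    Algebra.TensorProduct.map_tmul]
  refine (matrixEquivTensor_apply_symm (Fin 4) ℂ U v (spin c)).trans ?_
  ext i j
  change v * algebraMap ℂ U (spin c i j) = spin c i j • v
  rw [Algebra.smul_def, Algebra.commutes]

/-! ### The action of `K` on matrices -/

/-- The matrix `diag(a, 1)`. -/
def blk (a : Matrix (Fin 2) (Fin 2) ℂ) : Matrix (Fin 3) (Fin 3) ℂ :=
  !![a 0 0, a 0 1, 0; a 1 0, a 1 1, 0; 0, 0, 1]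

/-- The action of `a ∈ GL(2)` on `Λ(𝔭⁺)`, that is, `diag(1, a, det a)`. -/
def spinBlk {S : Type*} [CommRing S] (a : Matrix (Fin 2) (Fin 2) S) : Matrix (Fin 4) (Fin 4) S :=
  !![1, 0, 0, 0; 0, a 0 0, a 0 1, 0; 0, a 1 0, a 1 1, 0; 0, 0, 0, a 0 0 * a 1 1 - a 0 1 * a 1 0]

lemma spinBlk_map {S S' : Type*} [CommRing S] [CommRing S'] (f : S →+* S')
    (a : Matrix (Fin 2) (Fin 2) S) : (spinBlk a).map f = spinBlk (a.map f) := by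
  ext i j
  fin_cases i <;> fin_cases j <;> simp [spinBlk]

/-- `Ad(x)` is conjugation by `diag(a, 1)`, where `b = a⁻¹`. The scalar that makes the determinant
of `x` equal to `1` plays no role in the adjoint action. -/
structure ConjBy (x : K) (a b : Matrix (Fin 2) (Fin 2) ℂ) : Prop where
  mul_eq : a * b = 1
  adg_eq : ∀ X : g, (adg x X).1 = blk a * X.1 * blk b

lemma blk_mul (a b : Matrix (Fin 2) (Fin 2) ℂ) : blk a * blk b = blk (a * b) := by
  ext i j
  fin_cases i <;> fin_cases j <;>
    simp [blk, Matrix.mul_apply, Fin.sum_univ_three, Fin.sum_univ_two]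

/-- An element of `K` is block diagonal, so it is a scalar multiple of some `diag(a, 1)`. -/
lemma exists_conjBy (x : K) : ∃ a b, ConjBy x a b := by
  have h1 := gam_comm x.2
  have h2 := gam_comm (K.inv_mem x.2)
  have h3 : (x.1.1 : Matrix (Fin 3) (Fin 3) ℂ) * (x.1⁻¹).1 = 1 := by
    have := congrArg Subtype.val (mul_inv_cancel x.1); exact this
  have key : ∀ X : g, (adg x X).1 = x.1.1 * X.1 * (x.1⁻¹).1 := fun X => rfl
  generalize (x.1⁻¹).1 = m at *
  generalize x.1.1 = k at *
  have e : ∀ M : Matrix (Fin 3) (Fin 3) ℂ, gam * M = M * gam →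
      M 0 2 = 0 ∧ M 1 2 = 0 ∧ M 2 0 = 0 ∧ M 2 1 = 0 := by
    intro M hM
    refine ⟨?_, ?_, ?_, ?_⟩
    · simpa [gam, self_eq_neg] using congrFun (congrFun hM 0) 2
    · simpa [gam, self_eq_neg] using congrFun (congrFun hM 1) 2
    · simpa [gam, neg_eq_self] using congrFun (congrFun hM 2) 0
    · simpa [gam, neg_eq_self] using congrFun (congrFun hM 2) 1
  obtain ⟨k1, k2, k3, k4⟩ := e k h1
  obtain ⟨m1, m2, m3, m4⟩ := e m h2
  have h4 := fun i j => congrFun (congrFun h3 i) j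
  simp only [Matrix.mul_apply, Fin.sum_univ_three] at h4
  have e22 := h4 2 2
  simp [k3, k4] at e22
  have hk : k = k 2 2 • blk (m 2 2 • !![k 0 0, k 0 1; k 1 0, k 1 1]) := by
    ext i j
    fin_cases i <;> fin_cases j <;> simp [blk, k1, k2, k3, k4, ← mul_assoc, e22]
  have hm : m = m 2 2 • blk (k 2 2 • !![m 0 0, m 0 1; m 1 0, m 1 1]) := by
    have e22' : m 2 2 * k 2 2 = 1 := by rw [mul_comm, e22]
    ext i j
    fin_cases i <;> fin_cases j <;> simp [blk, m1, m2, m3, m4, ← mul_assoc, e22']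
  refine ⟨m 2 2 • !![k 0 0, k 0 1; k 1 0, k 1 1], k 2 2 • !![m 0 0, m 0 1; m 1 0, m 1 1], ?_, ?_⟩
  · have e00 := h4 0 0
    have e01 := h4 0 1
    have e10 := h4 1 0
    have e11 := h4 1 1
    simp [k1, k2] at e00 e01 e10 e11
    rw [Matrix.smul_mul, Matrix.mul_smul, smul_smul, mul_comm, e22, one_smul]
    ext i j
    fin_cases i <;> fin_cases j <;> simp [e00, e01, e10, e11]
  · intro X
    have h5 : k * X.1 * m = (k 2 2 • blk (m 2 2 • !![k 0 0, k 0 1; k 1 0, k 1 1])) * X.1 *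
        (m 2 2 • blk (k 2 2 • !![m 0 0, m 0 1; m 1 0, m 1 1])) := by rw [← hk, ← hm]
    rw [key, h5, Matrix.smul_mul, Matrix.smul_mul, Matrix.mul_smul, smul_smul, e22, one_smul]

/-- Every element of `U(2)` occurs: divide `diag(a, 1)` by a cube root of its determinant. -/
lemma exists_of_unitary (a : Matrix (Fin 2) (Fin 2) ℂ) (ha : a * aᴴ = 1) :
    ∃ x : K, ConjBy x a aᴴ := by
  have ha' : aᴴ * a = 1 := mul_eq_one_comm.1 ha
  obtain ⟨z, hz⟩ := IsAlgClosed.exists_pow_nat_eq (a.det) (n := 3) (by norm_num)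
  have hd : a.det * star a.det = 1 := by
    rw [← Matrix.det_conjTranspose, ← Matrix.det_mul, ha, Matrix.det_one]
  have hzz : z * star z = 1 := by
    have h1 : (z * star z) ^ 3 = 1 := by rw [mul_pow, ← star_pow, hz, hd]
    have h2 : z * star z = ((‖z‖ ^ 2 : ℝ) : ℂ) := by
      have := Complex.mul_conj' z
      simpa using this
    rw [h2] at h1 ⊢
    have h3 : (‖z‖ ^ 2) ^ 3 = 1 := by exact_mod_cast h1
    have h4 := (pow_eq_one_iff_of_nonneg (sq_nonneg ‖z‖) (by norm_num : 3 ≠ 0)).1 h3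
    rw [h4]; simp
  have hz0 : z ≠ 0 := by rintro rfl; simp at hzz
  have hblk : (blk a)ᴴ = blk aᴴ := by
    ext i j; fin_cases i <;> fin_cases j <;> simp [blk]
  have hblk1 : blk 1 = 1 := by
    ext i j; fin_cases i <;> fin_cases j <;> simp [blk]
  let m : Matrix (Fin 3) (Fin 3) ℂ := star z • blk a
  have hdet : m.det = 1 := by
    have : (blk a).det = a.det := by
      simp [Matrix.det_fin_three, Matrix.det_fin_two, blk]
    rw [Matrix.det_smul, this, ← hz, Fintype.card_fin, ← mul_pow, mul_comm, hzz, one_pow]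
  have hmH : mᴴ = z • blk aᴴ := by
    simp only [m]
    rw [Matrix.conjTranspose_smul, hblk, star_star]
  have hmm : mᴴ * m = 1 := by
    rw [hmH, Matrix.smul_mul, Matrix.mul_smul, smul_smul, hzz, one_smul, blk_mul, ha', hblk1]
  have hgm : gam * m = m * gam := by
    ext i j; fin_cases i <;> fin_cases j <;> simp [gam, m, blk]
  let k : Matrix.SpecialLinearGroup (Fin 3) ℂ := ⟨m, hdet⟩
  have hk : k ∈ K := by
    refine ⟨?_, hmm⟩
    change mᴴ * gam * m = gam
    rw [mul_assoc, hgm, ← mul_assoc, hmm, one_mul]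
  refine ⟨⟨k, hk⟩, ha, fun X => ?_⟩
  change m * X.1 * (k⁻¹).1 = _
  have hinv : (k⁻¹).1 = mᴴ := by
    have h1 : (k⁻¹).1 * m = 1 := coe_inv_mul_coe k
    calc (k⁻¹).1 = (k⁻¹).1 * (m * mᴴ) := by rw [mul_eq_one_comm.1 hmm, mul_one]
      _ = mᴴ := by rw [← mul_assoc, h1, one_mul]
  rw [hinv, hmH, Matrix.smul_mul, Matrix.smul_mul, Matrix.mul_smul, smul_smul, mul_comm, hzz,
    one_smul]

/-- `Ad(x)` on `C(𝔭)` becomes conjugation by `spinBlk a` under the spin representation. -/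
lemma ConjBy.spin_adC {x : K} {a b : Matrix (Fin 2) (Fin 2) ℂ} (h : ConjBy x a b) (c : C) :
    spin (adC x c) * spinBlk a = spinBlk a * spin c := by
  induction c using CliffordAlgebra.induction with
  | algebraMap r =>
    rw [AlgHom.commutes, AlgHom.commutes, Algebra.commutes]
  | ι X =>
    have hba : b * a = 1 := mul_eq_one_comm.1 h.mul_eq
    have e := fun i j => congrFun (congrFun hba i) j
    simp only [Matrix.mul_apply, Fin.sum_univ_two] at e
    have e00 := e 0 0
    have e01 := e 0 1
    have e10 := e 1 0
    have e11 := e 1 1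
    simp at e00 e01 e10 e11
    have d00 : b 0 0 * (a 0 0 * a 1 1 - a 0 1 * a 1 0) = a 1 1 := by
      linear_combination a 1 1 * e00 - a 1 0 * e01
    have d01 : b 0 1 * (a 0 0 * a 1 1 - a 0 1 * a 1 0) = -a 0 1 := by
      linear_combination a 0 0 * e01 - a 0 1 * e00
    have d10 : b 1 0 * (a 0 0 * a 1 1 - a 0 1 * a 1 0) = -a 1 0 := by
      linear_combination a 1 1 * e10 - a 1 0 * e11
    have d11 : b 1 1 * (a 0 0 * a 1 1 - a 0 1 * a 1 0) = a 0 0 := by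
      linear_combination a 0 0 * e11 - a 0 1 * e10
    rw [adC, CliffordAlgebra.map_apply_ι, spin_ι, spin_ι]
    have hY : ((adp x X : p) : g).1 = blk a * X.1.1 * blk b := h.adg_eq X.1
    have t02 : ((adp x X : p) : g).1 0 2 = a 0 0 * X.1.1 0 2 + a 0 1 * X.1.1 1 2 := by
      rw [hY]; simp [blk, Matrix.mul_apply, Matrix.vecMul, dotProduct, Fin.sum_univ_three]
    have t12 : ((adp x X : p) : g).1 1 2 = a 1 0 * X.1.1 0 2 + a 1 1 * X.1.1 1 2 := by
      rw [hY]; simp [blk, Matrix.mul_apply, Matrix.vecMul, dotProduct, Fin.sum_univ_three]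
    have t20 : ((adp x X : p) : g).1 2 0 = X.1.1 2 0 * b 0 0 + X.1.1 2 1 * b 1 0 := by
      rw [hY]; simp [blk, Matrix.mul_apply, Matrix.vecMul, dotProduct, Fin.sum_univ_three]
    have t21 : ((adp x X : p) : g).1 2 1 = X.1.1 2 0 * b 0 1 + X.1.1 2 1 * b 1 1 := by
      rw [hY]; simp [blk, Matrix.mul_apply, Matrix.vecMul, dotProduct, Fin.sum_univ_three]
    clear hY
    generalize ((adp x X : p) : g).1 = Y at *
    generalize X.1.1 = Z at *
    ext i j
    fin_cases i <;> fin_cases j <;>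
      simp [spinMat, spinBlk, Matrix.mul_apply, Fin.sum_univ_four, t02, t12, t20, t21]
    · linear_combination (-2 * Z 2 0) * e00 + (-2 * Z 2 1) * e10
    · linear_combination (-2 * Z 2 0) * e01 + (-2 * Z 2 1) * e11
    · linear_combination (2 * Z 2 0) * d01 + (2 * Z 2 1) * d11
    · linear_combination (-2 * Z 2 0) * d00 + (-2 * Z 2 1) * d10
    · ring
    · ring
  | mul c d hc hd =>
    rw [map_mul, map_mul, mul_assoc, hd, ← mul_assoc, hc, map_mul, mul_assoc]
  | add c d hc hd => rw [map_add, map_add, add_mul, hc, hd, map_add, mul_add]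

/-- The action of `K` on `U(𝔤) ⊗ C(𝔭)` in terms of matrices over `U(𝔤)`: entrywise `Ad`, followed by
conjugation by `spinBlk a`. -/
lemma ConjBy.toMat_adUC {x : K} {a b : Matrix (Fin 2) (Fin 2) ℂ} (h : ConjBy x a b) (w : UC) :
    toMat (adUC x w) * (spinBlk a).map (algebraMap ℂ U) =
      (spinBlk a).map (algebraMap ℂ U) * (toMat w).map (adU x) := by
  induction w using TensorProduct.induction_on with
  | zero => simp
  | tmul v c =>
    rw [adUC, Algebra.TensorProduct.map_tmul, toMat_tmul, toMat_tmul]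
    ext i j
    have := congrFun (congrFun (h.spin_adC c) i) j
    simp only [Matrix.mul_apply, Matrix.map_apply, map_smul, ← Algebra.smul_def,
      ← Algebra.commutes, smul_smul, ← Finset.sum_smul] at this ⊢
    rw [← this]
    simp only [mul_comm]
  | add v w hv hw =>
    rw [map_add, map_add, add_mul, hv, hw, map_add, Matrix.map_add _ (map_add _), mul_add]

open MvPolynomial (X eval aeval)

/-! ### From equivariance under `U(2)` to equivariance under `GL(2, ℂ)` -/

/-- The skew-Hermitian matrix with real coordinates `v`, extended complex linearly. -/
def skew (v : Fin 4 → ℂ) : Matrix (Fin 2) (Fin 2) ℂ :=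
  !![Complex.I * v 0, v 1 + Complex.I * v 2; -v 1 + Complex.I * v 2, Complex.I * v 3]

lemma skew_surjective (M : Matrix (Fin 2) (Fin 2) ℂ) : ∃ v, skew v = M := by
  refine ⟨![-Complex.I * M 0 0, (M 0 1 - M 1 0) / 2, -Complex.I * (M 0 1 + M 1 0) / 2,
    -Complex.I * M 1 1], ?_⟩
  ext i j
  fin_cases i <;> fin_cases j <;> simp [skew, ← mul_assoc]
  · linear_combination (-(M 0 1 + M 1 0) / 2) * Complex.I_sq
  · linear_combination (-(M 0 1 + M 1 0) / 2) * Complex.I_sq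

lemma skew_conjTranspose (v : Fin 4 → ℝ) :
    (skew fun i => (v i : ℂ))ᴴ = -skew fun i => (v i : ℂ) := by
  ext i j
  fin_cases i <;> fin_cases j <;> simp [skew] <;> ring

/-- The determinant of `1 - skew v`, as a polynomial in `v`. -/
def cayM : MvPolynomial (Fin 4) ℂ :=
  (1 - Complex.I • X 0) * (1 - Complex.I • X 3) -
    (X 1 + Complex.I • X 2) * (-X 1 + Complex.I • X 2)

/-- The determinant of `1 + skew v`, as a polynomial in `v`. -/
def cayP : MvPolynomial (Fin 4) ℂ :=
  (1 + Complex.I • X 0) * (1 + Complex.I • X 3) -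
    (X 1 + Complex.I • X 2) * (-X 1 + Complex.I • X 2)

lemma eval_cayM (v : Fin 4 → ℂ) : eval v cayM = (1 - skew v).det := by
  simp [cayM, skew, Matrix.det_fin_two, MvPolynomial.smul_eval]
  ring

lemma eval_cayP (v : Fin 4 → ℂ) : eval v cayP = (1 + skew v).det := by
  simp [cayP, skew, Matrix.det_fin_two, MvPolynomial.smul_eval]

/-- The common denominator of the Cayley transform of `skew v` and its inverse. -/
def cayDen : MvPolynomial (Fin 4) ℂ := cayM * cayP

lemma eval_cayDen (v : Fin 4 → ℂ) : eval v cayDen = (1 - skew v).det * (1 + skew v).det := by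
  rw [cayDen, map_mul, eval_cayM, eval_cayP]

/-- The functions of `v` that agree, where `d` does not vanish, with a polynomial divided by a power
of `d`. -/
def ratFun (d : MvPolynomial (Fin 4) ℂ) : Subalgebra ℂ ((Fin 4 → ℂ) → ℂ) where
  carrier := {φ | ∃ (N : ℕ) (q : MvPolynomial (Fin 4) ℂ),
    ∀ v, eval v d ≠ 0 → eval v d ^ N * φ v = eval v q}
  mul_mem' := by
    rintro φ ψ ⟨N, q, h⟩ ⟨N', q', h'⟩
    refine ⟨N + N', q * q', fun v hv => ?_⟩
    rw [map_mul, ← h v hv, ← h' v hv, Pi.mul_apply]; ring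
  add_mem' := by
    rintro φ ψ ⟨N, q, h⟩ ⟨N', q', h'⟩
    refine ⟨N + N', d ^ N' * q + d ^ N * q', fun v hv => ?_⟩
    rw [map_add, map_mul, map_mul, map_pow, map_pow, ← h v hv, ← h' v hv, Pi.add_apply]; ring
  algebraMap_mem' c := ⟨0, MvPolynomial.C c, fun v _ => by simp⟩

lemma eval_mem_ratFun (d q : MvPolynomial (Fin 4) ℂ) : (fun v => eval v q) ∈ ratFun d :=
  ⟨0, q, fun v _ => by simp⟩

lemma inv_mem_ratFun {d q r : MvPolynomial (Fin 4) ℂ} (h : d = q * r) :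
    (fun v => (eval v q)⁻¹) ∈ ratFun d := by
  refine ⟨1, r, fun v hv => ?_⟩
  rw [h, map_mul] at hv
  have := left_ne_zero_of_mul hv
  rw [h, map_mul]
  field_simp

lemma aeval_mem_ratFun {σ : Type*} (d : MvPolynomial (Fin 4) ℂ) (f : (Fin 4 → ℂ) → σ → ℂ)
    (hf : ∀ i, (fun v => f v i) ∈ ratFun d) (p : MvPolynomial σ ℂ) :
    (fun v => eval (f v) p) ∈ ratFun d := by
  induction p using MvPolynomial.induction_on with
  | C c => simp only [MvPolynomial.eval_C]; exact (ratFun d).algebraMap_mem c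
  | add p q hp hq => simp only [map_add]; exact add_mem hp hq
  | mul_X p i hp => simp only [map_mul, MvPolynomial.eval_X]; exact mul_mem hp (hf i)

/-- Real points are Zariski dense: a rational function that vanishes on them is zero. -/
lemma eq_zero_of_mem_ratFun {d : MvPolynomial (Fin 4) ℂ} {φ : (Fin 4 → ℂ) → ℂ}
    (hφ : φ ∈ ratFun d)
    (h : ∀ v : Fin 4 → ℝ, eval (fun i => (v i : ℂ)) d ≠ 0 → φ (fun i => (v i : ℂ)) = 0)
    (v : Fin 4 → ℂ) (hv : eval v d ≠ 0) : φ v = 0 := by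
  obtain ⟨N, q, hq⟩ := hφ
  have : q * d = 0 := by
    refine MvPolynomial.funext_set (fun _ => Set.range ((↑) : ℝ → ℂ))
      (fun _ => Set.infinite_range_of_injective Complex.ofReal_injective) fun x hx => ?_
    choose r hr using fun i => hx i trivial
    obtain rfl : (fun i => (r i : ℂ)) = x := funext hr
    rw [map_mul, map_zero]
    by_cases h0 : eval (fun i => (r i : ℂ)) d = 0
    · rw [h0, mul_zero]
    · rw [← hq _ h0, h r h0, mul_zero, zero_mul]
  have h1 : eval v q = 0 := by
    have := congrArg (eval v) this
    rw [map_mul, map_zero] at this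
    exact (mul_eq_zero.1 this).resolve_right hv
  rw [← hq v hv] at h1
  exact (mul_eq_zero.1 h1).resolve_left (pow_ne_zero _ hv)

/-- The matrix `Y` formed by the values `x₁, x₂, x₃` of a point of `𝔤*` at `H, E, F`. -/
def ptY (x : Fin 8 → ℂ) : Matrix (Fin 2) (Fin 2) ℂ := !![x 1, 2 * x 3; 2 * x 2, - x 1]

/-- The action on points of `𝔤*`, where `z = (x₄, x₅)` is a row and
`y = (x₆, x₇)` a column: `y ↦ b y`, `z ↦ z a`, `Y ↦ b Y a`. -/
def act (b a : Matrix (Fin 2) (Fin 2) ℂ) (x : Fin 8 → ℂ) : Fin 8 → ℂ :=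
  ![x 0, (b * ptY x * a) 0 0, (b * ptY x * a) 1 0 / 2, (b * ptY x * a) 0 1 / 2,
    x 4 * a 0 0 + x 5 * a 1 0, x 4 * a 0 1 + x 5 * a 1 1,
    b 0 0 * x 6 + b 0 1 * x 7, b 1 0 * x 6 + b 1 1 * x 7]

/-- Matrices over `S(𝔤)`, where the symbols of the elements of `U(𝔤) ⊗ C(𝔭)` live. -/
abbrev PolMat : Type := Matrix (Fin 4) (Fin 4) Pol

/-- Equivariance under `U(2)`, which acts on the points of `𝔤*` and on the spin module. -/
def UEquivariant (P : PolMat) : Prop := ∀ a : Matrix (Fin 2) (Fin 2) ℂ, a * aᴴ = 1 → ∀ x,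
  P.map (eval x) * spinBlk a = spinBlk a * P.map (eval (act aᴴ a x))

/-- Equivariance extends to the elements `a` of `GL(2, ℂ)` without the eigenvalue `-1`. These
are the Cayley transforms `(1 + M)(1 - M)⁻¹`, which are unitary for skew-Hermitian `M`; the
equivariance is an identity between rational functions of `M`. -/
lemma UEquivariant.extend {P : PolMat} (h : UEquivariant P) {a b : Matrix (Fin 2) (Fin 2) ℂ}
    (hab : a * b = 1) (ha : (1 + a).det ≠ 0) (x : Fin 8 → ℂ) :
    P.map (eval x) * spinBlk a = spinBlk a * P.map (eval (act b a x)) := by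
  -- The Cayley transform and its inverse.
  let ca : (Fin 4 → ℂ) → Matrix (Fin 2) (Fin 2) ℂ := fun v => (1 + skew v) * (1 - skew v)⁻¹
  let cb : (Fin 4 → ℂ) → Matrix (Fin 2) (Fin 2) ℂ := fun v => (1 + skew v)⁻¹ * (1 - skew v)
  have hM : ∀ i j, (fun v => skew v i j) ∈ ratFun cayDen := by
    intro i j
    have : ∃ q : MvPolynomial (Fin 4) ℂ, (fun v => skew v i j) = fun v => eval v q := by
      fin_cases i <;> fin_cases j
      · exact ⟨Complex.I • X 0, by ext; simp [skew, MvPolynomial.smul_eval]⟩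
      · exact ⟨X 1 + Complex.I • X 2, by ext; simp [skew, MvPolynomial.smul_eval]⟩
      · exact ⟨-X 1 + Complex.I • X 2, by ext; simp [skew, MvPolynomial.smul_eval]⟩
      · exact ⟨Complex.I • X 3, by ext; simp [skew, MvPolynomial.smul_eval]⟩
    obtain ⟨q, hq⟩ := this
    rw [hq]; exact eval_mem_ratFun _ _
  have h1 : ∀ i j, (fun _ : Fin 4 → ℂ => (1 : Matrix (Fin 2) (Fin 2) ℂ) i j) ∈ ratFun cayDen :=
    fun i j => (ratFun cayDen).algebraMap_mem _
  have hp : ∀ i j, (fun v => (1 + skew v) i j) ∈ ratFun cayDen :=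
    fun i j => add_mem (h1 i j) (hM i j)
  have hm : ∀ i j, (fun v => (1 - skew v) i j) ∈ ratFun cayDen :=
    fun i j => sub_mem (h1 i j) (hM i j)
  have hdp : (fun v => ((1 + skew v).det)⁻¹) ∈ ratFun cayDen := by
    simp only [← eval_cayP]
    exact inv_mem_ratFun (mul_comm _ _)
  have hdm : (fun v => ((1 - skew v).det)⁻¹) ∈ ratFun cayDen := by
    simp only [← eval_cayM]
    exact inv_mem_ratFun rfl
  have hinv : ∀ M : (Fin 4 → ℂ) → Matrix (Fin 2) (Fin 2) ℂ,
      (∀ i j, (fun v => M v i j) ∈ ratFun cayDen) → ((fun v => (M v).det⁻¹) ∈ ratFun cayDen) →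
      ∀ i j, (fun v => (M v)⁻¹ i j) ∈ ratFun cayDen := by
    intro M h h' i j
    have e : ∀ v, (M v)⁻¹ i j = (M v).det⁻¹ * (M v).adjugate i j := by
      intro v; rw [Matrix.inv_def, Ring.inverse_eq_inv']; rfl
    simp only [e, Matrix.adjugate_fin_two]
    refine mul_mem h' ?_
    fin_cases i <;> fin_cases j
    · exact h 1 1
    · exact neg_mem (h 0 1)
    · exact neg_mem (h 1 0)
    · exact h 0 0
  have hmul : ∀ M N : (Fin 4 → ℂ) → Matrix (Fin 2) (Fin 2) ℂ,
      (∀ i j, (fun v => M v i j) ∈ ratFun cayDen) → (∀ i j, (fun v => N v i j) ∈ ratFun cayDen) →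
      ∀ i j, (fun v => (M v * N v) i j) ∈ ratFun cayDen := by
    intro M N h h' i j
    simp only [Matrix.mul_apply, Fin.sum_univ_two]
    exact add_mem (mul_mem (h _ _) (h' _ _)) (mul_mem (h _ _) (h' _ _))
  have hca : ∀ i j, (fun v => ca v i j) ∈ ratFun cayDen :=
    hmul _ _ hp (hinv _ hm hdm)
  have hcb : ∀ i j, (fun v => cb v i j) ∈ ratFun cayDen :=
    hmul _ _ (hinv _ hp hdp) hm
  have hconst : ∀ c : ℂ, (fun _ : Fin 4 → ℂ => c) ∈ ratFun cayDen :=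
    fun c => (ratFun cayDen).algebraMap_mem c
  have hact : ∀ i, (fun v => act (cb v) (ca v) x i) ∈ ratFun cayDen := by
    have hY := hmul _ _ (hmul _ (fun _ => ptY x) hcb (fun i j => hconst _)) hca
    intro i
    fin_cases i
    · exact hconst _
    · exact hY 0 0
    · exact mul_mem (hY 1 0) (hconst 2⁻¹)
    · exact mul_mem (hY 0 1) (hconst 2⁻¹)
    · exact add_mem (mul_mem (hconst _) (hca _ _)) (mul_mem (hconst _) (hca _ _))
    · exact add_mem (mul_mem (hconst _) (hca _ _)) (mul_mem (hconst _) (hca _ _))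
    · exact add_mem (mul_mem (hcb _ _) (hconst _)) (mul_mem (hcb _ _) (hconst _))
    · exact add_mem (mul_mem (hcb _ _) (hconst _)) (mul_mem (hcb _ _) (hconst _))
  have hS : ∀ i j, (fun v => spinBlk (ca v) i j) ∈ ratFun cayDen := by
    intro i j
    fin_cases i <;> fin_cases j
    exacts [hconst 1, hconst 0, hconst 0, hconst 0, hconst 0, hca 0 0, hca 0 1, hconst 0,
      hconst 0, hca 1 0, hca 1 1, hconst 0, hconst 0, hconst 0, hconst 0,
      sub_mem (mul_mem (hca _ _) (hca _ _)) (mul_mem (hca _ _) (hca _ _))]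
  have hfun : ∀ i j, (fun v => (P.map (eval x) * spinBlk (ca v) -
      spinBlk (ca v) * P.map (eval (act (cb v) (ca v) x))) i j) ∈ ratFun cayDen := by
    intro i j
    simp only [Matrix.sub_apply, Matrix.mul_apply, Fin.sum_univ_four, Matrix.map_apply]
    have l1 : ∀ k, (fun v => eval x (P i k) * spinBlk (ca v) k j) ∈ ratFun cayDen :=
      fun k => mul_mem (hconst _) (hS _ _)
    have l2 : ∀ k, (fun v => spinBlk (ca v) i k * eval (act (cb v) (ca v) x) (P k j)) ∈
        ratFun cayDen := fun k => mul_mem (hS _ _) (aeval_mem_ratFun _ _ hact _)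
    exact sub_mem (add_mem (add_mem (add_mem (l1 _) (l1 _)) (l1 _)) (l1 _))
      (add_mem (add_mem (add_mem (l2 _) (l2 _)) (l2 _)) (l2 _))
  have hcab : ∀ v, eval v cayDen ≠ 0 → ca v * cb v = 1 := by
    intro v hv
    rw [eval_cayDen] at hv
    have u1 : IsUnit (1 - skew v).det := (left_ne_zero_of_mul hv).isUnit
    have u2 : IsUnit (1 + skew v).det := (right_ne_zero_of_mul hv).isUnit
    have hc : (1 - skew v)⁻¹ * (1 + skew v)⁻¹ = (1 + skew v)⁻¹ * (1 - skew v)⁻¹ := by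
      rw [← Matrix.mul_inv_rev, ← Matrix.mul_inv_rev]
      congr 1; noncomm_ring
    calc (1 + skew v) * (1 - skew v)⁻¹ * ((1 + skew v)⁻¹ * (1 - skew v))
        = (1 + skew v) * ((1 - skew v)⁻¹ * (1 + skew v)⁻¹) * (1 - skew v) := by
          simp only [mul_assoc]
      _ = ((1 + skew v) * (1 + skew v)⁻¹) * ((1 - skew v)⁻¹ * (1 - skew v)) := by
          rw [hc]; simp only [mul_assoc]
      _ = 1 := by rw [Matrix.mul_nonsing_inv _ u2, Matrix.nonsing_inv_mul _ u1, one_mul]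
  have hreal : ∀ v : Fin 4 → ℝ, (ca fun i => (v i : ℂ))ᴴ = cb fun i => (v i : ℂ) := by
    intro v
    simp only [ca, cb]
    rw [Matrix.conjTranspose_mul, Matrix.conjTranspose_nonsing_inv, Matrix.conjTranspose_sub,
      Matrix.conjTranspose_add, skew_conjTranspose, Matrix.conjTranspose_one, sub_neg_eq_add,
      ← sub_eq_add_neg]
  have hzero : ∀ v, eval v cayDen ≠ 0 → P.map (eval x) * spinBlk (ca v) =
      spinBlk (ca v) * P.map (eval (act (cb v) (ca v) x)) := by
    intro v hv
    rw [← sub_eq_zero]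
    ext i j
    refine eq_zero_of_mem_ratFun (hfun i j) (fun r hr => ?_) v hv
    have h2 := hcab _ hr
    rw [← hreal] at h2
    have h3 := h _ h2 x
    rw [hreal] at h3
    rw [h3, sub_self]; rfl
  -- The preimage of `a` under the Cayley transform.
  have hua : IsUnit (1 + a).det := ha.isUnit
  obtain ⟨v, hv⟩ := skew_surjective ((a - 1) * (1 + a)⁻¹)
  have e1 : 1 - skew v = (2 : ℂ) • (1 + a)⁻¹ := by
    have : (1 - skew v) = ((1 + a) - (a - 1)) * (1 + a)⁻¹ := by
      rw [sub_mul, Matrix.mul_nonsing_inv _ hua, hv]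
    rw [this, two_smul]; noncomm_ring
  have e2 : 1 + skew v = (2 : ℂ) • (a * (1 + a)⁻¹) := by
    have : (1 + skew v) = ((1 + a) + (a - 1)) * (1 + a)⁻¹ := by
      rw [add_mul, Matrix.mul_nonsing_inv _ hua, hv]
    rw [this, two_smul]; noncomm_ring
  have hda : a.det ≠ 0 := by
    have := congrArg Matrix.det hab
    rw [Matrix.det_mul, Matrix.det_one] at this
    exact left_ne_zero_of_mul_eq_one this
  have hinvdet : ((1 + a)⁻¹).det ≠ 0 := by
    rw [Matrix.det_nonsing_inv, Ring.inverse_eq_inv']; exact inv_ne_zero ha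
  have hv0 : eval v cayDen ≠ 0 := by
    rw [eval_cayDen, e1, e2, Matrix.det_smul, Matrix.det_smul, Matrix.det_mul]
    have : (2 : ℂ) ^ Fintype.card (Fin 2) ≠ 0 := pow_ne_zero _ two_ne_zero
    exact mul_ne_zero (mul_ne_zero this hinvdet) (mul_ne_zero this (mul_ne_zero hda hinvdet))
  have e3 : ca v = a := by
    have u1 : IsUnit (1 - skew v).det := by
      rw [eval_cayDen] at hv0; exact (left_ne_zero_of_mul hv0).isUnit
    have : 1 + skew v = a * (1 - skew v) := by rw [e1, e2, Matrix.mul_smul]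
    change (1 + skew v) * (1 - skew v)⁻¹ = a
    rw [this, mul_assoc, Matrix.mul_nonsing_inv _ u1, mul_one]
  have e4 : cb v = b := by
    have h5 := hcab v hv0
    rw [e3] at h5
    have hba : b * a = 1 := mul_eq_one_comm.1 hab
    calc cb v = (b * a) * cb v := by rw [hba, one_mul]
      _ = b := by rw [mul_assoc, h5, mul_one]
  have := hzero v hv0
  rwa [e3, e4] at this

/-! ### Invariants and slices -/

/-- The polynomial ring in the symbols of `ã, b̃, c̃, d̃`. -/
abbrev Inv : Type := MvPolynomial (Fin 4) ℂ

/-- The first entry of `Yy`. -/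
def v₁ : Pol := X 1 * X 6 + 2 * X 3 * X 7
/-- The second entry of `Yy`. -/
def v₂ : Pol := 2 * X 2 * X 6 - X 1 * X 7
/-- The first entry of `zY`. -/
def w₁ : Pol := X 1 * X 4 + 2 * X 2 * X 5
/-- The second entry of `zY`. -/
def w₂ : Pol := 2 * X 3 * X 4 - X 1 * X 5
/-- The symbol of `b̃`, which is `tr Y² / 2 = -det Y`. -/
def symbB : Pol := X 1 ^ 2 + 4 * X 2 * X 3
/-- The symbol of `c̃`, which is `zy`. -/
def symbC : Pol := X 4 * X 6 + X 5 * X 7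
/-- The symbol of `d̃`, which is `zYy`. -/
def symbD : Pol := X 4 * v₁ + X 5 * v₂
/-- The determinant of `frameY`. -/
def detY : Pol := X 6 * v₂ - X 7 * v₁
/-- The determinant of `frameZ`. -/
def detZ : Pol := X 4 * w₂ - X 5 * w₁

/-- The inclusion of the invariants into `S(𝔤)`. -/
def inv : Inv →ₐ[ℂ] Pol := aeval ![X 0, symbB, symbC, symbD]

/-- Restriction to the slice of points at which `y` and `Yy` are the standard basis. By the
theorem of Cayley and Hamilton, `Y` is then `(0, symbB; 1, 0)`. -/
def resY : Pol →ₐ[ℂ] Inv :=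
  aeval ![X 0, 0, MvPolynomial.C (1 / 2), MvPolynomial.C (1 / 2) * X 1, X 2, X 3, 1, 0]

/-- Restriction to the slice of points at which `z` and `zY` are the standard basis. -/
def resZ : Pol →ₐ[ℂ] Inv :=
  aeval ![X 0, 0, MvPolynomial.C (1 / 2) * X 1, MvPolynomial.C (1 / 2), 1, 0, X 2, X 3]

lemma C_half_mul_two (σ : Type*) : (MvPolynomial.C 2⁻¹ * 2 : MvPolynomial σ ℂ) = 1 := by
  rw [← map_ofNat MvPolynomial.C, ← map_mul]; norm_num

lemma resY_inv (p : Inv) : resY (inv p) = p := by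
  have h : resY.comp inv = AlgHom.id ℂ Inv := by
    apply MvPolynomial.algHom_ext
    intro i
    have h2 := C_half_mul_two (Fin 4)
    fin_cases i <;> simp [resY, inv, symbB, symbC, symbD, v₁, v₂]
    · rw [map_ofNat]
      linear_combination (2 * MvPolynomial.C 2⁻¹ + 1) * X 1 * h2
    · rw [map_ofNat, mul_comm]
      exact h2
  exact DFunLike.congr_fun h p

lemma inv_injective : Function.Injective inv :=
  Function.LeftInverse.injective resY_inv

lemma detY_ne_zero : detY ≠ 0 := by
  intro h
  have := congrArg (eval ![0, 0, 1 / 2, 0, 0, 0, 1, 0]) h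
  simp [detY, v₁, v₂] at this

lemma detZ_ne_zero : detZ ≠ 0 := by
  intro h
  have := congrArg (eval ![0, 0, 0, 1 / 2, 1, 0, 0, 0]) h
  simp [detZ, w₁, w₂] at this

lemma eq_of_generic {p q D : Pol} (hD : D ≠ 0)
    (h : ∀ x, eval x D ≠ 0 → eval x p = eval x q) : p = q := by
  have : (p - q) * D = 0 := by
    apply MvPolynomial.funext
    intro x
    rw [map_mul, map_sub, map_zero]
    by_cases hx : eval x D = 0
    · rw [hx, mul_zero]
    · rw [h x hx, sub_self, zero_mul]
  exact sub_eq_zero.1 ((mul_eq_zero.1 this).resolve_right hD)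

/-- The matrix with columns `y` and `Yy`. -/
def frameY : Matrix (Fin 2) (Fin 2) Pol := !![X 6, v₁; X 7, v₂]
/-- The matrix with rows `z` and `zY`. -/
def frameZ : Matrix (Fin 2) (Fin 2) Pol := !![X 4, X 5; w₁, w₂]

/-- Evaluation at `x'` is restriction by `r` followed by evaluation of the invariants at `x`, if
this holds for the coordinates. -/
lemma eval_of_act_eq {x x' : Fin 8 → ℂ} {r : Pol →ₐ[ℂ] Inv}
    (h : ∀ i, x' i = eval x (inv (r (X i)))) (p : Pol) : eval x' p = eval x (inv (r p)) := by
  have : (MvPolynomial.aeval x' : Pol →ₐ[ℂ] ℂ) = (MvPolynomial.aeval x).comp (inv.comp r) := by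
    apply MvPolynomial.algHom_ext
    intro i
    simpa [MvPolynomial.coe_aeval_eq_eval] using h i
  have := DFunLike.congr_fun this p
  simpa [MvPolynomial.coe_aeval_eq_eval] using this

/-- An equivariant matrix is determined by its restriction to the slice for `y`: a generic point is
moved to the slice by the element `frameY` of `GL(2)`. -/
lemma UEquivariant.mul_frameY {P : PolMat} (h : UEquivariant P) :
    P * spinBlk frameY = spinBlk frameY * P.map fun p => inv (resY p) := by
  have hD : detY * (1 + X 6 + v₂ + detY) ≠ 0 := by
    intro h
    have := congrArg (eval ![0, 0, 1 / 2, 0, 0, 0, 1, 0]) h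
    simp [detY, v₁, v₂] at this; norm_num at this
  ext1 i j
  refine eq_of_generic hD fun x hx => ?_
  rw [map_mul] at hx
  have hx1 := left_ne_zero_of_mul hx
  have hx2 := right_ne_zero_of_mul hx
  set a := frameY.map (eval x) with ha
  set D := eval x detY with hDdef
  let b : Matrix (Fin 2) (Fin 2) ℂ := D⁻¹ • a.adjugate
  have hdet : a.det = D := by
    rw [ha, Matrix.det_fin_two]; simp [frameY, hDdef, detY]; ring
  have hab : a * b = 1 := by
    rw [Matrix.mul_smul, Matrix.mul_adjugate, hdet, smul_smul, inv_mul_cancel₀ hx1, one_smul]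
  have h1a : (1 + a).det ≠ 0 := by
    convert hx2 using 1
    rw [ha, Matrix.det_fin_two]; simp [frameY, detY]; ring
  have key := h.extend hab h1a x
  have hact : ∀ p, eval (act b a x) p = eval x (inv (resY p)) := by
    apply eval_of_act_eq
    intro i
    have e1 : D = x 6 * (2 * x 2 * x 6 - x 1 * x 7) - x 7 * (x 1 * x 6 + 2 * x 3 * x 7) := by
      simp [hDdef, detY, v₁, v₂]
    have hi : D⁻¹ * D = 1 := inv_mul_cancel₀ hx1
    nth_rewrite 2 [e1] at hi
    clear_value D
    fin_cases i <;>
      simp [act, resY, inv, b, ha, frameY, ptY, Matrix.adjugate_fin_two, Matrix.mul_apply,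
        Fin.sum_univ_two, symbB, symbC, symbD, v₁, v₂]
    · ring
    · linear_combination (1 / 2) * hi
    · linear_combination (1 / 2) * (x 1 ^ 2 + 4 * x 2 * x 3) * hi
    · linear_combination hi
    · ring
  have e1 : P.map (eval (act b a x)) = (P.map fun p => inv (resY p)).map (eval x) := by
    ext i j; exact hact _
  rw [e1, ha, ← spinBlk_map, ← Matrix.map_mul, ← Matrix.map_mul] at key
  exact congrFun (congrFun key i) j

/-- An equivariant matrix is determined by its restriction to the slice for `z`: a generic point is
moved to the slice by the inverse of `frameZ`. -/
lemma UEquivariant.frameZ_mul {P : PolMat} (h : UEquivariant P) :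
    spinBlk frameZ * P = (P.map fun p => inv (resZ p)) * spinBlk frameZ := by
  have hD : detZ * (1 + X 4 + w₂ + detZ) ≠ 0 := by
    intro h
    have := congrArg (eval ![0, 0, 0, 1 / 2, 1, 0, 0, 0]) h
    simp [detZ, w₁, w₂] at this; norm_num at this
  ext1 i j
  refine eq_of_generic hD fun x hx => ?_
  rw [map_mul] at hx
  have hx1 := left_ne_zero_of_mul hx
  have hx2 := right_ne_zero_of_mul hx
  set b := frameZ.map (eval x) with hb
  set D := eval x detZ with hDdef
  let a : Matrix (Fin 2) (Fin 2) ℂ := D⁻¹ • b.adjugate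
  have hdet : b.det = D := by
    rw [hb, Matrix.det_fin_two]; simp [frameZ, hDdef, detZ]
  have hba : b * a = 1 := by
    rw [Matrix.mul_smul, Matrix.mul_adjugate, hdet, smul_smul, inv_mul_cancel₀ hx1, one_smul]
  have hab : a * b = 1 := mul_eq_one_comm.1 hba
  have h1b : (1 + b).det ≠ 0 := by
    convert hx2 using 1
    rw [hb, Matrix.det_fin_two]; simp [frameZ, detZ]; ring
  have h1a : (1 + a).det ≠ 0 := by
    intro h0
    apply h1b
    have : 1 + b = b * (1 + a) := by rw [mul_add, mul_one, hba, add_comm]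
    rw [this, Matrix.det_mul, h0, mul_zero]
  have key := h.extend hab h1a x
  have hact : ∀ p, eval (act b a x) p = eval x (inv (resZ p)) := by
    apply eval_of_act_eq
    intro i
    have e1 : D = x 4 * (2 * x 3 * x 4 - x 1 * x 5) - x 5 * (x 1 * x 4 + 2 * x 2 * x 5) := by
      simp [hDdef, detZ, w₁, w₂]
    have hi : D⁻¹ * D = 1 := inv_mul_cancel₀ hx1
    nth_rewrite 2 [e1] at hi
    clear_value D
    fin_cases i <;>
      simp [act, resZ, inv, a, hb, frameZ, ptY, Matrix.adjugate_fin_two, Matrix.mul_apply,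
        Fin.sum_univ_two, symbB, symbC, symbD, v₁, v₂, w₁, w₂]
    · ring
    · linear_combination (1 / 2) * (x 1 ^ 2 + 4 * x 2 * x 3) * hi
    · linear_combination (1 / 2) * hi
    · linear_combination hi
    · ring
    · ring
  have e1 : P.map (eval (act b a x)) = (P.map fun p => inv (resZ p)).map (eval x) := by
    ext i j; exact hact _
  have hS : spinBlk b * spinBlk a = 1 := by
    have h2 := fun i j => congrFun (congrFun hba i) j
    simp only [Matrix.mul_apply, Fin.sum_univ_two] at h2
    have d : (b 0 0 * b 1 1 - b 0 1 * b 1 0) * (a 0 0 * a 1 1 - a 0 1 * a 1 0) = 1 := by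
      have := congrArg Matrix.det hba
      rwa [Matrix.det_mul, Matrix.det_fin_two, Matrix.det_fin_two, Matrix.det_one] at this
    ext i j
    fin_cases i <;> fin_cases j <;>
      simp [spinBlk, Matrix.mul_apply, Fin.sum_univ_four, h2, d]
  have key2 : spinBlk b * P.map (eval x) = P.map (eval (act b a x)) * spinBlk b := by
    calc spinBlk b * P.map (eval x)
        = spinBlk b * (P.map (eval x) * spinBlk a) * spinBlk b := by
          rw [mul_assoc, mul_assoc _ (spinBlk a), mul_eq_one_comm.1 hS, mul_one]
      _ = _ := by rw [key, ← mul_assoc, hS, one_mul]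
  rw [e1, hb, ← spinBlk_map, ← Matrix.map_mul, ← Matrix.map_mul] at key2
  exact congrFun (congrFun key2 i) j

/-! ### The symbols of the sixteen elements -/

/-- The symbol of `ẽ`. -/
def symE : PolMat := !![0, 0, 0, 0; X 6, 0, 0, 0; X 7, 0, 0, 0; 0, -X 7, X 6, 0]
/-- The symbol of `f̃`. -/
def symF : PolMat := !![0, -2 * X 4, -2 * X 5, 0; 0, 0, 0, 2 * X 5; 0, 0, 0, -2 * X 4; 0, 0, 0, 0]
/-- The symbol of `g̃`. -/
def symG : PolMat := !![0, 0, 0, 0; 0, -2, 0, 0; 0, 0, -2, 0; 0, 0, 0, -4]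
/-- The symbol of `h̃`. -/
def symH : PolMat := !![0, -2 * w₁, -2 * w₂, 0; 0, 0, 0, 2 * w₂; 0, 0, 0, -2 * w₁; 0, 0, 0, 0]
/-- The symbol of `ĩ`. -/
def symI : PolMat :=
  !![0, 0, 0, 0; 0, -2 * X 1, -4 * X 3, 0; 0, -4 * X 2, 2 * X 1, 0; 0, 0, 0, 0]
/-- The symbol of `j̃`. -/
def symJ : PolMat := !![0, 0, 0, 0; v₁, 0, 0, 0; v₂, 0, 0, 0; 0, -v₂, v₁, 0]

/-- The symbols of the elements of `T̃`, in the same order. -/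
def symT : Fin 16 → PolMat :=
  ![1, symE, symF, symG, symH, symI, symJ, symE * symF, symE * symG, symF * symG, symG ^ 2,
    symE * symI, symE * symJ, symF * symH, symF * symI, symF * symJ]

/-- The combination of the matrices `symT i` with coefficients `k i`, written out. -/
def comb (k : Fin 16 → Pol) : PolMat :=
  !![k 0 - 2 * symbD * k 15, -2 * X 4 * (k 2 - 2 * k 9) - 2 * w₁ * (k 4 - 2 * k 14),
      -2 * X 5 * (k 2 - 2 * k 9) - 2 * w₂ * (k 4 - 2 * k 14), -4 * detZ * k 13;
    X 6 * k 1 + v₁ * k 6,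
      k 0 - 2 * k 3 + 4 * k 10 - 2 * X 1 * k 5 - 2 * X 6 * X 4 * k 7 - 2 * X 5 * v₂ * k 15,
      -4 * X 3 * k 5 - 2 * X 6 * X 5 * k 7 + 2 * X 5 * v₁ * k 15,
      2 * X 5 * (k 2 - 4 * k 9) + 2 * w₂ * k 4;
    X 7 * k 1 + v₂ * k 6,
      -4 * X 2 * k 5 - 2 * X 7 * X 4 * k 7 + 2 * X 4 * v₂ * k 15,
      k 0 - 2 * k 3 + 4 * k 10 + 2 * X 1 * k 5 - 2 * X 7 * X 5 * k 7 - 2 * X 4 * v₁ * k 15,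
      -2 * X 4 * (k 2 - 4 * k 9) - 2 * w₁ * k 4;
    detY * k 12, -X 7 * (k 1 - 2 * k 8) - v₂ * (k 6 + 2 * k 11),
      X 6 * (k 1 - 2 * k 8) + v₁ * (k 6 + 2 * k 11), k 0 - 4 * k 3 + 16 * k 10 - 2 * symbC * k 7]

lemma symE_mul_symF : symE * symF =
  !![0, 0, 0, 0; 0, -2 * X 6 * X 4, -2 * X 6 * X 5, 0;
    0, -2 * X 7 * X 4, -2 * X 7 * X 5, 0; 0, 0, 0, -2 * symbC] := by
  ext1 i j
  fin_cases i <;> fin_cases j <;> simp [symE, symF, symbC] <;> ring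

lemma symE_mul_symG : symE * symG =
  !![0, 0, 0, 0; 0, 0, 0, 0; 0, 0, 0, 0; 0, 2 * X 7, -2 * X 6, 0] := by
  ext1 i j
  fin_cases i <;> fin_cases j <;> simp [symE, symG] <;> ring

lemma symF_mul_symG : symF * symG =
  !![0, 4 * X 4, 4 * X 5, 0; 0, 0, 0, -8 * X 5; 0, 0, 0, 8 * X 4; 0, 0, 0, 0] := by
  ext1 i j
  fin_cases i <;> fin_cases j <;> simp [symF, symG] <;> ring

lemma symG_sq : symG ^ 2 =
  !![0, 0, 0, 0; 0, 4, 0, 0; 0, 0, 4, 0; 0, 0, 0, 16] := by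
  ext1 i j
  fin_cases i <;> fin_cases j <;> simp [symG, pow_two] <;> ring

lemma symE_mul_symI : symE * symI =
  !![0, 0, 0, 0; 0, 0, 0, 0; 0, 0, 0, 0; 0, -2 * v₂, 2 * v₁, 0] := by
  ext1 i j
  fin_cases i <;> fin_cases j <;> simp [symE, symI, v₁, v₂] <;> ring

lemma symE_mul_symJ : symE * symJ =
  !![0, 0, 0, 0; 0, 0, 0, 0; 0, 0, 0, 0; detY, 0, 0, 0] := by
  ext1 i j
  fin_cases i <;> fin_cases j <;> simp [symE, symJ, detY]
  ring

lemma symF_mul_symH : symF * symH =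
  !![0, 0, 0, -4 * detZ; 0, 0, 0, 0; 0, 0, 0, 0; 0, 0, 0, 0] := by
  ext1 i j
  fin_cases i <;> fin_cases j <;> simp [symF, symH, detZ]
  ring

lemma symF_mul_symI : symF * symI =
  !![0, 4 * w₁, 4 * w₂, 0; 0, 0, 0, 0; 0, 0, 0, 0; 0, 0, 0, 0] := by
  ext1 i j
  fin_cases i <;> fin_cases j <;> simp [symF, symI, w₁, w₂]
  all_goals ring

lemma symF_mul_symJ : symF * symJ =
  !![-2 * symbD, 0, 0, 0; 0, -2 * X 5 * v₂, 2 * X 5 * v₁, 0;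
    0, 2 * X 4 * v₂, -2 * X 4 * v₁, 0; 0, 0, 0, 0] := by
  ext1 i j
  fin_cases i <;> fin_cases j <;> simp [symF, symJ, symbD]
  ring

lemma one_fin_four : (1 : PolMat) = !![1, 0, 0, 0; 0, 1, 0, 0; 0, 0, 1, 0; 0, 0, 0, 1] := by
  ext1 i j
  fin_cases i <;> fin_cases j <;> simp

lemma sum_smul_symT (k : Fin 16 → Pol) : ∑ i, k i • symT i = comb k := by
  have h : ∑ i, k i • symT i = k 0 • 1 + k 1 • symE + k 2 • symF + k 3 • symG + k 4 • symH +
      k 5 • symI + k 6 • symJ + k 7 • (symE * symF) + k 8 • (symE * symG) + k 9 • (symF * symG) +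
      k 10 • symG ^ 2 + k 11 • (symE * symI) + k 12 • (symE * symJ) + k 13 • (symF * symH) +
      k 14 • (symF * symI) + k 15 • (symF * symJ) := by
    simp only [Fin.sum_univ_succ, Fin.sum_univ_zero]
    simp only [← add_assoc, add_zero]
    rfl
  rw [h, symE_mul_symF, symE_mul_symG, symF_mul_symG, symG_sq,
    symE_mul_symI, symE_mul_symJ, symF_mul_symH, symF_mul_symI, symF_mul_symJ]
  simp only [symE, symF, symG, symH, symI, symJ, comb, one_fin_four, Matrix.smul_of,
    Matrix.of_add_of, Matrix.smul_cons, Matrix.cons_add_cons, Matrix.smul_empty,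
    Matrix.empty_add_empty, smul_eq_mul]
  ext1 i j
  fin_cases i <;> fin_cases j <;> simp <;> ring

/-! ### The module of covariants -/

lemma inv_X0 : inv (X 0) = X 0 := by simp [inv]
lemma inv_X1 : inv (X 1) = symbB := by simp [inv]
lemma inv_X2 : inv (X 2) = symbC := by simp [inv]
lemma inv_X3 : inv (X 3) = symbD := by simp [inv]

lemma inv_ofNat (n : ℕ) [n.AtLeastTwo] : inv (OfNat.ofNat n) = OfNat.ofNat n := map_ofNat inv n

lemma exists_two_mul (q : Inv) : ∃ r, 2 * r = q :=
  ⟨MvPolynomial.C 2⁻¹ * q, by rw [← mul_assoc, mul_comm 2, C_half_mul_two, one_mul]⟩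

lemma exists_four_mul (q : Inv) : ∃ r, 4 * r = q := by
  obtain ⟨r, rfl⟩ := exists_two_mul q
  obtain ⟨s, rfl⟩ := exists_two_mul r
  exact ⟨s, by ring⟩

lemma exists_eight_mul (q : Inv) : ∃ r, 8 * r = q := by
  obtain ⟨r, rfl⟩ := exists_four_mul q
  obtain ⟨s, rfl⟩ := exists_two_mul r
  exact ⟨s, by ring⟩

/-- `y, Yy` are independent over the invariants. -/
lemma indepY {α β : Inv} (h1 : inv α * X 6 + inv β * v₁ = 0) (h2 : inv α * X 7 + inv β * v₂ = 0) :
    α = 0 ∧ β = 0 := by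
  have e1 : inv α * detY = 0 := by rw [detY]; linear_combination v₂ * h1 - v₁ * h2
  have e2 : inv β * detY = 0 := by rw [detY]; linear_combination X 6 * h2 - X 7 * h1
  refine ⟨inv_injective ?_, inv_injective ?_⟩
  · rw [map_zero]; exact (mul_eq_zero.1 e1).resolve_right detY_ne_zero
  · rw [map_zero]; exact (mul_eq_zero.1 e2).resolve_right detY_ne_zero

/-- `z, zY` are independent over the invariants. -/
lemma indepZ {α β : Inv} (h1 : inv α * X 4 + inv β * w₁ = 0) (h2 : inv α * X 5 + inv β * w₂ = 0) :
    α = 0 ∧ β = 0 := by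
  have e1 : inv α * detZ = 0 := by rw [detZ]; linear_combination w₂ * h1 - w₁ * h2
  have e2 : inv β * detZ = 0 := by rw [detZ]; linear_combination X 4 * h2 - X 5 * h1
  refine ⟨inv_injective ?_, inv_injective ?_⟩
  · rw [map_zero]; exact (mul_eq_zero.1 e1).resolve_right detZ_ne_zero
  · rw [map_zero]; exact (mul_eq_zero.1 e2).resolve_right detZ_ne_zero

/-- The matrices `1`, `Y`, `yz`, `Yyz` are independent over the invariants, as their restrictions to
the slice for `y` show. -/
lemma indepBlock {a b α β : Inv}
    (h11 : inv a + inv b * X 1 + inv α * (X 6 * X 4) + inv β * (v₁ * X 4) = 0)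
    (h12 : inv b * (2 * X 3) + inv α * (X 6 * X 5) + inv β * (v₁ * X 5) = 0)
    (h21 : inv b * (2 * X 2) + inv α * (X 7 * X 4) + inv β * (v₂ * X 4) = 0)
    (h22 : inv a - inv b * X 1 + inv α * (X 7 * X 5) + inv β * (v₂ * X 5) = 0) :
    a = 0 ∧ b = 0 ∧ α = 0 ∧ β = 0 := by
  have k11 := congrArg resY h11
  have k12 := congrArg resY h12
  have k21 := congrArg resY h21
  have k22 := congrArg resY h22
  simp only [map_add, map_mul, map_sub, map_zero, resY_inv] at k11 k12 k21 k22
  have h2 := C_half_mul_two (Fin 4)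
  have r1 : resY (X 1) = 0 := by simp [resY]
  have r2 : resY (X 2) = MvPolynomial.C 2⁻¹ := by simp [resY]
  have r3 : resY (X 3) = MvPolynomial.C 2⁻¹ * X 1 := by simp [resY]
  have r4 : resY (X 4) = X 2 := by simp [resY]
  have r5 : resY (X 5) = X 3 := by simp [resY]
  have r6 : resY (X 6) = 1 := by simp [resY]
  have r7 : resY (X 7) = 0 := by simp [resY]
  have s1 : resY v₁ = 0 := by simp [v₁, r1, r6, r7]
  have s2 : resY v₂ = 1 := by
    rw [v₂, map_sub, map_mul, map_mul, map_mul, r1, r2, r6, r7, map_ofNat]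
    linear_combination h2
  rw [r1, r4, r6, s1] at k11
  rw [r3, r5, r6, s1, map_ofNat] at k12
  rw [r2, r4, r7, s2, map_ofNat] at k21
  rw [r1, r5, r7, s2] at k22
  have hb : b = -β * X 2 := by linear_combination k21 - b * h2
  have ha : a = -β * X 3 := by linear_combination k22
  have hβ : β * (X 3 ^ 2 - X 2 ^ 2 * X 1) = 0 := by
    linear_combination (- X 3) * k11 + X 3 * ha + X 2 * k12 - X 2 * X 1 * hb - b * X 1 * X 2 * h2
  have hne : (X 3 ^ 2 - X 2 ^ 2 * X 1 : Inv) ≠ 0 := by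
    intro h
    have := congrArg (eval ![0, 0, 0, 1]) h
    simp at this
  have hβ0 : β = 0 := (mul_eq_zero.1 hβ).resolve_right hne
  have ha0 : a = 0 := by rw [ha, hβ0]; ring
  have hα : α * X 2 = 0 := by rw [ha0] at k11; linear_combination k11
  exact ⟨ha0, by rw [hb, hβ0]; ring,
    (mul_eq_zero.1 hα).resolve_right (MvPolynomial.X_ne_zero _), hβ0⟩

/-- The symbols of the sixteen elements are independent over the invariants. -/
lemma symT_independent (c : Fin 16 → Inv) (h : ∑ i, inv (c i) • symT i = 0) : c = 0 := by
  rw [sum_smul_symT fun i => inv (c i)] at h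
  have e := fun i j => congrFun (congrFun h i) j
  have e00 := e 0 0
  have e01 := e 0 1
  have e02 := e 0 2
  have e03 := e 0 3
  have e10 := e 1 0
  have e11 := e 1 1
  have e12 := e 1 2
  have e13 := e 1 3
  have e20 := e 2 0
  have e21 := e 2 1
  have e22 := e 2 2
  have e23 := e 2 3
  have e30 := e 3 0
  have e31 := e 3 1
  have e32 := e 3 2
  have e33 := e 3 3
  simp [comb] at e00 e01 e02 e03 e10 e11 e12 e13 e20 e21 e22 e23 e30 e31 e32 e33
  have i2 := inv_ofNat 2
  have i4 := inv_ofNat 4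
  have two : (2 : Inv) ≠ 0 := two_ne_zero
  have c13 : c 13 = 0 := inv_injective (by rw [map_zero]; exact e03.resolve_left detZ_ne_zero)
  have c12 : c 12 = 0 := inv_injective (by rw [map_zero]; exact e30.resolve_left detY_ne_zero)
  obtain ⟨c1, c6⟩ : c 1 = 0 ∧ c 6 = 0 :=
    indepY (by linear_combination e10) (by linear_combination e20)
  obtain ⟨c8, c11⟩ : c 1 - 2 * c 8 = 0 ∧ c 6 + 2 * c 11 = 0 := by
    apply indepY <;> simp only [map_sub, map_add, map_mul, i2]
    · linear_combination e32
    · linear_combination -e31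
  obtain ⟨c9, c14⟩ : 2 * (c 2 - 2 * c 9) = 0 ∧ 2 * (c 4 - 2 * c 14) = 0 := by
    apply indepZ <;> simp only [map_sub, map_mul, i2]
    · linear_combination -e01
    · linear_combination -e02
  obtain ⟨c2, c4⟩ : 2 * (c 2 - 4 * c 9) = 0 ∧ 2 * c 4 = 0 := by
    apply indepZ <;> simp only [map_sub, map_mul, i2, i4]
    · linear_combination -e23
    · linear_combination e13
  obtain ⟨c3, c5, c7, c15⟩ : c 0 - 2 * c 3 + 4 * c 10 - 2 * X 3 * c 15 = 0 ∧ -2 * c 5 = 0 ∧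
      -2 * c 7 = 0 ∧ 2 * c 15 = 0 := by
    apply indepBlock <;> simp only [map_sub, map_add, map_mul, map_neg, i2, i4, inv_X3, symbD]
    · linear_combination e11
    · linear_combination e12
    · linear_combination e21
    · linear_combination e22
  have c15' : c 15 = 0 := (mul_eq_zero.1 c15).resolve_left two
  have c7' : c 7 = 0 := by linear_combination (mul_eq_zero.1 c7).resolve_left (neg_ne_zero.2 two)
  have c5' : c 5 = 0 := (mul_eq_zero.1 c5).resolve_left (neg_ne_zero.2 two)
  have c4' : c 4 = 0 := (mul_eq_zero.1 c4).resolve_left two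
  have c14' : c 14 = 0 := by
    have : 4 * c 14 = 0 := by linear_combination 2 * c4' - c14
    exact (mul_eq_zero.1 this).resolve_left (by norm_num)
  have c9' : c 9 = 0 := by
    have : 4 * c 9 = 0 := by linear_combination c9 - c2
    exact (mul_eq_zero.1 this).resolve_left (by norm_num)
  have c2' : c 2 = 0 := by
    have : 2 * c 2 = 0 := by linear_combination c9 + 4 * c9'
    exact (mul_eq_zero.1 this).resolve_left two
  have c8' : c 8 = 0 := by
    have : 2 * c 8 = 0 := by linear_combination c1 - c8
    exact (mul_eq_zero.1 this).resolve_left two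
  have c11' : c 11 = 0 := by
    have : 2 * c 11 = 0 := by linear_combination c11 - c6
    exact (mul_eq_zero.1 this).resolve_left two
  have c0' : c 0 = 0 := by
    apply inv_injective
    rw [c15', map_zero] at e00
    rw [map_zero]; linear_combination e00
  have c33 : c 0 - 4 * c 3 + 16 * c 10 = 0 := by
    apply inv_injective
    rw [c7', map_zero] at e33
    simp only [map_sub, map_add, map_mul, i4, inv_ofNat 16, map_zero]
    linear_combination e33
  have c10' : c 10 = 0 := by
    have : 8 * c 10 = 0 := by linear_combination c33 - 2 * c3 + c0' - 4 * X 3 * c15'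
    exact (mul_eq_zero.1 this).resolve_left (by norm_num)
  have c3' : c 3 = 0 := by
    have : 2 * c 3 = 0 := by linear_combination c0' + 4 * c10' - c3 - 2 * X 3 * c15'
    exact (mul_eq_zero.1 this).resolve_left two
  funext i
  fin_cases i
  exacts [c0', c1, c2', c3', c4', c5', c6, c7', c8', c9', c10', c11', c12, c13, c14', c15']

/-- The `2 × 2` block of an equivariant matrix is a combination of `1`, `Y`, `yz`, `yzY`. The
hypotheses say that it is equivariant, in terms of its restrictions `q` and `q'` to the two
slices. -/
lemma block_decomposition {P : Matrix (Fin 2) (Fin 2) Pol} {q q' : Matrix (Fin 2) (Fin 2) Inv}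
    (hy : P * frameY = frameY * q.map inv) (hz : frameZ * P = q'.map inv * frameZ) :
    ∃ α β : Inv,
      P 0 0 = inv (q 1 1) + inv (q 1 0) * X 1 + X 6 * (inv α * X 4 + inv β * w₁) ∧
      P 0 1 = inv (q 1 0) * (2 * X 3) + X 6 * (inv α * X 5 + inv β * w₂) ∧
      P 1 0 = inv (q 1 0) * (2 * X 2) + X 7 * (inv α * X 4 + inv β * w₁) ∧
      P 1 1 = inv (q 1 1) - inv (q 1 0) * X 1 + X 7 * (inv α * X 5 + inv β * w₂) := by
  have y := fun i j => congrFun (congrFun hy i) j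
  have z := fun i j => congrFun (congrFun hz i) j
  simp only [Matrix.mul_apply, Fin.sum_univ_two, Matrix.map_apply] at y z
  have y00 := y 0 0
  have y01 := y 0 1
  have y10 := y 1 0
  have y11 := y 1 1
  have z00 := z 0 0
  have z01 := z 0 1
  have z10 := z 1 0
  have z11 := z 1 1
  simp [frameY] at y00 y01 y10 y11
  simp [frameZ] at z00 z01 z10 z11
  generalize P 0 0 = p00 at *
  generalize P 0 1 = p01 at *
  generalize P 1 0 = p10 at *
  generalize P 1 1 = p11 at *
  -- The matrix `P - q₁₁ - q₁₀ Y` has image in the line spanned by `y`.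
  have h0 : X 7 * (p00 - inv (q 1 1) - inv (q 1 0) * X 1) =
      X 6 * (p10 - inv (q 1 0) * (2 * X 2)) := by
    refine mul_left_cancel₀ detY_ne_zero ?_
    simp only [detY, v₁, v₂] at *
    linear_combination X 7 * ((2 * X 2 * X 6 - X 1 * X 7) * y00 - X 7 * y01) -
      X 6 * ((2 * X 2 * X 6 - X 1 * X 7) * y10 - X 7 * y11)
  have h1 : X 7 * (p01 - inv (q 1 0) * (2 * X 3)) =
      X 6 * (p11 - inv (q 1 1) + inv (q 1 0) * X 1) := by
    refine mul_left_cancel₀ detY_ne_zero ?_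
    simp only [detY, v₁, v₂] at *
    linear_combination X 7 * (X 6 * y01 - (X 1 * X 6 + 2 * X 3 * X 7) * y00) -
      X 6 * (X 6 * y11 - (X 1 * X 6 + 2 * X 3 * X 7) * y10)
  -- So it is the product of the column `y` and a row `u`.
  have hdvd : ∀ f g : Pol, X 7 * f = X 6 * g → ∃ w, f = X 6 * w ∧ g = X 7 * w := by
    intro f g h
    have hp : Prime (X 6 : Pol) := MvPolynomial.X_prime
    have h67 : ¬ (X 6 : Pol) ∣ X 7 := by
      rw [MvPolynomial.X_dvd_X]; decide
    obtain ⟨w, rfl⟩ := (hp.dvd_or_dvd (Dvd.intro _ h.symm)).resolve_left h67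
    refine ⟨w, rfl, mul_left_cancel₀ hp.ne_zero ?_⟩
    linear_combination -h
  obtain ⟨u0, hu0, hu0'⟩ := hdvd _ _ h0
  obtain ⟨u1, hu1, hu1'⟩ := hdvd _ _ h1
  -- The covector `u` is a combination of `z` and `zY` with coefficients in the fraction field.
  have k1 : inv (X 2) * u0 = inv (q' 0 0 - q 1 1) * X 4 + inv (q' 0 1 - q 1 0) * w₁ := by
    rw [inv_X2, map_sub, map_sub]
    simp only [symbC, w₁, w₂] at *
    linear_combination z00 - X 4 * hu0 - X 5 * hu0'
  have k2 : inv (X 2) * u1 = inv (q' 0 0 - q 1 1) * X 5 + inv (q' 0 1 - q 1 0) * w₂ := by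
    rw [inv_X2, map_sub, map_sub]
    simp only [symbC, w₁, w₂] at *
    linear_combination z01 - X 4 * hu1 - X 5 * hu1'
  have k3 : inv (X 3) * u0 =
      inv (q' 1 0 - X 1 * q 1 0) * X 4 + inv (q' 1 1 - q 1 1) * w₁ := by
    rw [inv_X3, map_sub, map_sub, map_mul, inv_X1]
    simp only [symbB, symbD, v₁, v₂, w₁, w₂] at *
    linear_combination z10 - (X 1 * X 4 + 2 * X 2 * X 5) * hu0 -
      (2 * X 3 * X 4 - X 1 * X 5) * hu0'
  have k4 : inv (X 3) * u1 =
      inv (q' 1 0 - X 1 * q 1 0) * X 5 + inv (q' 1 1 - q 1 1) * w₂ := by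
    rw [inv_X3, map_sub, map_sub, map_mul, inv_X1]
    simp only [symbB, symbD, v₁, v₂, w₁, w₂] at *
    linear_combination z11 - (X 1 * X 4 + 2 * X 2 * X 5) * hu1 -
      (2 * X 3 * X 4 - X 1 * X 5) * hu1'
  have hdvd2 : ∀ f g : Inv, X 3 * f = X 2 * g → ∃ w, f = X 2 * w := by
    intro f g h
    have hp : Prime (X 2 : Inv) := MvPolynomial.X_prime
    have h23 : ¬ (X 2 : Inv) ∣ X 3 := by
      rw [MvPolynomial.X_dvd_X]; decide
    exact (hp.dvd_or_dvd (Dvd.intro _ h.symm)).resolve_left h23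
  -- Elimination of `u` leaves a relation in the invariants, which shows that `X 2`, the symbol of
  -- `c̃`, divides both coefficients.
  obtain ⟨l1, l2⟩ : X 3 * (q' 0 0 - q 1 1) - X 2 * (q' 1 0 - X 1 * q 1 0) = 0 ∧
      X 3 * (q' 0 1 - q 1 0) - X 2 * (q' 1 1 - q 1 1) = 0 := by
    apply indepZ <;> rw [map_sub, map_sub, map_mul inv (X 3), map_mul inv (X 2), map_mul inv (X 3),
      map_mul inv (X 2)]
    · linear_combination inv (X 2) * k3 - inv (X 3) * k1
    · linear_combination inv (X 2) * k4 - inv (X 3) * k2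
  obtain ⟨α, hα⟩ := hdvd2 _ _ (sub_eq_zero.1 l1)
  obtain ⟨β, hβ⟩ := hdvd2 _ _ (sub_eq_zero.1 l2)
  rw [hα, hβ, map_mul, map_mul] at k1 k2
  have hX2 : inv (X 2) ≠ 0 := by
    rw [← map_zero inv]; exact inv_injective.ne (MvPolynomial.X_ne_zero _)
  have m1 : u0 = inv α * X 4 + inv β * w₁ :=
    mul_left_cancel₀ hX2 (by linear_combination k1)
  have m2 : u1 = inv α * X 5 + inv β * w₂ :=
    mul_left_cancel₀ hX2 (by linear_combination k2)
  refine ⟨α, β, ?_, ?_, ?_, ?_⟩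
  · rw [← m1]; linear_combination hu0
  · rw [← m2]; linear_combination hu1
  · rw [← m1]; linear_combination hu0'
  · rw [← m2]; linear_combination hu1'

/-- The module of covariants: an equivariant matrix of polynomials is a combination of the symbols
of the sixteen elements, with coefficients polynomial in the symbols of `ã, b̃, c̃, d̃`. -/
lemma UEquivariant.exists_comb {P : PolMat} (h : UEquivariant P) :
    ∃ c : Fin 16 → Inv, P = ∑ i, inv (c i) • symT i := by
  have hy := fun i j => congrFun (congrFun h.mul_frameY i) j
  have hz := fun i j => congrFun (congrFun h.frameZ_mul i) j
  have y00 := hy 0 0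
  have y10 := hy 1 0
  have y20 := hy 2 0
  have y30 := hy 3 0
  have y31 := hy 3 1
  have y32 := hy 3 2
  have y33 := hy 3 3
  have z01 := hz 0 1
  have z02 := hz 0 2
  have z03 := hz 0 3
  have z13 := hz 1 3
  have z23 := hz 2 3
  simp [spinBlk, frameY, Matrix.mul_apply, Fin.sum_univ_four] at y00 y10 y20 y30 y31 y32 y33
  simp [spinBlk, frameZ, Matrix.mul_apply, Fin.sum_univ_four] at z01 z02 z03 z13 z23
  have hD : X 6 * v₂ - v₁ * X 7 = detY := by rw [detY]; ring
  have hE : X 4 * w₂ - X 5 * w₁ = detZ := by rw [detZ]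
  rw [hD] at y30 y31 y32 y33
  rw [hE] at z03 z13 z23
  have p33 : P 3 3 = inv (resY (P 3 3)) :=
    mul_left_cancel₀ detY_ne_zero (by linear_combination y33)
  have p31 : P 3 1 = v₂ * inv (resY (P 3 1)) - X 7 * inv (resY (P 3 2)) := by
    refine mul_left_cancel₀ detY_ne_zero ?_
    rw [detY] at *
    linear_combination v₂ * y31 - X 7 * y32
  have p32 : P 3 2 = X 6 * inv (resY (P 3 2)) - v₁ * inv (resY (P 3 1)) := by
    refine mul_left_cancel₀ detY_ne_zero ?_
    rw [detY] at *
    linear_combination X 6 * y32 - v₁ * y31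
  have p13 : P 1 3 = w₂ * inv (resZ (P 1 3)) - X 5 * inv (resZ (P 2 3)) := by
    refine mul_left_cancel₀ detZ_ne_zero ?_
    rw [detZ] at *
    linear_combination w₂ * z13 - X 5 * z23
  have p23 : P 2 3 = X 4 * inv (resZ (P 2 3)) - w₁ * inv (resZ (P 1 3)) := by
    refine mul_left_cancel₀ detZ_ne_zero ?_
    rw [detZ] at *
    linear_combination X 4 * z23 - w₁ * z13
  let Pb : Matrix (Fin 2) (Fin 2) Pol := !![P 1 1, P 1 2; P 2 1, P 2 2]
  obtain ⟨α, β, b00, b01, b10, b11⟩ := block_decomposition (P := Pb) (q := Pb.map resY)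
    (q' := Pb.map resZ) (by
      have y11 := hy 1 1
      have y12 := hy 1 2
      have y21 := hy 2 1
      have y22 := hy 2 2
      simp [spinBlk, Matrix.mul_apply, Fin.sum_univ_four] at y11 y12 y21 y22
      ext1 i j
      fin_cases i <;> fin_cases j <;> simpa [Pb, Matrix.mul_apply, Fin.sum_univ_two])
    (by
      have z11 := hz 1 1
      have z12 := hz 1 2
      have z21 := hz 2 1
      have z22 := hz 2 2
      simp [spinBlk, Matrix.mul_apply, Fin.sum_univ_four] at z11 z12 z21 z22
      ext1 i j
      fin_cases i <;> fin_cases j <;> simpa [Pb, Matrix.mul_apply, Fin.sum_univ_two])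
  simp [Pb] at b00 b01 b10 b11
  set q00 := resY (P 0 0)
  set q10 := resY (P 1 0)
  set q20 := resY (P 2 0)
  set q30 := resY (P 3 0)
  set q31 := resY (P 3 1)
  set q32 := resY (P 3 2)
  set q33 := resY (P 3 3)
  set q21 := resY (P 2 1)
  set q22 := resY (P 2 2)
  set r01 := resZ (P 0 1)
  set r02 := resZ (P 0 2)
  set r03 := resZ (P 0 3)
  set r13 := resZ (P 1 3)
  set r23 := resZ (P 2 3)
  -- The coefficients solve the linear system that `comb` expresses, entry by entry.
  obtain ⟨c2, h2⟩ := exists_two_mul (r23 - 2 * r01)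
  obtain ⟨c4, h4⟩ := exists_two_mul r13
  obtain ⟨c5, h5⟩ := exists_two_mul (-(q21 + X 2 * β))
  obtain ⟨c7, h7⟩ := exists_two_mul (-α)
  obtain ⟨c8, h8⟩ := exists_two_mul (q10 - q32)
  obtain ⟨c9, h9⟩ := exists_four_mul (r23 - r01)
  obtain ⟨c10, h10⟩ := exists_eight_mul ((q00 - X 3 * β) - 2 * q22 + (q33 - X 2 * α))
  obtain ⟨c3, h3⟩ := exists_two_mul (4 * c10 - q22 + (q00 - X 3 * β))
  obtain ⟨c11, h11⟩ := exists_two_mul (-q31 - q20)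
  obtain ⟨c13, h13⟩ := exists_four_mul (-r03)
  obtain ⟨c14, h14⟩ := exists_four_mul (r02 + r13)
  obtain ⟨c15, h15⟩ := exists_two_mul (-β)
  refine ⟨![q00 - X 3 * β, q10, c2, c3, c4, c5, q20, c7, c8, c9, c10, c11, q30, c13, c14, c15], ?_⟩
  rw [sum_smul_symT fun i => inv _]
  replace h2 := congrArg inv h2
  replace h3 := congrArg inv h3
  replace h4 := congrArg inv h4
  replace h5 := congrArg inv h5
  replace h7 := congrArg inv h7
  replace h8 := congrArg inv h8
  replace h9 := congrArg inv h9
  replace h10 := congrArg inv h10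
  replace h11 := congrArg inv h11
  replace h13 := congrArg inv h13
  replace h14 := congrArg inv h14
  replace h15 := congrArg inv h15
  have i2 : inv 2 = 2 := inv_ofNat 2
  have i4 : inv 4 = 4 := inv_ofNat 4
  have i8 : inv 8 = 8 := inv_ofNat 8
  simp only [map_mul, map_sub, map_add, map_neg, i2, i4, inv_X2, inv_X3] at h2 h3 h4 h5 h7 h8
  simp only [map_mul, map_sub, map_add, map_neg, i2, i4, i8, inv_X2, inv_X3] at h9 h10 h11 h13 h14
  simp only [map_neg, map_mul, i2] at h15
  ext1 i j
  fin_cases i <;> fin_cases j <;> simp [comb, inv_X3]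
  · linear_combination y00 + symbD * h15
  · linear_combination z01 + X 4 * h2 - X 4 * h9 + w₁ * h4 - w₁ * h14
  · linear_combination z02 + X 5 * h2 - X 5 * h9 + w₂ * h4 - w₂ * h14
  · linear_combination z03 + detZ * h13
  · linear_combination y10
  · simp only [symbC, symbD, v₁, v₂, w₁] at h3 h5 b00 ⊢
    linear_combination b00 + h3 + X 1 * h5 + X 6 * X 4 * h7 +
      X 5 * (2 * X 2 * X 6 - X 1 * X 7) * h15
  · simp only [symbC, v₁, w₂] at h5 b01 ⊢
    linear_combination b01 + 2 * X 3 * h5 + X 6 * X 5 * h7 -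
      X 5 * (X 1 * X 6 + 2 * X 3 * X 7) * h15
  · linear_combination p13 - X 5 * h2 + 2 * X 5 * h9 - w₂ * h4
  · linear_combination y20
  · simp only [symbC, v₂, w₁] at h5 b10 ⊢
    linear_combination b10 + 2 * X 2 * h5 + X 7 * X 4 * h7 -
      X 4 * (2 * X 2 * X 6 - X 1 * X 7) * h15
  · simp only [symbC, symbD, v₁, v₂, w₂] at h3 h5 b11 ⊢
    linear_combination b11 + h3 - X 1 * h5 + X 7 * X 5 * h7 +
      X 4 * (X 1 * X 6 + 2 * X 3 * X 7) * h15
  · linear_combination p23 + X 4 * h2 - 2 * X 4 * h9 + w₁ * h4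
  · linear_combination y30
  · linear_combination p31 - X 7 * h8 + v₂ * h11
  · linear_combination p32 + X 6 * h8 - v₁ * h11
  · linear_combination p33 + 2 * h3 - h10 + symbC * h7

/-! ### The action of `K` on symbols -/

lemma adU_u (x : K) (X : g) : adU x (u X) = u (adg x X) :=
  UniversalEnvelopingAlgebra.lift_ι_apply ℂ _ X

/-- `act` is dual to the adjoint action. -/
lemma ConjBy.eval_sym {x : K} {a b : Matrix (Fin 2) (Fin 2) ℂ} (h : ConjBy x a b) (X : g)
    (pt : Fin 8 → ℂ) : eval pt (sym (adg x X)) = eval (act b a pt) (sym X) := by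
  have hba : b * a = 1 := mul_eq_one_comm.1 h.mul_eq
  have e := fun i j => congrFun (congrFun hba i) j
  simp only [Matrix.mul_apply, Fin.sum_univ_two] at e
  have e00 := e 0 0
  have e01 := e 0 1
  have e10 := e 1 0
  have e11 := e 1 1
  have f := fun i j => congrFun (congrFun h.mul_eq i) j
  simp only [Matrix.mul_apply, Fin.sum_univ_two] at f
  have f00 := f 0 0
  have f01 := f 0 1
  have f10 := f 1 0
  have f11 := f 1 1
  simp at e00 e01 e10 e11 f00 f01 f10 f11
  change eval pt (∑ i, ∑ j, (adg x X).1 i j • lam i j) =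
    eval (act b a pt) (∑ i, ∑ j, X.1 i j • lam i j)
  rw [h.adg_eq]
  generalize X.1 = M
  simp [lam, act, ptY, blk, Matrix.mul_apply, Fin.sum_univ_three, Fin.sum_univ_two,
    MvPolynomial.smul_eval, Matrix.vecMul, dotProduct]
  linear_combination (1 / 2 * pt 0) * (M 0 0 * e00 + M 1 0 * e01 + M 0 1 * e10 + M 1 1 * e11) +
    (1 / 2 * M 1 1) * (pt 1 * f00 - pt 1 * f11 + 2 * pt 3 * f10 + 2 * pt 2 * f01)

lemma adU_mem_fil (x : K) {n : ℕ} {v : U} (hv : v ∈ fil n) : adU x v ∈ fil n := by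
  refine fil_induction (p := fun n v => adU x v ∈ fil n) ?_ ?_ ?_ hv
  · intro c
    rw [AlgHom.commutes, Algebra.algebraMap_eq_smul_one]
    exact Submodule.smul_mem _ _ (one_mem_fil 0)
  · intro n v w _ _ h h'
    rw [map_add]; exact add_mem h h'
  · intro n c X v _ h
    rw [map_mul, map_add, AlgHom.commutes, adU_u, add_comm n]
    refine fil_mul (add_mem ?_ (u_mem_fil _)) h
    rw [Algebra.algebraMap_eq_smul_one]
    exact Submodule.smul_mem _ _ (one_mem_fil 1)

/-- The symbol maps commute with the action of `K`. -/
lemma ConjBy.eval_symb {x : K} {a b : Matrix (Fin 2) (Fin 2) ℂ} (h : ConjBy x a b)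
    (pt : Fin 8 → ℂ) {n : ℕ} {v : U} (hv : v ∈ fil n) :
    eval pt (symb n (adU x v)) = eval (act b a pt) (symb n v) := by
  refine fil_induction (p := fun n v =>
    eval pt (symb n (adU x v)) = eval (act b a pt) (symb n v)) ?_ ?_ ?_ hv
  · intro c
    rw [AlgHom.commutes, Algebra.algebraMap_eq_smul_one, map_smul, symb_one,
      MvPolynomial.smul_eval, MvPolynomial.smul_eval, map_one, map_one]
  · intro n v w _ _ h h'
    rw [map_add, map_add, map_add, map_add, map_add, h, h']
  · intro n c X v hv hv'
    rw [map_mul, map_add, AlgHom.commutes, adU_u, symb_mul_left (adU_mem_fil x hv),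
      symb_mul_left hv, map_mul, map_mul, hv', h.eval_sym]

/-- `w` has degree at most `n`, and `P` is its symbol in degree `n`. -/
structure HasSymb (n : ℕ) (w : UC) (P : PolMat) : Prop where
  mem : ∀ i j, toMat w i j ∈ fil n
  eq : (toMat w).map (symb n) = P

lemma HasSymb.add {n : ℕ} {v w : UC} {P P' : PolMat} (h : HasSymb n v P) (h' : HasSymb n w P') :
    HasSymb n (v + w) (P + P') := by
  refine ⟨fun i j => ?_, ?_⟩
  · rw [map_add]; exact add_mem (h.mem i j) (h'.mem i j)
  · rw [map_add, Matrix.map_add _ (map_add _), h.eq, h'.eq]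

lemma HasSymb.sub {n : ℕ} {v w : UC} {P P' : PolMat} (h : HasSymb n v P) (h' : HasSymb n w P') :
    HasSymb n (v - w) (P - P') := by
  refine ⟨fun i j => ?_, ?_⟩
  · rw [map_sub]; exact sub_mem (h.mem i j) (h'.mem i j)
  · rw [map_sub, Matrix.map_sub _ (map_sub _), h.eq, h'.eq]

lemma HasSymb.smul {n : ℕ} {v : UC} {P : PolMat} (c : ℂ) (h : HasSymb n v P) :
    HasSymb n (c • v) (c • P) := by
  refine ⟨fun i j => ?_, ?_⟩
  · rw [map_smul]; exact Submodule.smul_mem _ _ (h.mem i j)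
  · rw [map_smul, Matrix.map_smul _ _ (fun _ => map_smul _ _ _), h.eq]

lemma HasSymb.zero (n : ℕ) : HasSymb n 0 0 := by
  refine ⟨fun i j => ?_, ?_⟩
  · rw [map_zero]; exact zero_mem _
  · rw [map_zero]; ext1 i j; simp

lemma HasSymb.mul {m n : ℕ} {v w : UC} {P P' : PolMat} (h : HasSymb m v P)
    (h' : HasSymb n w P') : HasSymb (m + n) (v * w) (P * P') := by
  refine ⟨fun i j => ?_, ?_⟩
  · rw [map_mul, Matrix.mul_apply]
    exact sum_mem fun k _ => fil_mul (h.mem i k) (h'.mem k j)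
  · rw [← h.eq, ← h'.eq, map_mul]
    ext1 i j
    simp only [Matrix.map_apply, Matrix.mul_apply, map_sum]
    exact Finset.sum_congr rfl fun k _ => symb_mul (h.mem i k) (h'.mem k j)

lemma HasSymb.tmul {n : ℕ} {v : U} (hv : v ∈ fil n) (c : C) :
    HasSymb n (v ⊗ₜ c) ((spin c).map fun z => z • symb n v) := by
  rw [← one_mul v] at hv
  refine ⟨fun i j => ?_, ?_⟩
  · rw [toMat_tmul]; rw [one_mul] at hv; exact Submodule.smul_mem _ _ hv
  · rw [toMat_tmul]; ext1 i j; simp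

lemma HasSymb.one : HasSymb 0 1 1 := by
  have := HasSymb.tmul (one_mem_fil 0) 1
  rw [symb_one, map_one, ← Algebra.TensorProduct.one_def] at this
  convert this using 1
  ext1 i j
  by_cases h : i = j <;> simp [h, Matrix.one_apply]

lemma HasSymb.pow {n : ℕ} {v : UC} {P : PolMat} (h : HasSymb n v P) (k : ℕ) :
    HasSymb (k * n) (v ^ k) (P ^ k) := by
  induction k with
  | zero => simpa using HasSymb.one
  | succ k ih =>
    rw [pow_succ, pow_succ, add_mul, one_mul]; exact ih.mul h

lemma HasSymb.isHomogeneous {n : ℕ} {v : UC} {P : PolMat} (h : HasSymb n v P) (i j : Fin 4) :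
    (P i j).IsHomogeneous n := by
  rw [← h.eq]; exact symb_homogeneous (h.mem i j)

/-- The symbol of an invariant is equivariant. -/
lemma HasSymb.uEquivariant {n : ℕ} {w : UC} {P : PolMat} (h : HasSymb n w P) (hw : w ∈ UCK) :
    UEquivariant P := by
  intro a ha pt
  obtain ⟨x, hx⟩ := exists_of_unitary a ha
  have key := hx.toMat_adUC w
  rw [hw x] at key
  ext i j
  have kij := congrArg (fun v => eval pt (symb n v)) (congrFun (congrFun key i) j)
  simp only [Matrix.mul_apply, Matrix.map_apply, ← Algebra.commutes, map_sum,
    ← Algebra.smul_def, map_smul, MvPolynomial.smul_eval,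
    hx.eval_symb pt (h.mem _ _)] at kij
  simp only [← h.eq, Matrix.mul_apply, Matrix.map_apply]
  rw [← kij]
  exact Finset.sum_congr rfl fun k _ => mul_comm _ _

/-! ### Tensorial construction of invariants -/

section Tensors

variable {R : Type*} [Ring R] [Algebra ℂ R]

/-- The pair `z` transforms under `φ` as a row vector, `z ↦ z a`. -/
def IsRow (φ : R →ₐ[ℂ] R) (a : Matrix (Fin 2) (Fin 2) ℂ) (z : Fin 2 → R) : Prop :=
  ∀ j, φ (z j) = a 0 j • z 0 + a 1 j • z 1

/-- The pair `y` transforms under `φ` as a column vector, `y ↦ b y`. -/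
def IsCol (φ : R →ₐ[ℂ] R) (b : Matrix (Fin 2) (Fin 2) ℂ) (y : Fin 2 → R) : Prop :=
  ∀ i, φ (y i) = b i 0 • y 0 + b i 1 • y 1

/-- The matrix `Y` transforms under `φ` by `Y ↦ b Y a`. -/
def IsMat (φ : R →ₐ[ℂ] R) (a b : Matrix (Fin 2) (Fin 2) ℂ) (Y : Matrix (Fin 2) (Fin 2) R) : Prop :=
  ∀ i j, φ (Y i j) = (b i 0 * a 0 j) • Y 0 0 + (b i 0 * a 1 j) • Y 0 1 +
    (b i 1 * a 0 j) • Y 1 0 + (b i 1 * a 1 j) • Y 1 1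

variable {φ : R →ₐ[ℂ] R} {a b : Matrix (Fin 2) (Fin 2) ℂ}

lemma mul_eq_one_entries {a b : Matrix (Fin 2) (Fin 2) ℂ} (h : a * b = 1) :
    (a 0 0 * b 0 0 + a 0 1 * b 1 0 = 1 ∧ a 0 0 * b 0 1 + a 0 1 * b 1 1 = 0) ∧
    (a 1 0 * b 0 0 + a 1 1 * b 1 0 = 0 ∧ a 1 0 * b 0 1 + a 1 1 * b 1 1 = 1) := by
  have e := fun i j => congrFun (congrFun h i) j
  simp only [Matrix.mul_apply, Fin.sum_univ_two] at e
  exact ⟨⟨by simpa using e 0 0, by simpa using e 0 1⟩, by simpa using e 1 0, by simpa using e 1 1⟩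

/-- The contraction of a row and a column is invariant, even though their entries need not
commute. -/
lemma IsRow.mul_col {z y : Fin 2 → R} (h : a * b = 1) (hz : IsRow φ a z) (hy : IsCol φ b y) :
    φ (z 0 * y 0 + z 1 * y 1) = z 0 * y 0 + z 1 * y 1 := by
  obtain ⟨⟨e00, e01⟩, e10, e11⟩ := mul_eq_one_entries h
  rw [map_add, map_mul, map_mul, hz, hz, hy, hy]
  simp only [mul_add, add_mul, smul_mul_smul_comm]
  match_scalars
  · linear_combination e00
  · linear_combination e10
  · linear_combination e01
  · linear_combination e11

/-- The product `z Y` with the entries of `Y` to the left of those of `z` is a row. -/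
lemma IsRow.mat_mul {z : Fin 2 → R} {Y : Matrix (Fin 2) (Fin 2) R} (h : a * b = 1)
    (hz : IsRow φ a z) (hY : IsMat φ a b Y) :
    IsRow φ a (fun j => Y 0 j * z 0 + Y 1 j * z 1) := by
  obtain ⟨⟨e00, e01⟩, e10, e11⟩ := mul_eq_one_entries h
  intro j
  rw [map_add, map_mul, map_mul, hz, hz, hY, hY]
  simp only [mul_add, add_mul, smul_mul_smul_comm, smul_add]
  match_scalars
  -- Each coefficient identity is an entry of `a * b = 1`, up to a factor.
  all_goals first
    | linear_combination a 0 j * e00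
    | linear_combination a 0 j * e01
    | linear_combination a 0 j * e10
    | linear_combination a 0 j * e11
    | linear_combination a 1 j * e00
    | linear_combination a 1 j * e01
    | linear_combination a 1 j * e10
    | linear_combination a 1 j * e11

lemma IsCol.mat_mul {y : Fin 2 → R} {Y : Matrix (Fin 2) (Fin 2) R} (h : a * b = 1)
    (hy : IsCol φ b y) (hY : IsMat φ a b Y) :
    IsCol φ b (fun i => Y i 0 * y 0 + Y i 1 * y 1) := by
  obtain ⟨⟨e00, e01⟩, e10, e11⟩ := mul_eq_one_entries h
  intro i
  rw [map_add, map_mul, map_mul, hy, hy, hY, hY]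
  simp only [mul_add, add_mul, smul_mul_smul_comm, smul_add]
  match_scalars
  all_goals first
    | linear_combination b i 0 * e00
    | linear_combination b i 0 * e01
    | linear_combination b i 0 * e10
    | linear_combination b i 0 * e11
    | linear_combination b i 1 * e00
    | linear_combination b i 1 * e01
    | linear_combination b i 1 * e10
    | linear_combination b i 1 * e11

/-- The product `Y y` with the entries of `Y` to the right of those of `y` is a column. -/
lemma IsCol.mul_mat {y : Fin 2 → R} {Y : Matrix (Fin 2) (Fin 2) R} (h : a * b = 1)
    (hy : IsCol φ b y) (hY : IsMat φ a b Y) :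
    IsCol φ b (fun i => y 0 * Y i 0 + y 1 * Y i 1) := by
  obtain ⟨⟨e00, e01⟩, e10, e11⟩ := mul_eq_one_entries h
  intro i
  rw [map_add, map_mul, map_mul, hy, hy, hY, hY]
  simp only [mul_add, add_mul, smul_mul_smul_comm, smul_add]
  match_scalars
  all_goals first
    | linear_combination b i 0 * e00
    | linear_combination b i 0 * e01
    | linear_combination b i 0 * e10
    | linear_combination b i 0 * e11
    | linear_combination b i 1 * e00
    | linear_combination b i 1 * e01
    | linear_combination b i 1 * e10
    | linear_combination b i 1 * e11

lemma IsMat.trace_sq {Y : Matrix (Fin 2) (Fin 2) R} (h : a * b = 1) (hY : IsMat φ a b Y) :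
    φ (Y 0 0 * Y 0 0 + Y 0 1 * Y 1 0 + Y 1 0 * Y 0 1 + Y 1 1 * Y 1 1) =
      Y 0 0 * Y 0 0 + Y 0 1 * Y 1 0 + Y 1 0 * Y 0 1 + Y 1 1 * Y 1 1 := by
  have key : ∀ k l m n c,
      (1 : Matrix (Fin 2) (Fin 2) ℂ) k l * (1 : Matrix (Fin 2) (Fin 2) ℂ) m n = c →
      (a k 0 * b 0 l + a k 1 * b 1 l) * (a m 0 * b 0 n + a m 1 * b 1 n) = c := by
    rintro k l m n c rfl
    rw [← h]; simp only [Matrix.mul_apply, Fin.sum_univ_two]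
  simp only [map_add, map_mul, hY _ _]
  simp only [mul_add, add_mul, smul_mul_smul_comm]
  match_scalars
  all_goals first
    | linear_combination key 0 0 0 0 1 (by simp)
    | linear_combination key 0 0 0 1 0 (by simp)
    | linear_combination key 0 0 1 0 0 (by simp)
    | linear_combination key 0 0 1 1 1 (by simp)
    | linear_combination key 0 1 0 0 0 (by simp)
    | linear_combination key 0 1 0 1 0 (by simp)
    | linear_combination key 0 1 1 0 0 (by simp)
    | linear_combination key 0 1 1 1 0 (by simp)
    | linear_combination key 1 0 0 0 0 (by simp)
    | linear_combination key 1 0 0 1 0 (by simp)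
    | linear_combination key 1 0 1 0 0 (by simp)
    | linear_combination key 1 0 1 1 0 (by simp)
    | linear_combination key 1 1 0 0 1 (by simp)
    | linear_combination key 1 1 0 1 0 (by simp)
    | linear_combination key 1 1 1 0 0 (by simp)
    | linear_combination key 1 1 1 1 1 (by simp)

lemma IsCol.map {R' : Type*} [Ring R'] [Algebra ℂ R'] {φ' : R' →ₐ[ℂ] R'} (f : R →ₐ[ℂ] R')
    (hf : ∀ r, φ' (f r) = f (φ r)) {y : Fin 2 → R} (hy : IsCol φ b y) :
    IsCol φ' b (fun i => f (y i)) := by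
  intro i; rw [hf, hy, map_add, map_smul, map_smul]

lemma IsRow.map {R' : Type*} [Ring R'] [Algebra ℂ R'] {φ' : R' →ₐ[ℂ] R'} (f : R →ₐ[ℂ] R')
    (hf : ∀ r, φ' (f r) = f (φ r)) {z : Fin 2 → R} (hz : IsRow φ a z) :
    IsRow φ' a (fun i => f (z i)) := by
  intro i; rw [hf, hz, map_add, map_smul, map_smul]

lemma IsMat.map {R' : Type*} [Ring R'] [Algebra ℂ R'] {φ' : R' →ₐ[ℂ] R'} (f : R →ₐ[ℂ] R')
    (hf : ∀ r, φ' (f r) = f (φ r)) {Y : Matrix (Fin 2) (Fin 2) R} (hY : IsMat φ a b Y) :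
    IsMat φ' a b (Y.map f) := by
  intro i j
  rw [Matrix.map_apply, hf, hY]
  simp only [map_add, map_smul, Matrix.map_apply]

end Tensors

lemma u_smul (c : ℂ) (X : g) : u (c • X) = c • u X := map_smul (UniversalEnvelopingAlgebra.ι ℂ) c X
lemma u_add (X Y : g) : u (X + Y) = u X + u Y := map_add (UniversalEnvelopingAlgebra.ι ℂ) X Y

/-- The row `z = (E₁, E₂)` in `U(𝔤)`. -/
def rowU : Fin 2 → U := ![u E₁, u E₂]
/-- The column `y = (F₁, F₂)` in `U(𝔤)`. -/
def colU : Fin 2 → U := ![u F₁, u F₂]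
/-- The matrix `Y` in `U(𝔤)`. -/
def matU : Matrix (Fin 2) (Fin 2) U := !![u H, 2 * u F; 2 * u E, -u H]
/-- The row `(E₁, E₂)` in `C(𝔭)`. -/
def rowC : Fin 2 → C := ![cE₁, cE₂]
/-- The column `(F₁, F₂)` in `C(𝔭)`. -/
def colC : Fin 2 → C := ![cF₁, cF₂]

variable {x : K} {a b : Matrix (Fin 2) (Fin 2) ℂ}

lemma ConjBy.adg_E₁ (h : ConjBy x a b) : adg x E₁ = a 0 0 • E₁ + a 1 0 • E₂ := by
  apply Subtype.ext
  rw [h.adg_eq]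
  ext i j
  fin_cases i <;> fin_cases j <;> simp [blk, E₁, E₂, Matrix.mul_apply, Fin.sum_univ_three]

lemma ConjBy.adg_E₂ (h : ConjBy x a b) : adg x E₂ = a 0 1 • E₁ + a 1 1 • E₂ := by
  apply Subtype.ext
  rw [h.adg_eq]
  ext i j
  fin_cases i <;> fin_cases j <;> simp [blk, E₁, E₂, Matrix.mul_apply, Fin.sum_univ_three]

lemma ConjBy.adg_F₁ (h : ConjBy x a b) : adg x F₁ = b 0 0 • F₁ + b 0 1 • F₂ := by
  apply Subtype.ext
  rw [h.adg_eq]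
  ext i j
  fin_cases i <;> fin_cases j <;> simp [blk, F₁, F₂, Matrix.mul_apply, Fin.sum_univ_three]

lemma ConjBy.adg_F₂ (h : ConjBy x a b) : adg x F₂ = b 1 0 • F₁ + b 1 1 • F₂ := by
  apply Subtype.ext
  rw [h.adg_eq]
  ext i j
  fin_cases i <;> fin_cases j <;> simp [blk, F₁, F₂, Matrix.mul_apply, Fin.sum_univ_three]

lemma ConjBy.isRow_rowU (h : ConjBy x a b) : IsRow (adU x) a rowU := by
  intro j
  fin_cases j
  · exact (adU_u x E₁).trans (by rw [h.adg_E₁, u_add, u_smul, u_smul]; rfl)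
  · exact (adU_u x E₂).trans (by rw [h.adg_E₂, u_add, u_smul, u_smul]; rfl)

lemma ConjBy.isCol_colU (h : ConjBy x a b) : IsCol (adU x) b colU := by
  intro j
  fin_cases j
  · exact (adU_u x F₁).trans (by rw [h.adg_F₁, u_add, u_smul, u_smul]; rfl)
  · exact (adU_u x F₂).trans (by rw [h.adg_F₂, u_add, u_smul, u_smul]; rfl)

lemma ConjBy.isRow_rowC (h : ConjBy x a b) : IsRow (adC x) a rowC := by
  have key : ∀ j, adp x (![⟨E₁, E₁_mem⟩, ⟨E₂, E₂_mem⟩] j) =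
      a 0 j • (⟨E₁, E₁_mem⟩ : p) + a 1 j • (⟨E₂, E₂_mem⟩ : p) := by
    intro j
    apply Subtype.ext
    fin_cases j
    · exact h.adg_E₁
    · exact h.adg_E₂
  intro j
  have := congrArg (CliffordAlgebra.ι Q) (key j)
  rw [map_add, map_smul, map_smul] at this
  fin_cases j
  · exact (CliffordAlgebra.map_apply_ι _ _).trans this
  · exact (CliffordAlgebra.map_apply_ι _ _).trans this

lemma ConjBy.isCol_colC (h : ConjBy x a b) : IsCol (adC x) b colC := by
  have key : ∀ i, adp x (![⟨F₁, F₁_mem⟩, ⟨F₂, F₂_mem⟩] i) =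
      b i 0 • (⟨F₁, F₁_mem⟩ : p) + b i 1 • (⟨F₂, F₂_mem⟩ : p) := by
    intro j
    apply Subtype.ext
    fin_cases j
    · exact h.adg_F₁
    · exact h.adg_F₂
  intro j
  have := congrArg (CliffordAlgebra.ι Q) (key j)
  rw [map_add, map_smul, map_smul] at this
  fin_cases j
  · exact (CliffordAlgebra.map_apply_ι _ _).trans this
  · exact (CliffordAlgebra.map_apply_ι _ _).trans this

/-- The matrix of elements of `𝔨` whose images in `U(𝔤)` form `matU`. -/
def matG : Matrix (Fin 2) (Fin 2) g := !![H, (2 : ℂ) • F; (2 : ℂ) • E, -H]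

lemma matU_eq (i j : Fin 2) : matU i j = u (matG i j) := by
  fin_cases i <;> fin_cases j <;> simp [matU, matG, two_smul, two_mul]

lemma ConjBy.isMat_matU (h : ConjBy x a b) : IsMat (adU x) a b matU := by
  obtain ⟨⟨e00, e01⟩, e10, e11⟩ := mul_eq_one_entries h.mul_eq
  obtain ⟨⟨f00, f01⟩, f10, f11⟩ := mul_eq_one_entries (mul_eq_one_comm.1 h.mul_eq)
  have key : ∀ i j, adg x (matG i j) = (b i 0 * a 0 j) • matG 0 0 + (b i 0 * a 1 j) • matG 0 1 +
    (b i 1 * a 0 j) • matG 1 0 + (b i 1 * a 1 j) • matG 1 1 := by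
    intro i j
    apply Subtype.ext
    rw [h.adg_eq]
    ext k l
    fin_cases i <;> fin_cases j <;> fin_cases k <;> fin_cases l <;>
      simp [blk, matG, H, H₁, H₂, E, F, Matrix.mul_apply, Fin.sum_univ_three]
    -- The two sides differ by entries of `b * a = 1` and of `a * b = 1`.
    all_goals first
    | ring1
    | linear_combination f00
    | linear_combination f01
    | linear_combination f10
    | linear_combination f11
    | linear_combination -e01
    | linear_combination -e10
    | linear_combination f00 - e00
    | linear_combination f00 - e11
    | linear_combination f11 - e00
    | linear_combination f11 - e11
  intro i j
  simp only [matU_eq, adU_u, key, u_add, u_smul]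

/-! ### The generators are invariant -/

/-- The elements of `U(𝔤)` of which `ã, b̃, c̃, d̃` are the images under `v ↦ v ⊗ 1`. -/
def gen : Fin 4 → U :=
  ![u H₁ + u H₂, u H ^ 2 + 2 * (u E * u F + u F * u E), u E₁ * u F₁ + u E₂ * u F₂,
    2 * u E * u E₂ * u F₁ + u H * u E₁ * u F₁ - u H * u E₂ * u F₂ + 2 * u F * u E₁ * u F₂]

lemma mem_UK {v : U} (h : ∀ x a b, ConjBy x a b → adU x v = v) : v ∈ UK := by
  intro x
  obtain ⟨a, b, hab⟩ := exists_conjBy x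
  exact h x a b hab

lemma gen_zero_mem : gen 0 ∈ UK := by
  refine mem_UK fun x a b h => ?_
  have e : gen 0 = u (H₁ + H₂) := (u_add _ _).symm
  rw [e, adU_u]
  congr 1
  obtain ⟨⟨e00, e01⟩, e10, e11⟩ := mul_eq_one_entries h.mul_eq
  apply Subtype.ext
  rw [h.adg_eq]
  ext k l
  fin_cases k <;> fin_cases l <;>
    simp [blk, H₁, H₂, Matrix.mul_apply, Fin.sum_univ_three]
  · linear_combination (1 / 3) * e00
  · linear_combination (1 / 3) * e01
  · linear_combination (1 / 3) * e10
  · linear_combination (1 / 3) * e11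

lemma gen_one_mem : gen 1 ∈ UK := by
  refine mem_UK fun x a b h => ?_
  have e : gen 1 = (1 / 2 : ℂ) • (matU 0 0 * matU 0 0 + matU 0 1 * matU 1 0 + matU 1 0 * matU 0 1 +
      matU 1 1 * matU 1 1) := by
    simp only [gen, matU]
    simp only [Matrix.of_apply, Matrix.cons_val_zero, Matrix.cons_val_one, pow_two, two_mul,
      mul_add, add_mul, neg_mul, mul_neg, neg_neg]
    module
  rw [e, map_smul, h.isMat_matU.trace_sq h.mul_eq]

lemma gen_two_mem : gen 2 ∈ UK :=
  mem_UK fun _ _ _ h => h.isRow_rowU.mul_col h.mul_eq h.isCol_colU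

lemma gen_three_mem : gen 3 ∈ UK := by
  refine mem_UK fun x a b h => ?_
  have e : gen 3 = (matU 0 0 * rowU 0 + matU 1 0 * rowU 1) * colU 0 +
      (matU 0 1 * rowU 0 + matU 1 1 * rowU 1) * colU 1 := by
    simp [gen, matU, rowU, colU]
    noncomm_ring
  rw [e]
  exact (h.isRow_rowU.mat_mul h.mul_eq h.isMat_matU).mul_col h.mul_eq h.isCol_colU

/-- The inclusion of the factor `U(𝔤)`. -/
abbrev iU : U →ₐ[ℂ] UC := Algebra.TensorProduct.includeLeft
/-- The inclusion of the factor `C(𝔭)`. -/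
abbrev iC : C →ₐ[ℂ] UC := Algebra.TensorProduct.includeRight

lemma adUC_iU (x : K) (v : U) : adUC x (iU v) = iU (adU x v) := by
  change adUC x (v ⊗ₜ 1) = adU x v ⊗ₜ 1
  rw [adUC, Algebra.TensorProduct.map_tmul, map_one]

lemma adUC_iC (x : K) (c : C) : adUC x (iC c) = iC (adC x c) := by
  change adUC x (1 ⊗ₜ c) = 1 ⊗ₜ adC x c
  rw [adUC, Algebra.TensorProduct.map_tmul, map_one]

lemma iU_mul_iC (v : U) (c : C) : iU v * iC c = v ⊗ₜ c := by
  change (v ⊗ₜ[ℂ] (1 : C)) * ((1 : U) ⊗ₜ[ℂ] c) = v ⊗ₜ c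
  rw [Algebra.TensorProduct.tmul_mul_tmul, mul_one, one_mul]

lemma iC_mul_iU (v : U) (c : C) : iC c * iU v = v ⊗ₜ c := by
  change ((1 : U) ⊗ₜ[ℂ] c) * (v ⊗ₜ[ℂ] (1 : C)) = v ⊗ₜ c
  rw [Algebra.TensorProduct.tmul_mul_tmul, mul_one, one_mul]

lemma tmul_mul_iC (v : U) (c d : C) : v ⊗ₜ c * iC d = v ⊗ₜ (c * d) := by
  rw [← iU_mul_iC, mul_assoc, ← map_mul, iU_mul_iC]

lemma mem_UCK {v : UC} (h : ∀ x a b, ConjBy x a b → adUC x v = v) : v ∈ UCK := by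
  intro x
  obtain ⟨a, b, hab⟩ := exists_conjBy x
  exact h x a b hab

lemma ConjBy.isRow_iU (h : ConjBy x a b) : IsRow (adUC x) a fun i => iU (rowU i) :=
  h.isRow_rowU.map iU (adUC_iU x)
lemma ConjBy.isCol_iU (h : ConjBy x a b) : IsCol (adUC x) b fun i => iU (colU i) :=
  h.isCol_colU.map iU (adUC_iU x)
lemma ConjBy.isMat_iU (h : ConjBy x a b) : IsMat (adUC x) a b (matU.map iU) :=
  h.isMat_matU.map iU (adUC_iU x)
lemma ConjBy.isRow_iC (h : ConjBy x a b) : IsRow (adUC x) a fun i => iC (rowC i) :=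
  h.isRow_rowC.map iC (adUC_iC x)
lemma ConjBy.isCol_iC (h : ConjBy x a b) : IsCol (adUC x) b fun i => iC (colC i) :=
  h.isCol_colC.map iC (adUC_iC x)

lemma te_mem : te ∈ UCK := by
  refine mem_UCK fun x a b h => ?_
  have := h.isRow_iC.mul_col h.mul_eq h.isCol_iU
  rwa [iC_mul_iU, iC_mul_iU] at this

lemma tf_mem : tf ∈ UCK := by
  refine mem_UCK fun x a b h => ?_
  have := h.isRow_iU.mul_col h.mul_eq h.isCol_iC
  rwa [iU_mul_iC, iU_mul_iC] at this

lemma tg_mem : tg ∈ UCK := by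
  refine mem_UCK fun x a b h => ?_
  have := h.isRow_iC.mul_col h.mul_eq h.isCol_iC
  rw [← map_mul, ← map_mul, ← map_add] at this
  exact this

lemma th_mem : th ∈ UCK := by
  refine mem_UCK fun x a b h => ?_
  have := (h.isRow_iU.mat_mul h.mul_eq h.isMat_iU).mul_col h.mul_eq h.isCol_iC
  simp only [Matrix.map_apply, ← map_mul, ← map_add, iU_mul_iC] at this
  have e : th = (matU 0 0 * rowU 0 + matU 1 0 * rowU 1) ⊗ₜ[ℂ] colC 0 +
      (matU 0 1 * rowU 0 + matU 1 1 * rowU 1) ⊗ₜ[ℂ] colC 1 := by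
    rw [th]
    congr 2
    · exact add_comm _ _
    · rw [add_comm, ← neg_mul]; rfl
  rw [e, this]

lemma ti_mem : ti ∈ UCK := by
  refine mem_UCK fun x a b h => ?_
  have := (h.isRow_iC.mat_mul h.mul_eq h.isMat_iU).mul_col h.mul_eq h.isCol_iC
  simp only [Matrix.map_apply, add_mul, iU_mul_iC, tmul_mul_iC] at this
  have e : ti = matU 0 0 ⊗ₜ[ℂ] (rowC 0 * colC 0) + matU 1 0 ⊗ₜ[ℂ] (rowC 1 * colC 0) +
      (matU 0 1 ⊗ₜ[ℂ] (rowC 0 * colC 1) + matU 1 1 ⊗ₜ[ℂ] (rowC 1 * colC 1)) := by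
    have h1 : matU 1 1 ⊗ₜ[ℂ] (rowC 1 * colC 1) = -(u H ⊗ₜ[ℂ] (cE₂ * cF₂)) :=
      (iU_mul_iC (-u H) _).symm.trans (by rw [map_neg, neg_mul, iU_mul_iC]; rfl)
    rw [h1, ti]
    change _ = u H ⊗ₜ[ℂ] (cE₁ * cF₁) + (2 * u E) ⊗ₜ[ℂ] (cE₂ * cF₁) +
      ((2 * u F) ⊗ₜ[ℂ] (cE₁ * cF₂) + -(u H ⊗ₜ[ℂ] (cE₂ * cF₂)))
    abel
  rw [e, this]

lemma tj_mem : tj ∈ UCK := by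
  refine mem_UCK fun x a b h => ?_
  have := h.isRow_iC.mul_col h.mul_eq (h.isCol_iU.mat_mul h.mul_eq h.isMat_iU)
  simp only [Matrix.map_apply, ← map_mul, ← map_add, iC_mul_iU] at this
  have e : tj = (matU 0 0 * colU 0 + matU 0 1 * colU 1) ⊗ₜ[ℂ] rowC 0 +
      (matU 1 0 * colU 0 + matU 1 1 * colU 1) ⊗ₜ[ℂ] rowC 1 := by
    rw [tj]
    congr 2
    rw [sub_eq_add_neg, ← neg_mul]; rfl
  rw [e, this]

/-! ### The symbols of the generators -/

/-- `v` has degree at most `n`, and `q` is its symbol in degree `n`. -/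
structure HasSymbU (n : ℕ) (v : U) (q : Pol) : Prop where
  mem : v ∈ fil n
  eq : symb n v = q

namespace HasSymbU

variable {m n : ℕ} {v w : U} {q r : Pol}

lemma add (h : HasSymbU n v q) (h' : HasSymbU n w r) : HasSymbU n (v + w) (q + r) :=
  ⟨add_mem h.mem h'.mem, by rw [map_add, h.eq, h'.eq]⟩

lemma neg (h : HasSymbU n v q) : HasSymbU n (-v) (-q) :=
  ⟨neg_mem h.mem, by rw [map_neg, h.eq]⟩

lemma sub (h : HasSymbU n v q) (h' : HasSymbU n w r) : HasSymbU n (v - w) (q - r) :=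
  ⟨sub_mem h.mem h'.mem, by rw [map_sub, h.eq, h'.eq]⟩

lemma two_mul (h : HasSymbU n v q) : HasSymbU n (2 * v) (2 * q) := by
  rw [_root_.two_mul, _root_.two_mul]; exact h.add h

lemma mul (h : HasSymbU m v q) (h' : HasSymbU n w r) : HasSymbU (m + n) (v * w) (q * r) :=
  ⟨fil_mul h.mem h'.mem, by rw [symb_mul h.mem h'.mem, h.eq, h'.eq]⟩

lemma one : HasSymbU 0 1 1 := ⟨one_mem_fil 0, symb_one⟩

lemma pow (h : HasSymbU n v q) (k : ℕ) : HasSymbU (k * n) (v ^ k) (q ^ k) := by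
  induction k with
  | zero => simpa using one
  | succ k ih => rw [pow_succ, pow_succ, add_mul, one_mul]; exact ih.mul h

lemma bas (i : Fin 8) : HasSymbU 1 (u (SU21.bas i)) (X i) :=
  ⟨u_mem_fil _, by rw [symb_u, sym_bas]⟩

lemma H : HasSymbU 1 (u H) (X 1) := bas 1
lemma E : HasSymbU 1 (u E) (X 2) := bas 2
lemma F : HasSymbU 1 (u F) (X 3) := bas 3
lemma E₁ : HasSymbU 1 (u E₁) (X 4) := bas 4
lemma E₂ : HasSymbU 1 (u E₂) (X 5) := bas 5
lemma F₁ : HasSymbU 1 (u F₁) (X 6) := bas 6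
lemma F₂ : HasSymbU 1 (u F₂) (X 7) := bas 7

end HasSymbU

/-- The degrees of `ã, b̃, c̃, d̃`. -/
def genDeg : Fin 4 → ℕ := ![1, 2, 2, 3]

lemma hasSymbU_gen (i : Fin 4) : HasSymbU (genDeg i) (gen i) (inv (X i)) := by
  fin_cases i
  · have h := HasSymbU.bas 0
    rw [show u (bas 0) = gen 0 from u_add _ _] at h
    exact inv_X0 ▸ h
  · have h := (HasSymbU.H.pow 2).add ((HasSymbU.E.mul .F).add (HasSymbU.F.mul .E)).two_mul
    refine ⟨h.mem, h.eq.trans ?_⟩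
    exact Eq.trans (by rw [symbB]; ring) inv_X1.symm
  · have h := (HasSymbU.E₁.mul .F₁).add (HasSymbU.E₂.mul .F₂)
    refine ⟨h.mem, h.eq.trans inv_X2.symm⟩
  · have h := ((((HasSymbU.E.two_mul.mul .E₂).mul .F₁).add ((HasSymbU.H.mul .E₁).mul .F₁)).sub
      ((HasSymbU.H.mul .E₂).mul .F₂)).add ((HasSymbU.F.two_mul.mul .E₁).mul .F₂)
    refine ⟨h.mem, h.eq.trans ?_⟩
    exact Eq.trans (by rw [symbD, v₁, v₂]; ring) inv_X3.symm

lemma HasSymb.tmul' {n : ℕ} {v : U} {q : Pol} (h : HasSymbU n v q) (c : C) :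
    HasSymb n (v ⊗ₜ c) ((spin c).map fun z => z • q) := by
  rw [← h.eq]; exact HasSymb.tmul h.mem c

lemma HasSymb.congr {n : ℕ} {w : UC} {P P' : PolMat} (h : HasSymb n w P) (e : P = P') :
    HasSymb n w P' := e ▸ h

lemma hasSymb_te : HasSymb 1 te symE := by
  refine ((HasSymb.tmul' .F₁ cE₁).add (HasSymb.tmul' .F₂ cE₂)).congr ?_
  rw [spin_cE₁, spin_cE₂]
  ext1 i j
  fin_cases i <;> fin_cases j <;> simp [symE]

lemma hasSymb_tf : HasSymb 1 tf symF := by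
  refine ((HasSymb.tmul' .E₁ cF₁).add (HasSymb.tmul' .E₂ cF₂)).congr ?_
  rw [spin_cF₁, spin_cF₂]
  ext1 i j
  fin_cases i <;> fin_cases j <;> simp [symF, ofNat_smul_eq_nsmul]

lemma hasSymb_tg : HasSymb 0 tg symG := by
  refine (HasSymb.tmul' .one (cE₁ * cF₁ + cE₂ * cF₂)).congr ?_
  rw [map_add, map_mul, map_mul, spin_cE₁, spin_cE₂, spin_cF₁, spin_cF₂]
  ext1 i j
  fin_cases i <;> fin_cases j <;> simp [symG, ofNat_smul_eq_nsmul, add_smul]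
  ring

lemma hasSymb_th : HasSymb 2 th symH := by
  refine ((HasSymb.tmul' ((HasSymbU.E.two_mul.mul .E₂).add (HasSymbU.H.mul .E₁)) cF₁).add
    (HasSymb.tmul' ((HasSymbU.H.mul .E₂).neg.add (HasSymbU.F.two_mul.mul .E₁)) cF₂)).congr ?_
  rw [spin_cF₁, spin_cF₂]
  ext1 i j
  fin_cases i <;> fin_cases j <;> simp [symH, w₁, w₂, ofNat_smul_eq_nsmul] <;> ring

lemma hasSymb_ti : HasSymb 1 ti symI := by
  refine ((((HasSymb.tmul' HasSymbU.E.two_mul (cE₂ * cF₁)).add (HasSymb.tmul' .H (cE₁ * cF₁))).sub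
    (HasSymb.tmul' .H (cE₂ * cF₂))).add (HasSymb.tmul' HasSymbU.F.two_mul (cE₁ * cF₂))).congr ?_
  rw [map_mul, map_mul, map_mul, map_mul, spin_cE₁, spin_cE₂, spin_cF₁, spin_cF₂]
  ext1 i j
  fin_cases i <;> fin_cases j <;> simp [symI, ofNat_smul_eq_nsmul] <;> ring

lemma hasSymb_tj : HasSymb 2 tj symJ := by
  refine ((HasSymb.tmul' ((HasSymbU.H.mul .F₁).add (HasSymbU.F.two_mul.mul .F₂)) cE₁).add
    (HasSymb.tmul' ((HasSymbU.E.two_mul.mul .F₁).sub (HasSymbU.H.mul .F₂)) cE₂)).congr ?_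
  rw [spin_cE₁, spin_cE₂]
  ext1 i j
  fin_cases i <;> fin_cases j <;> simp [symJ, v₁, v₂]

/-- The degrees of the sixteen elements of `T̃`. -/
def degT : Fin 16 → ℕ := ![0, 1, 1, 0, 2, 1, 2, 2, 1, 1, 0, 2, 3, 3, 2, 3]

lemma hasSymb_T (i : Fin 16) : HasSymb (degT i) (T i) (symT i) := by
  fin_cases i
  exacts [.one, hasSymb_te, hasSymb_tf, hasSymb_tg, hasSymb_th, hasSymb_ti, hasSymb_tj,
    hasSymb_te.mul hasSymb_tf, hasSymb_te.mul hasSymb_tg, hasSymb_tf.mul hasSymb_tg,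
    hasSymb_tg.pow 2, hasSymb_te.mul hasSymb_ti, hasSymb_te.mul hasSymb_tj,
    hasSymb_tf.mul hasSymb_th, hasSymb_tf.mul hasSymb_ti, hasSymb_tf.mul hasSymb_tj]

lemma T_mem (i : Fin 16) : T i ∈ UCK := by
  fin_cases i
  exacts [one_mem _, te_mem, tf_mem, tg_mem, th_mem, ti_mem, tj_mem,
    mul_mem te_mem tf_mem, mul_mem te_mem tg_mem, mul_mem tf_mem tg_mem,
    pow_mem tg_mem 2, mul_mem te_mem ti_mem, mul_mem te_mem tj_mem,
    mul_mem tf_mem th_mem, mul_mem tf_mem ti_mem, mul_mem tf_mem tj_mem]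

lemma gen_mem (i : Fin 4) : gen i ∈ UK := by
  fin_cases i
  exacts [gen_zero_mem, gen_one_mem, gen_two_mem, gen_three_mem]

/-- The ordered monomials in the generators of `U(𝔤)^K`. -/
def mon (n : Fin 4 → ℕ) : U := gen 0 ^ n 0 * gen 1 ^ n 1 * gen 2 ^ n 2 * gen 3 ^ n 3

lemma mon_mem (n : Fin 4 → ℕ) : mon n ∈ UK :=
  mul_mem (mul_mem (mul_mem (pow_mem (gen_mem 0) _) (pow_mem (gen_mem 1) _))
    (pow_mem (gen_mem 2) _)) (pow_mem (gen_mem 3) _)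

lemma S_eq (n : Fin 4 → ℕ) : S n = mon n ⊗ₜ 1 := by
  change S n = iU (mon n)
  simp only [mon, map_mul, map_pow]
  rfl

/-- The degree of `mon n`. -/
def monDeg (n : Fin 4 → ℕ) : ℕ := n 0 * 1 + n 1 * 2 + n 2 * 2 + n 3 * 3

/-- The symbol of `mon n`, as a polynomial in the symbols of the generators. -/
def monPoly (n : Fin 4 → ℕ) : Inv := X 0 ^ n 0 * X 1 ^ n 1 * X 2 ^ n 2 * X 3 ^ n 3

lemma hasSymbU_mon (n : Fin 4 → ℕ) : HasSymbU (monDeg n) (mon n) (inv (monPoly n)) := by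
  simp only [monPoly, map_mul, map_pow]
  exact ((((hasSymbU_gen 0).pow _).mul ((hasSymbU_gen 1).pow _)).mul
    ((hasSymbU_gen 2).pow _)).mul ((hasSymbU_gen 3).pow _)

lemma monPoly_eq (n : Fin 4 → ℕ) :
    monPoly n = MvPolynomial.basisMonomials (Fin 4) ℂ (Finsupp.equivFunOnFinite.symm n) := by
  rw [MvPolynomial.coe_basisMonomials]
  change _ = MvPolynomial.monomial _ 1
  rw [MvPolynomial.monomial_eq, MvPolynomial.C_1, one_mul,
    Finsupp.prod_fintype _ _ (by simp)]
  simp [Fin.prod_univ_four, monPoly]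

lemma HasSymb.left {n : ℕ} {v : U} {q : Pol} (h : HasSymbU n v q) :
    HasSymb n (v ⊗ₜ 1) (q • 1) := by
  refine (HasSymb.tmul' h 1).congr ?_
  rw [map_one]
  ext1 i j
  by_cases hij : i = j <;> simp [hij]

lemma hasSymb_S_mul_T (n : Fin 4 → ℕ) (i : Fin 16) :
    HasSymb (monDeg n + degT i) (S n * T i) (inv (monPoly n) • symT i) := by
  rw [S_eq]
  have := (HasSymb.left (hasSymbU_mon n)).mul (hasSymb_T i)
  rwa [Matrix.smul_mul, one_mul] at this

lemma S_mem (n : Fin 4 → ℕ) : S n ∈ UCK := by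
  rw [S_eq]; exact (incl ⟨mon n, mon_mem n⟩).2

/-! ### The transposition -/

/-- The transpose of an element of `𝔤`. -/
def trg : g →ₗ[ℂ] g where
  toFun X := ⟨X.1ᵀ, (Matrix.trace_transpose X.1).trans X.2⟩
  map_add' _ _ := rfl
  map_smul' _ _ := rfl

lemma trg_coe (X : g) : (trg X).1 = X.1ᵀ := rfl

lemma trg_lie (X Y : g) : trg ⁅X, Y⁆ = ⁅trg Y, trg X⁆ := by
  apply Subtype.ext
  rw [LieAlgebra.SpecialLinear.sl_bracket]
  change (⁅X, Y⁆ : g).1ᵀ = _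
  rw [LieAlgebra.SpecialLinear.sl_bracket, Matrix.transpose_sub, Matrix.transpose_mul,
    Matrix.transpose_mul]
  rfl

/-- The transposition of matrices as a homomorphism from `𝔤` to the opposite algebra of `U(𝔤)`. -/
def trHom : g →ₗ⁅ℂ⁆ Uᵐᵒᵖ where
  toFun X := MulOpposite.op (u (trg X))
  map_add' X Y := by rw [map_add, u_add, MulOpposite.op_add]
  map_smul' c X := by rw [map_smul, u_smul, MulOpposite.op_smul]; rfl
  map_lie' {X Y} := by
    rw [trg_lie, ← u_lie, LieRing.of_associative_ring_bracket]
    rfl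

/-- The transposition as an algebra homomorphism to the opposite algebra. -/
def trOp : U →ₐ[ℂ] Uᵐᵒᵖ := UniversalEnvelopingAlgebra.lift ℂ trHom

/-- The anti-automorphism of `U(𝔤)` that extends the transposition of matrices. -/
def trU : U →ₗ[ℂ] U := (MulOpposite.opLinearEquiv ℂ).symm.toLinearMap ∘ₗ trOp.toLinearMap

lemma trU_mul (v w : U) : trU (v * w) = trU w * trU v := by
  change (trOp (v * w)).unop = _
  rw [map_mul]; rfl

lemma trU_algebraMap (c : ℂ) : trU (algebraMap ℂ U c) = algebraMap ℂ U c := by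
  change (trOp (algebraMap ℂ U c)).unop = _
  rw [AlgHom.commutes]; rfl

lemma trU_one : trU 1 = 1 := by simpa using trU_algebraMap 1

lemma trU_u (X : g) : trU (u X) = u (trg X) := by
  change (trOp (u X)).unop = _
  have : trOp (u X) = trHom X := UniversalEnvelopingAlgebra.lift_ι_apply ℂ trHom X
  rw [this]; rfl

lemma trU_trU (v : U) : trU (trU v) = v := by
  obtain ⟨n, hn⟩ := exists_mem_fil v
  refine fil_induction (p := fun _ v => trU (trU v) = v) ?_ ?_ ?_ hn
  · intro c; rw [trU_algebraMap, trU_algebraMap]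
  · intro n v w _ _ h h'; rw [map_add, map_add, h, h']
  · intro n c X v _ h
    rw [trU_mul, trU_mul, h, map_add, trU_algebraMap, trU_u, map_add, trU_algebraMap, trU_u]
    rfl

lemma trU_pow (v : U) (k : ℕ) : trU (v ^ k) = trU v ^ k := by
  induction k with
  | zero => simpa using trU_one
  | succ k ih => rw [pow_succ', trU_mul, ih, pow_succ]

/-- The transposition on symbols. -/
def trPol : Pol →ₐ[ℂ] Pol := aeval ![X 0, X 1, X 3, X 2, X 6, X 7, X 4, X 5]

lemma trPol_sym (Y : g) : trPol (sym Y) = sym (trg Y) := by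
  change trPol (∑ i, ∑ j, Y.1 i j • lam i j) = ∑ i, ∑ j, Y.1 j i • lam i j
  rw [Finset.sum_comm (f := fun i j => Y.1 j i • lam i j)]
  simp only [map_sum, map_smul]
  refine Finset.sum_congr rfl fun i _ => Finset.sum_congr rfl fun j _ => ?_
  congr 1
  fin_cases i <;> fin_cases j <;> simp [lam, trPol]

lemma trU_symb {n : ℕ} {v : U} (hv : v ∈ fil n) :
    trU v ∈ fil n ∧ symb n (trU v) = trPol (symb n v) := by
  refine fil_induction (p := fun n v => trU v ∈ fil n ∧ symb n (trU v) = trPol (symb n v))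
    ?_ ?_ ?_ hv
  · intro c
    rw [trU_algebraMap, Algebra.algebraMap_eq_smul_one, map_smul, symb_one, map_smul, map_one]
    exact ⟨Submodule.smul_mem _ _ (one_mem_fil 0), rfl⟩
  · rintro n v w _ _ ⟨h1, h2⟩ ⟨h3, h4⟩
    rw [map_add, map_add, h2, h4, map_add, map_add]
    exact ⟨add_mem h1 h3, rfl⟩
  · rintro n c Y v hv ⟨h1, h2⟩
    have hY : algebraMap ℂ U c + u (trg Y) ∈ fil 1 := by
      refine add_mem ?_ (u_mem_fil _)
      rw [Algebra.algebraMap_eq_smul_one]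
      exact Submodule.smul_mem _ _ (one_mem_fil 1)
    have hs : symb 1 (algebraMap ℂ U c + u (trg Y)) = sym (trg Y) := by
      rw [map_add, symb_u, Algebra.algebraMap_eq_smul_one, map_smul,
        symb_of_lt (one_mem_fil 0) one_pos, smul_zero, zero_add]
    rw [trU_mul, map_add, trU_algebraMap, trU_u, symb_mul_left hv, symb_mul h1 hY, hs, h2, map_mul,
      trPol_sym, mul_comm]
    exact ⟨fil_mul h1 hY, rfl⟩

lemma trPol_inv (q : Inv) : trPol (inv q) = inv q := by
  have : trPol.comp inv = inv := by
    apply MvPolynomial.algHom_ext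
    intro i
    fin_cases i <;> simp [inv, trPol, symbB, symbC, symbD, v₁, v₂, map_ofNat]
    all_goals ring
  exact DFunLike.congr_fun this q

/-! ### Spanning sets of the invariants -/

/-- The symbol of an element of `U(𝔤)^K` is a polynomial in the symbols of the generators. -/
lemma exists_symb_eq_inv {v : U} (hv : v ∈ UK) {n : ℕ} (hn : v ∈ fil n) :
    ∃ q, symb n v = inv q := by
  have h := (HasSymb.left ⟨hn, rfl⟩).uEquivariant (incl ⟨v, hv⟩).2
  have := congrFun (congrFun h.mul_frameY 0) 0
  refine ⟨resY (symb n v), ?_⟩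
  simpa [Matrix.mul_apply, Fin.sum_univ_four, spinBlk] using this

/-- Induction on the degree: if the symbols of the elements of `N` are combinations of the symbols
of the elements `S n * T i` with `(n, i) ∈ J`, and these elements lie in `N`, then they span `N`. -/
lemma le_span_of_symb {N : Submodule ℂ UC} {J : Set ((Fin 4 → ℕ) × Fin 16)}
    (hJ : ∀ k ∈ J, S k.1 * T k.2 ∈ N)
    (hN : ∀ n P w, w ∈ N → HasSymb n w P →
      P ∈ Submodule.span ℂ ((fun k => inv (monPoly k.1) • symT k.2) '' J)) :
    N ≤ Submodule.span ℂ ((fun k => S k.1 * T k.2) '' J) := by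
  have key : ∀ n w, w ∈ N → (∀ i j, toMat w i j ∈ filLT n) →
      w ∈ Submodule.span ℂ ((fun k => S k.1 * T k.2) '' J) := by
    intro n
    induction n with
    | zero =>
      intro w _ hw
      have : toMat w = 0 := by
        ext1 i j; exact (Submodule.mem_bot ℂ).1 (hw i j)
      rw [(map_eq_zero_iff _ toMat.injective).1 this]
      exact zero_mem _
    | succ n ih =>
      intro w hwN hw
      have hs : HasSymb n w ((toMat w).map (symb n)) := ⟨hw, rfl⟩
      have hP := hN n _ w hwN hs
      -- The part of degree `n` of the combination.
      let π : PolMat →ₗ[ℂ] PolMat := (MvPolynomial.homogeneousComponent n).mapMatrix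
      have hπ : ∀ m v P, HasSymb m v P → π P = if m = n then P else 0 := by
        intro m v P h
        ext1 i j
        change MvPolynomial.homogeneousComponent n (P i j) = _
        rw [MvPolynomial.homogeneousComponent_of_mem (h.isHomogeneous i j)]
        by_cases hm : m = n
        · rw [if_pos hm, if_pos hm.symm]
        · rw [if_neg hm, if_neg (Ne.symm hm)]; rfl
      have hlift : ∃ w' ∈ N, w' ∈ Submodule.span ℂ ((fun k => S k.1 * T k.2) '' J) ∧
          HasSymb n w' (π ((toMat w).map (symb n))) := by
        generalize (toMat w).map (symb n) = P at hP
        induction hP using Submodule.span_induction with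
        | zero => exact ⟨0, zero_mem _, zero_mem _, by rw [map_zero]; exact .zero n⟩
        | add x y _ _ hx hy =>
          obtain ⟨v, h1, h2, h3⟩ := hx
          obtain ⟨v', h1', h2', h3'⟩ := hy
          exact ⟨v + v', add_mem h1 h1', add_mem h2 h2', by rw [map_add]; exact h3.add h3'⟩
        | smul c x _ hx =>
          obtain ⟨v, h1, h2, h3⟩ := hx
          exact ⟨c • v, Submodule.smul_mem _ _ h1, Submodule.smul_mem _ _ h2, by
            rw [map_smul]; exact h3.smul c⟩
        | mem x hx =>
          obtain ⟨k, hk, rfl⟩ := hx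
          have hsk := hasSymb_S_mul_T k.1 k.2
          change ∃ w' ∈ N, _ ∧ HasSymb n w' (π (inv (monPoly k.1) • symT k.2))
          rw [hπ _ _ _ hsk]
          split_ifs with hd
          · exact ⟨_, hJ k hk, Submodule.subset_span ⟨k, hk, rfl⟩, hd ▸ hsk⟩
          · exact ⟨0, zero_mem _, zero_mem _, .zero n⟩
      obtain ⟨w', h1, h2, h3⟩ := hlift
      rw [hπ _ _ _ hs, if_pos rfl] at h3
      have h4 := hs.sub h3
      rw [sub_self] at h4
      have h5 := ih (w - w') (sub_mem hwN h1) fun i j =>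
        mem_filLT_of_symb_eq_zero (h4.mem i j) (congrFun (congrFun h4.eq i) j)
      rw [← sub_add_cancel w w']
      exact add_mem h5 h2
  intro w hw
  choose f hf using fun i j => exists_mem_fil (toMat w i j)
  refine key ((∑ i, ∑ j, f i j) + 1) w hw fun i j => fil_mono ?_ (hf i j)
  exact (Finset.single_le_sum (f := fun j => f i j) (fun _ _ => Nat.zero_le _)
    (Finset.mem_univ j)).trans (Finset.single_le_sum (f := fun i => ∑ j, f i j)
      (fun _ _ => Nat.zero_le _) (Finset.mem_univ i))

lemma inv_mem_span (q : Inv) :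
    inv q ∈ Submodule.span ℂ (Set.range fun n : Fin 4 → ℕ => inv (monPoly n)) := by
  have : q ∈ Submodule.span ℂ (Set.range monPoly) := by
    have h : monPoly = MvPolynomial.basisMonomials (Fin 4) ℂ ∘ Finsupp.equivFunOnFinite.symm :=
      funext monPoly_eq
    rw [h, Set.range_comp, Finsupp.equivFunOnFinite.symm.surjective.range_eq, Set.image_univ]
    exact (MvPolynomial.basisMonomials (Fin 4) ℂ).mem_span q
  have h := Submodule.mem_map_of_mem (f := inv.toLinearMap) this
  rw [Submodule.map_span, ← Set.range_comp] at h
  exact h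

lemma inv_smul_mem_span (q : Inv) (i : Fin 16) {J : Set ((Fin 4 → ℕ) × Fin 16)}
    (hJ : ∀ n, (n, i) ∈ J) :
    inv q • symT i ∈ Submodule.span ℂ ((fun k => inv (monPoly k.1) • symT k.2) '' J) := by
  have h := Submodule.mem_map_of_mem 
    (f := (LinearMap.toSpanSingleton Pol PolMat (symT i)).restrictScalars ℂ) (inv_mem_span q)
  rw [Submodule.map_span, ← Set.range_comp] at h
  refine Submodule.span_mono ?_ h
  rintro _ ⟨n, rfl⟩
  exact ⟨(n, i), hJ n, rfl⟩

/-- The elements `S n * T i` span the algebra of invariants. -/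
lemma UCK_le_span :
    UCK.toSubmodule ≤
      Submodule.span ℂ (Set.range fun k : (Fin 4 → ℕ) × Fin 16 => S k.1 * T k.2) := by
  rw [← Set.image_univ]
  refine le_span_of_symb (fun k _ => UCK.mul_mem (S_mem _) (T_mem _)) fun n P w hw h => ?_
  obtain ⟨c, rfl⟩ := (h.uEquivariant hw).exists_comb
  exact sum_mem fun i _ => inv_smul_mem_span _ i fun _ => Set.mem_univ _

lemma toMat_left (v : U) : toMat (v ⊗ₜ 1) 0 0 = v := by
  rw [toMat_tmul, map_one]; simp

/-- The ordered monomials in the generators span `U(𝔤)^K`. -/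
lemma UK_le_span : UK.toSubmodule ≤ Submodule.span ℂ (Set.range mon) := by
  have h := le_span_of_symb (N := UK.toSubmodule.map iU.toLinearMap) (J := {k | k.2 = 0}) ?_ ?_
  · intro v hv
    have h1 := h (Submodule.mem_map_of_mem hv)
    let π : UC →ₗ[ℂ] U := Matrix.entryLinearMap ℂ U 0 0 ∘ₗ toMat.toLinearMap
    have hπ : ∀ v, π (v ⊗ₜ 1) = v := toMat_left
    have h2 := Submodule.mem_map_of_mem (f := π) h1
    rw [Submodule.map_span, ← Set.image_comp] at h2
    have h3 : π (iU v) = v := hπ v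
    change π (iU v) ∈ _ at h2
    rw [h3] at h2
    refine Submodule.span_mono ?_ h2
    rintro _ ⟨⟨n, i⟩, rfl : i = 0, rfl⟩
    refine ⟨n, ?_⟩
    change _ = π (S n * 1)
    rw [mul_one, S_eq, hπ]
  · rintro ⟨n, i⟩ (rfl : i = 0)
    refine ⟨mon n, mon_mem n, ?_⟩
    change mon n ⊗ₜ 1 = S n * 1
    rw [mul_one, S_eq]
  · rintro n P _ ⟨v, hv, rfl⟩ hP
    have hs : HasSymb n (v ⊗ₜ 1) P := hP
    have hv' : v ∈ fil n := by
      have := hs.mem 0 0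
      rwa [toMat_left] at this
    obtain ⟨q, hq⟩ := exists_symb_eq_inv hv hv'
    have : P = inv q • symT 0 := by
      rw [← hs.eq, ← hq]
      exact (HasSymb.left ⟨hv', rfl⟩).eq
    rw [this]
    exact inv_smul_mem_span q 0 fun _ => rfl

/-! ### Commutativity of `U(𝔤)^K` -/

lemma trg_bas : trg H₁ = H₁ ∧ trg H₂ = H₂ ∧ trg H = H ∧ trg E = F ∧ trg F = E ∧
    trg E₁ = F₁ ∧ trg E₂ = F₂ ∧ trg F₁ = E₁ ∧ trg F₂ = E₂ := by
  refine ⟨?_, ?_, ?_, ?_, ?_, ?_, ?_, ?_, ?_⟩ <;>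
  · apply Subtype.ext
    rw [trg_coe]
    ext i j
    fin_cases i <;> fin_cases j <;> simp [H, H₁, H₂, E, F, E₁, E₂, F₁, F₂]

lemma trU_two : trU 2 = 2 := by
  rw [← map_ofNat (algebraMap ℂ U) 2, trU_algebraMap]

/-- The transposition fixes the first three generators, and it maps the last one to the contraction
of `z` and `Yy` with the entries of `Y` to the right of those of `y`. -/
lemma trU_gen_mem (i : Fin 4) : trU (gen i) ∈ UK := by
  obtain ⟨h1, h2, h3, h4, h5, h6, h7, h8, h9⟩ := trg_bas
  fin_cases i
  · change trU (gen 0) ∈ UK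
    have : trU (gen 0) = gen 0 := by
      change trU (u H₁ + u H₂) = u H₁ + u H₂
      rw [map_add, trU_u, trU_u, h1, h2]
    rw [this]; exact gen_mem 0
  · change trU (gen 1) ∈ UK
    have : trU (gen 1) = gen 1 := by
      change trU (u H ^ 2 + 2 * (u E * u F + u F * u E)) = u H ^ 2 + 2 * (u E * u F + u F * u E)
      rw [map_add, trU_pow, trU_mul, map_add, trU_mul, trU_mul, trU_two, trU_u, trU_u, trU_u, h3,
        h4, h5]
      noncomm_ring
    rw [this]; exact gen_mem 1
  · change trU (gen 2) ∈ UK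
    have : trU (gen 2) = gen 2 := by
      change trU (u E₁ * u F₁ + u E₂ * u F₂) = u E₁ * u F₁ + u E₂ * u F₂
      rw [map_add, trU_mul, trU_mul, trU_u, trU_u, trU_u, trU_u, h6, h7, h8, h9]
    rw [this]; exact gen_mem 2
  · change trU (gen 3) ∈ UK
    refine mem_UK fun x a b h => ?_
    have e : trU (gen 3) = rowU 0 * (colU 0 * matU 0 0 + colU 1 * matU 0 1) +
        rowU 1 * (colU 0 * matU 1 0 + colU 1 * matU 1 1) := by
      change trU (2 * u E * u E₂ * u F₁ + u H * u E₁ * u F₁ - u H * u E₂ * u F₂ +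
        2 * u F * u E₁ * u F₂) = u E₁ * (u F₁ * u H + u F₂ * (2 * u F)) +
          u E₂ * (u F₁ * (2 * u E) + u F₂ * -u H)
      simp only [map_add, map_sub, trU_mul, trU_two, trU_u, h3, h4, h5, h6, h7, h8, h9]
      noncomm_ring
    rw [e]
    exact h.isRow_rowU.mul_col h.mul_eq (h.isCol_colU.mul_mat h.mul_eq h.isMat_matU)

lemma trU_mem {v : U} (hv : v ∈ UK) : trU v ∈ UK := by
  have h := Submodule.mem_map_of_mem (f := trU) (UK_le_span hv)
  rw [Submodule.map_span, ← Set.range_comp] at h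
  refine (Submodule.span_le.2 ?_ : _ ≤ UK.toSubmodule) h
  rintro _ ⟨n, rfl⟩
  change trU (mon n) ∈ UK
  simp only [mon, trU_mul, trU_pow]
  exact mul_mem (pow_mem (trU_gen_mem 3) _) (mul_mem (pow_mem (trU_gen_mem 2) _)
    (mul_mem (pow_mem (trU_gen_mem 1) _) (pow_mem (trU_gen_mem 0) _)))

/-- The transposition fixes the invariants: on the invariants of degree at most `n` it is the
identity up to invariants of lower degree, and it is an involution. -/
lemma trU_eq {v : U} (hv : v ∈ UK) : trU v = v := by
  have key : ∀ n v, v ∈ UK → v ∈ filLT n → trU v = v := by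
    intro n
    induction n with
    | zero => intro v _ h; rw [(Submodule.mem_bot ℂ).1 h, map_zero]
    | succ n ih =>
      intro v hv hn
      obtain ⟨h1, h2⟩ := trU_symb hn
      obtain ⟨q, hq⟩ := exists_symb_eq_inv hv hn
      have h3 := ih (trU v - v) (sub_mem (trU_mem hv) hv)
        (mem_filLT_of_symb_eq_zero (sub_mem h1 hn) (by rw [map_sub, h2, hq, trPol_inv, sub_self]))
      rw [map_sub, trU_trU] at h3
      have h4 : (2 : ℂ) • (trU v - v) = 0 := by
        rw [two_smul]; nth_rewrite 1 [← h3]; abel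
      exact sub_eq_zero.1 ((smul_eq_zero.1 h4).resolve_left two_ne_zero)
  obtain ⟨n, hn⟩ := exists_mem_fil v
  exact key (n + 1) v hv hn

/-- The algebra `U(𝔤)^K` is commutative, since an anti-automorphism fixes it pointwise. -/
lemma UK_mul_comm (v w : UK) : v * w = w * v := by
  apply Subtype.ext
  have h := trU_eq (v * w).2
  change trU (v.1 * w.1) = v.1 * w.1 at h
  rw [trU_mul, trU_eq v.2, trU_eq w.2] at h
  exact h.symm

/-! ### Bases of the invariants -/

lemma HasSymb.of_lt {m n : ℕ} {w : UC} {P : PolMat} (h : HasSymb m w P) (hmn : m < n) :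
    HasSymb n w 0 := by
  refine ⟨fun i j => fil_mono hmn.le (h.mem i j), ?_⟩
  ext1 i j
  exact symb_of_lt (h.mem i j) hmn

lemma HasSymb.sum {ι : Type*} {n : ℕ} {s : Finset ι} {w : ι → UC} {P : ι → PolMat}
    (h : ∀ i ∈ s, HasSymb n (w i) (P i)) : HasSymb n (∑ i ∈ s, w i) (∑ i ∈ s, P i) := by
  classical
  induction s using Finset.induction_on with
  | empty => exact .zero n
  | insert i s hi ih =>
    rw [Finset.sum_insert hi, Finset.sum_insert hi]
    exact (h i (Finset.mem_insert_self i s)).add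
      (ih fun j hj => h j (Finset.mem_insert_of_mem hj))

/-- The symbols of the elements `S n * T i` are linearly independent. -/
lemma symb_linearIndependent : LinearIndependent ℂ
    fun k : (Fin 4 → ℕ) × Fin 16 => inv (monPoly k.1) • symT k.2 := by
  let L : (Fin 16 → Inv) →ₗ[ℂ] PolMat :=
    { toFun := fun c => ∑ i, inv (c i) • symT i
      map_add' := fun c d => by
        simp only [Pi.add_apply, map_add, add_smul, Finset.sum_add_distrib]
      map_smul' := fun r c => by
        simp only [Pi.smul_apply, map_smul, smul_assoc, Finset.smul_sum, RingHom.id_apply] }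
  let b := Pi.basis fun _ : Fin 16 => MvPolynomial.basisMonomials (Fin 4) ℂ
  have h := b.linearIndependent.map' L
    (LinearMap.ker_eq_bot'.2 fun c hc => symT_independent c hc)
  have h2 := h.comp (fun k : (Fin 4 → ℕ) × Fin 16 => ⟨k.2, Finsupp.equivFunOnFinite.symm k.1⟩) (by
    rintro ⟨n, i⟩ ⟨n', i'⟩ h
    simp only [Sigma.mk.injEq, heq_eq_eq, EmbeddingLike.apply_eq_iff_eq] at h
    exact Prod.ext h.2 h.1)
  have e : ∀ k : (Fin 4 → ℕ) × Fin 16, L (b ⟨k.2, Finsupp.equivFunOnFinite.symm k.1⟩) =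
      inv (monPoly k.1) • symT k.2 := by
    intro k
    change ∑ i, inv (b ⟨k.2, _⟩ i) • symT i = _
    rw [Finset.sum_eq_single k.2]
    · rw [Pi.basis_apply, Pi.single_eq_same, ← monPoly_eq]
    · intro i _ hi
      rw [Pi.basis_apply, Pi.single_eq_of_ne hi, map_zero, zero_smul]
    · exact fun h => absurd (Finset.mem_univ _) h
  simp only [Function.comp_def, e] at h2
  exact h2

/-- The elements `S n * T i` are linearly independent: consider the symbol of highest degree of a
linear relation. -/
lemma S_mul_T_linearIndependent : LinearIndependent ℂ
    fun k : (Fin 4 → ℕ) × Fin 16 => S k.1 * T k.2 := by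
  rw [linearIndependent_iff']
  intro s c hc
  by_contra! hne
  obtain ⟨k₁, hk₁, hck₁⟩ := hne
  let d : (Fin 4 → ℕ) × Fin 16 → ℕ := fun k => monDeg k.1 + degT k.2
  obtain ⟨k₀, hk₀, hmax⟩ := (s.filter fun k => c k ≠ 0).exists_max_image d
    ⟨k₁, Finset.mem_filter.2 ⟨hk₁, hck₁⟩⟩
  obtain ⟨hk₀s, hck₀⟩ := Finset.mem_filter.1 hk₀
  have h1 : ∀ k ∈ s, HasSymb (d k₀) (c k • (S k.1 * T k.2))
      ((if d k = d k₀ then c k else 0) • inv (monPoly k.1) • symT k.2) := by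
    intro k hk
    by_cases hck : c k = 0
    · rw [hck, ite_self, zero_smul, zero_smul]; exact .zero _
    have hs : HasSymb (d k) _ _ := hasSymb_S_mul_T k.1 k.2
    rcases (hmax k (Finset.mem_filter.2 ⟨hk, hck⟩)).lt_or_eq with hlt | heq
    · rw [if_neg hlt.ne, zero_smul]
      simpa using (hs.of_lt hlt).smul (c k)
    · rw [if_pos heq, ← heq]
      exact hs.smul (c k)
  have h2 := HasSymb.sum h1
  rw [hc] at h2
  have h3 := h2.eq.symm.trans (HasSymb.zero (d k₀)).eq
  have h4 := linearIndependent_iff'.1 symb_linearIndependent s _ h3 k₀ hk₀s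
  rw [if_pos rfl] at h4
  exact hck₀ h4

instance : Nontrivial U := by
  refine ⟨1, 0, fun h => ?_⟩
  have := symb_one
  rw [h, map_zero] at this
  exact zero_ne_one this

/-- The elements of `T̃`, as elements of the algebra of invariants. -/
def TK (i : Fin 16) : UCK := ⟨T i, T_mem i⟩

lemma TK_linearIndependent : LinearIndependent UK TK := by
  rw [Fintype.linearIndependent_iff]
  intro v hv
  have hc : ∀ i, ∃ c : (Fin 4 → ℕ) →₀ ℂ, (c.sum fun n z => z • mon n) = (v i).1 := fun i =>
    Finsupp.mem_span_range_iff_exists_finsupp.1 (UK_le_span (v i).2)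
  choose c hc using hc
  let s : Finset (Fin 4 → ℕ) := Finset.univ.biUnion fun i => (c i).support
  have hs : ∀ i, (v i).1 = ∑ n ∈ s, c i n • mon n := fun i => by
    rw [← hc i]
    exact Finsupp.sum_of_support_subset _
      (Finset.subset_biUnion_of_mem (fun i => (c i).support) (Finset.mem_univ i)) _ (by simp)
  have h1 : ∑ k ∈ s ×ˢ Finset.univ, c k.2 k.1 • (S k.1 * T k.2) = 0 := by
    rw [Finset.sum_product_right]
    have h2 := congrArg UCK.val hv
    rw [map_sum, map_zero] at h2
    rw [← h2]
    refine Finset.sum_congr rfl fun i _ => ?_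
    change _ = ((v i • TK i : UCK) : UC)
    rw [coe_smul, hs i]
    change _ = iU (∑ n ∈ s, c i n • mon n) * T i
    rw [map_sum, Finset.sum_mul]
    refine Finset.sum_congr rfl fun n _ => ?_
    rw [map_smul, smul_mul_assoc, S_eq]
    rfl
  have h3 := linearIndependent_iff'.1 S_mul_T_linearIndependent _ _ h1
  intro i
  apply Subtype.ext
  rw [hs i]
  refine Finset.sum_eq_zero fun n hn => ?_
  rw [h3 (n, i) (Finset.mem_product.2 ⟨hn, Finset.mem_univ i⟩), zero_smul]

lemma TK_span : ⊤ ≤ Submodule.span UK (Set.range TK) := by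
  rintro ⟨w, hw⟩ -
  have key : ∀ w ∈ Submodule.span ℂ (Set.range fun k : (Fin 4 → ℕ) × Fin 16 => S k.1 * T k.2),
      ∃ h : w ∈ UCK, (⟨w, h⟩ : UCK) ∈ Submodule.span UK (Set.range TK) := by
    intro w hw
    induction hw using Submodule.span_induction with
    | zero => exact ⟨zero_mem _, zero_mem _⟩
    | add x y _ _ hx hy =>
      obtain ⟨h1, h2⟩ := hx
      obtain ⟨h3, h4⟩ := hy
      exact ⟨add_mem h1 h3, add_mem h2 h4⟩
    | smul z x _ hx =>
      obtain ⟨h1, h2⟩ := hx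
      refine ⟨Subalgebra.smul_mem _ h1 z, ?_⟩
      convert Submodule.smul_mem _ (algebraMap ℂ UK z) h2 using 1
      apply Subtype.ext
      rw [coe_smul]
      change z • x = iU (algebraMap ℂ U z) * x
      rw [AlgHom.commutes, Algebra.smul_def]
    | mem x hx =>
      obtain ⟨⟨n, i⟩, rfl⟩ := hx
      refine ⟨mul_mem (S_mem n) (T_mem i), ?_⟩
      convert Submodule.smul_mem _ (⟨mon n, mon_mem n⟩ : UK) 
        (Submodule.subset_span (Set.mem_range_self i) : TK i ∈ Submodule.span UK (Set.range TK))
        using 1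
      apply Subtype.ext
      rw [coe_smul, ← S_eq]
      rfl
  exact (key w (UCK_le_span hw)).2

/-- The sixteen elements form a basis over `U(𝔤)^K`. -/
def basisT : Module.Basis (Fin 16) UK UCK := .mk TK_linearIndependent TK_span

/-- The elements `S n * T i`, in the algebra of invariants. -/
def STK (k : (Fin 4 → ℕ) × Fin 16) : UCK := ⟨S k.1 * T k.2, mul_mem (S_mem _) (T_mem _)⟩

lemma STK_span : ⊤ ≤ Submodule.span ℂ (Set.range STK) := by
  rintro w -
  have h : (w : UC) ∈ (Submodule.span ℂ (Set.range STK)).map UCK.val.toLinearMap := by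
    rw [Submodule.map_span, ← Set.range_comp]
    exact UCK_le_span w.2
  obtain ⟨y, hy, hyw⟩ := h
  rwa [← Subtype.ext hyw]

lemma STK_linearIndependent : LinearIndependent ℂ STK := by
  have h : UCK.val.toLinearMap ∘ STK = fun k => S k.1 * T k.2 := rfl
  refine LinearIndependent.of_comp UCK.val.toLinearMap ?_
  rw [h]
  exact S_mul_T_linearIndependent

/-- The elements `S n * T i` form a basis over `ℂ`. -/
def basisST : Module.Basis ((Fin 4 → ℕ) × Fin 16) ℂ UCK :=
  .mk STK_linearIndependent STK_span

/-- Commutativity of `U(𝔤)^K` makes the rank of a free module well defined. -/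
lemma rank_UCK : Module.rank UK UCK = 16 := by
  let _ : CommRing UK := { (inferInstance : Ring UK) with mul_comm := UK_mul_comm }
  have : StrongRankCondition UK := commRing_strongRankCondition UK
  rw [rank_eq_card_basis basisT]
  simp

end SU21

end

theorem mainTheorem2 :
    Module.Free SU21.UK SU21.UCK ∧
    Module.rank SU21.UK SU21.UCK = 16 ∧
    (∃ b : Module.Basis (Fin 16) SU21.UK SU21.UCK, ∀ i, (b i : SU21.UC) = SU21.T i) ∧
    (∃ b : Module.Basis ((Fin 4 → ℕ) × Fin 16) ℂ SU21.UCK,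
      ∀ n i, (b (n, i) : SU21.UC) = SU21.S n * SU21.T i) := by
  refine ⟨.of_basis SU21.basisT, SU21.rank_UCK, ⟨SU21.basisT, fun i => ?_⟩,
    SU21.basisST, fun n i => ?_⟩
  · rw [SU21.basisT, Module.Basis.mk_apply]; rfl
  · rw [SU21.basisST, Module.Basis.mk_apply]; rfl
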